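/- Let $n\ge 2$ and $c\in\mathbb R$, and let $(N,\langle\cdot,\cdot\rangle,J)$ be a Kähler manifold of complex dimension $n$ with constant holomorphic sectional curvature $4c$ (in particular, the complete simply connected complex space form $N^n(4c)$). Let $M$ be a smooth $n$-dimensional manifold immersed in $N$ as a Lagrangian submanifold, i.e. $J$ maps each tangent space of $M$ onto the corresponding normal space; equip $M$ with the induced metric $g$ and its Levi-Civita connection $\nabla$. Let $h$ be the second fundamental form, $H=\frac1n\operatorname{tr}_g h$ the mean curvature vector, and let $$\tilde h(X,Y)=h(X,Y)-\frac{n}{n+2}\big\{\langle X,Y\rangle H+\langle JX,H\rangle JY+\langle JY,H\rangle JX\big\}$$ be the Lagrangian trace-free second fundamental form. Let $\nabla\tilde h$ be its covariant derivative, formed with $\nabla$ and the normal connection. In a local orthonormal frame $\{e_i\}$ of $M$ put $\tilde h^{m^*}_{ij}=\langle\tilde h(e_i,e_j),Je_m\rangle$ and $\tilde h^{m^*}_{ij,k}=\langle(\nabla_{e_k}\tilde h)(e_i,e_j),Je_m\rangle$, and define the $(0,2)$-tensor $T$ by $T_{ij}=\frac1n\sum_m\tilde h^{m^*}_{ij,m}$.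 Let $T_{ij,m}=(\nabla_{e_m}T)(e_i,e_j)$ and $\langle\tilde h,\nabla T\rangle=\sum_{i,j,m}\tilde h^{m^*}_{ij}T_{ij,m}$, let $|\tilde h|^2=\sum_{i,j,m}(\tilde h^{m^*}_{ij})^2$ and $|\nabla\tilde h|^2=\sum_{i,j,k,m}(\tilde h^{m^*}_{ij,k})^2$, and let $\Delta=\operatorname{tr}_g\nabla^2$ be the Laplace–Beltrami operator of $(M,g)$. Then, at every point of $M$, $$\tfrac12\Delta|\tilde h|^2\;\ge\;(n+2)\langle\tilde h,\nabla T\rangle+|\nabla\tilde h|^2+(n+1)c\,|\tilde h|^2+\frac{n^2}{n+2}|\tilde h|^2|H|^2-\frac{n+3}{2}|\tilde h|^4 .$$ -/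

import Mathlib

open scoped Manifold ContDiff

noncomputable section

namespace LagrangianSimons

/-- Coordinate space `ℝᵐ`. -/
abbrev Coord (m : ℕ) : Type := EuclideanSpace ℝ (Fin m)

/-- The `i`-th coordinate vector `∂ᵢ`. -/
def basisVec {m : ℕ} (i : Fin m) : Coord m := EuclideanSpace.single i 1

/-! ### Riemannian geometry of a metric given in local coordinates

`g x u v` is the value at `x` of the metric on the vectors `u`, `v`. Vectors are identified with
constant-coefficient vector fields in the coordinates. -/

section Coordinates

variable {m : ℕ} (g : Coord m → Coord m →L[ℝ] Coord m →L[ℝ] ℝ)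

/-- The Gram matrix `(g_{ij})` at `x`. -/
def gram (x : Coord m) : Matrix (Fin m) (Fin m) ℝ :=
  Matrix.of fun i j => g x (basisVec i) (basisVec j)

/-- The coefficients `g^{ij}` of the inverse metric at `x`. -/
def invMetric (x : Coord m) (i j : Fin m) : ℝ := (gram g x)⁻¹ i j

/-- `g(∇_u v, w) = ½ (∂_u g(v, w) + ∂_v g(u, w) - ∂_w g(u, v))` for constant-coefficient fields. -/
def koszul (x u v w : Coord m) : ℝ :=
  (1 / 2) * (fderiv ℝ g x u v w + fderiv ℝ g x v u w - fderiv ℝ g x w u v)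

/-- The Levi-Civita connection on constant-coefficient fields:
`∇_u v = Γ(u, v) = Γ^k_{ij} u^i v^j ∂_k`. -/
def christoffel (x u v : Coord m) : Coord m :=
  ∑ k, ∑ l, (invMetric g x k l * koszul g x u v (basisVec l)) • basisVec k

/-- The curvature tensor `R(u, v) w = ∇_u ∇_v w - ∇_v ∇_u w - ∇_{[u, v]} w`. -/
def curvature (x u v w : Coord m) : Coord m :=
  fderiv ℝ (fun y => christoffel g y v w) x u - fderiv ℝ (fun y => christoffel g y u w) x v
    + christoffel g x u (christoffel g x v w) - christoffel g x v (christoffel g x u w)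

/-- The covariant derivative `(∇_u J) v` of a field `J` of endomorphisms. -/
def covEnd (J : Coord m → Coord m →L[ℝ] Coord m) (x u v : Coord m) : Coord m :=
  fderiv ℝ (fun y => J y v) x u + christoffel g x u (J x v) - J x (christoffel g x u v)

/-- The Laplace–Beltrami operator `Δ φ = g^{ij} (∂_i ∂_j φ - Γ^k_{ij} ∂_k φ)`. -/
def laplacian (φ : Coord m → ℝ) (x : Coord m) : ℝ :=
  ∑ i, ∑ j, invMetric g x i j *
    (fderiv ℝ (fun y => fderiv ℝ φ y (basisVec j)) x (basisVec i)
      - fderiv ℝ φ x (christoffel g x (basisVec i) (basisVec j)))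

/-- The covariant derivative `(∇_u S)(v, w)` of a `(0, 2)`-tensor field `S`. -/
def covTwoTensor (S : Coord m → Coord m → Coord m → ℝ) (x u v w : Coord m) : ℝ :=
  fderiv ℝ (fun y => S y v w) x u - S x (christoffel g x u v) w - S x v (christoffel g x u w)

end Coordinates

/-! ### Submanifold geometry in local coordinates

`G` and `J` are the ambient metric and almost complex structure in coordinates of the ambient
manifold, and `F` is the coordinate expression of the immersion. -/

section Immersion

variable {n m : ℕ} (G : Coord m → Coord m →L[ℝ] Coord m →L[ℝ] ℝ)
  (J : Coord m → Coord m →L[ℝ] Coord m) (F : Coord n → Coord m)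

/-- The induced metric `g(u, v) = ⟨dF u, dF v⟩`. -/
def indMetric (x : Coord n) : Coord n →L[ℝ] Coord n →L[ℝ] ℝ :=
  (G (F x)).bilinearComp (fderiv ℝ F x) (fderiv ℝ F x)

/-- The normal component of an ambient vector `w` at `F x`. -/
def normalProj (x : Coord n) (w : Coord m) : Coord m :=
  w - ∑ k, ∑ l, (invMetric (indMetric G F) x k l * G (F x) w (fderiv ℝ F x (basisVec l))) •
    fderiv ℝ F x (basisVec k)

/-- The ambient Levi-Civita derivative `∇̄_u Y` of a vector field `Y` along `F`. -/
def covAlong (Y : Coord n → Coord m) (x u : Coord n) : Coord m :=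
  fderiv ℝ Y x u + christoffel G (F x) (fderiv ℝ F x u) (Y x)

/-- The normal connection `∇^⊥_u Y`, for `Y` a normal field along `F`. -/
def normalCov (Y : Coord n → Coord m) (x u : Coord n) : Coord m :=
  normalProj G F x (covAlong G F Y x u)

/-- The second fundamental form `h(u, v)`: the normal component of `∇̄_u v`. -/
def secondFF (x u v : Coord n) : Coord m :=
  normalProj G F x (covAlong G F (fun y => fderiv ℝ F y v) x u)

/-- The mean curvature vector `H = (1 / n) trace h`. -/
def meanCurv (x : Coord n) : Coord m :=
  (1 / (n : ℝ)) • ∑ i, ∑ j,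
    invMetric (indMetric G F) x i j • secondFF G F x (basisVec i) (basisVec j)

/-- The Lagrangian trace-free second fundamental form
`h̃(u, v) = h(u, v) - n / (n + 2) (⟨u, v⟩ H + ⟨J u, H⟩ J v + ⟨J v, H⟩ J u)`. -/
def tfSecondFF (x u v : Coord n) : Coord m :=
  secondFF G F x u v - ((n : ℝ) / ((n : ℝ) + 2)) •
    (indMetric G F x u v • meanCurv G F x
      + G (F x) (J (F x) (fderiv ℝ F x u)) (meanCurv G F x) • J (F x) (fderiv ℝ F x v)
      + G (F x) (J (F x) (fderiv ℝ F x v)) (meanCurv G F x) • J (F x) (fderiv ℝ F x u))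

/-- The covariant derivative `(∇_u h̃)(v, w)`, formed with the normal connection and the
Levi-Civita connection of the induced metric. -/
def covTfSecondFF (x u v w : Coord n) : Coord m :=
  normalCov G F (fun y => tfSecondFF G J F y v w) x u
    - tfSecondFF G J F x (christoffel (indMetric G F) x u v) w
    - tfSecondFF G J F x v (christoffel (indMetric G F) x u w)

/-- `|H|²`. -/
def normSqMeanCurv (x : Coord n) : ℝ := G (F x) (meanCurv G F x) (meanCurv G F x)

/-- `|h̃|²`. -/
def normSqTf (x : Coord n) : ℝ :=
  ∑ i, ∑ i', ∑ j, ∑ j', invMetric (indMetric G F) x i i' * invMetric (indMetric G F) x j j' *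
    G (F x) (tfSecondFF G J F x (basisVec i) (basisVec j))
      (tfSecondFF G J F x (basisVec i') (basisVec j'))

/-- `|∇h̃|²`. -/
def normSqCovTf (x : Coord n) : ℝ :=
  ∑ k, ∑ k', ∑ i, ∑ i', ∑ j, ∑ j',
    invMetric (indMetric G F) x k k' * invMetric (indMetric G F) x i i' *
      invMetric (indMetric G F) x j j' *
    G (F x) (covTfSecondFF G J F x (basisVec k) (basisVec i) (basisVec j))
      (covTfSecondFF G J F x (basisVec k') (basisVec i') (basisVec j'))

/-- The tensor `T`; in an orthonormal frame `T(v, w) = (1 / n) ∑_m ⟨(∇_{e_m} h̃)(v, w), J e_m⟩`. -/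
def tensorT (x v w : Coord n) : ℝ :=
  (1 / (n : ℝ)) * ∑ k, ∑ l, invMetric (indMetric G F) x k l *
    G (F x) (covTfSecondFF G J F x (basisVec k) v w) (J (F x) (fderiv ℝ F x (basisVec l)))

/-- `⟨h̃, ∇T⟩`; in an orthonormal frame it is
`∑_{i, j, m} ⟨h̃(e_i, e_j), J e_m⟩ (∇_{e_m} T)(e_i, e_j)`. -/
def innerTfCovT (x : Coord n) : ℝ :=
  ∑ k, ∑ k', ∑ i, ∑ i', ∑ j, ∑ j',
    invMetric (indMetric G F) x k k' * invMetric (indMetric G F) x i i' *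
      invMetric (indMetric G F) x j j' *
    G (F x) (tfSecondFF G J F x (basisVec i) (basisVec j)) (J (F x) (fderiv ℝ F x (basisVec k))) *
    covTwoTensor (indMetric G F) (tensorT G J F) x (basisVec k') (basisVec i') (basisVec j')

end Immersion

/-! ### Complex space forms and Lagrangian immersions -/

section Manifolds

variable {m : ℕ} {N : Type*} [TopologicalSpace N] [ChartedSpace (Coord m) N]

/-- The differential at `y` of the inverse `ψ⁻¹` of the chart `ψ`. -/
def chartSymmDeriv (ψ : OpenPartialHomeomorph N (Coord m)) (y : Coord m) :
    Coord m →L[ℝ] TangentSpace (𝓡 m) (ψ.symm y) :=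
  mfderiv 𝓘(ℝ, Coord m) (𝓡 m) ψ.symm y

/-- The differential at `q` of the chart `ψ`. -/
def chartDeriv (ψ : OpenPartialHomeomorph N (Coord m)) (q : N) :
    TangentSpace (𝓡 m) q →L[ℝ] Coord m :=
  mfderiv (𝓡 m) 𝓘(ℝ, Coord m) ψ q

/-- The coordinate expression `(u, v) ↦ ⟨dψ⁻¹ u, dψ⁻¹ v⟩` of a Riemannian metric in the
chart `ψ`. -/
def metricInChart [IsManifold (𝓡 m) ∞ N]
    (g : Bundle.ContMDiffRiemannianMetric (𝓡 m) ∞ (Coord m)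
      (fun q : N => TangentSpace (𝓡 m) q))
    (ψ : OpenPartialHomeomorph N (Coord m)) (y : Coord m) : Coord m →L[ℝ] Coord m →L[ℝ] ℝ :=
  ContinuousLinearMap.bilinearComp
    (E := Coord m) (F := Coord m) (E' := Coord m) (F' := Coord m)
    (g.inner (ψ.symm y)) (chartSymmDeriv ψ y) (chartSymmDeriv ψ y)

/-- The coordinate expression `dψ ∘ J ∘ dψ⁻¹` of a field `J` of endomorphisms of the tangent
bundle in the chart `ψ`. -/
def endInChart (J : ∀ q : N, TangentSpace (𝓡 m) q →L[ℝ] TangentSpace (𝓡 m) q)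
    (ψ : OpenPartialHomeomorph N (Coord m)) (y : Coord m) : Coord m →L[ℝ] Coord m :=
  (chartDeriv ψ (ψ.symm y)).comp ((J (ψ.symm y)).comp (chartSymmDeriv ψ y))

variable (n : ℕ) (c : ℝ) (N : Type*) [TopologicalSpace N] [ChartedSpace (Coord (2 * n)) N]
  [IsManifold (𝓡 (2 * n)) ∞ N]

/-- The structure of a Kähler manifold of complex dimension `n` and constant holomorphic sectional
curvature `4c` on a smooth manifold of real dimension `2n`: a Riemannian metric and an orthogonal
almost complex structure that is parallel for the Levi-Civita connection, such that
`⟨R(v, Jv)Jv, v⟩ = 4c |v|⁴` for all tangent vectors `v`. The two tensorial conditions that involve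
the connection are expressed in local coordinates. -/
structure ComplexSpaceForm where
  /-- the Riemannian metric -/
  metric : Bundle.ContMDiffRiemannianMetric (𝓡 (2 * n)) ∞ (Coord (2 * n))
    (fun q : N => TangentSpace (𝓡 (2 * n)) q)
  /-- the complex structure -/
  J : ∀ q : N, TangentSpace (𝓡 (2 * n)) q →L[ℝ] TangentSpace (𝓡 (2 * n)) q
  J_smooth : ContMDiff (𝓡 (2 * n))
    ((𝓡 (2 * n)).prod 𝓘(ℝ, Coord (2 * n) →L[ℝ] Coord (2 * n))) ∞
    (fun q : N => Bundle.TotalSpace.mk' (Coord (2 * n) →L[ℝ] Coord (2 * n))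
      (E := fun q : N => TangentSpace (𝓡 (2 * n)) q →L[ℝ] TangentSpace (𝓡 (2 * n)) q) q (J q))
  J_sq : ∀ (q : N) (v : TangentSpace (𝓡 (2 * n)) q), J q (J q v) = -v
  J_orthogonal : ∀ (q : N) (v w : TangentSpace (𝓡 (2 * n)) q),
    metric.inner q (J q v) (J q w) = metric.inner q v w
  J_parallel : ∀ ψ ∈ IsManifold.maximalAtlas (𝓡 (2 * n)) ∞ N, ∀ y ∈ ψ.target,
    ∀ u v : Coord (2 * n), covEnd (metricInChart metric ψ) (endInChart J ψ) y u v = 0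
  holomorphic_sectional_curvature : ∀ ψ ∈ IsManifold.maximalAtlas (𝓡 (2 * n)) ∞ N, ∀ y ∈ ψ.target,
    ∀ v : Coord (2 * n),
      metricInChart metric ψ y
        (curvature (metricInChart metric ψ) y v (endInChart J ψ y v) (endInChart J ψ y v)) v
      = 4 * c * (metricInChart metric ψ y v v) ^ 2

variable {n c N}

/-- A smooth immersion `f` of an `n`-manifold is Lagrangian if `J` maps each tangent space
`df(T_pM)` (isometrically, as `J` is orthogonal) onto the normal space `df(T_pM)^⊥`. -/
structure IsLagrangianImmersion (S : ComplexSpaceForm n c N)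
    {M : Type*} [TopologicalSpace M] [ChartedSpace (Coord n) M] (f : M → N) : Prop where
  smooth : ContMDiff (𝓡 n) (𝓡 (2 * n)) ∞ f
  immersion : ∀ p : M, Function.Injective (mfderiv (𝓡 n) (𝓡 (2 * n)) f p)
  lagrangian : ∀ (p : M) (w : TangentSpace (𝓡 (2 * n)) (f p)),
    (∃ v : TangentSpace (𝓡 n) p, S.J (f p) (mfderiv (𝓡 n) (𝓡 (2 * n)) f p v) = w) ↔
      ∀ u : TangentSpace (𝓡 n) p,
        S.metric.inner (f p) (mfderiv (𝓡 n) (𝓡 (2 * n)) f p u) w = 0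

end Manifolds

end LagrangianSimons

end

/-!
The second fundamental form of a Lagrangian immersion is encoded by the cubic form
`C(u, v, w) = ⟨h(u, v), J w⟩`. It is symmetric because `J` is parallel, and so is its covariant
derivative, by the Codazzi equation and the form of the curvature tensor of the ambient space.
The trace-free form `h̃` is the orthogonal projection of `C` onto the trace-free cubic forms, and
the remaining part of `C` is the symmetric product of the metric with a multiple of the trace of
`C`. Being parallel, this splitting is respected by `∇`.

Since `∇C` is symmetric, `Δ C` equals the Hessian of the trace of `C` up to the commutator of two
covariant derivatives, which the Gauss equation expresses algebraically in `c` and `C`. Pairing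
with `h̃` turns the trace term into `(n + 2)⟨h̃, ∇T⟩`. In an orthonormal frame the slices of `h̃`
are symmetric trace-free matrices `Aᵢ` with Gram matrix `G = (tr(AᵢAⱼ))ᵢⱼ`, and the quartic terms
`∑ |[Aᵢ, Aⱼ]|²` and `|G|²` are compared by means of `|[A, B]|² ≤ 2(|A|²|B|² - tr(AB)²)`. The terms
that mix `h̃` with the mean curvature vector are absorbed by the square `|G + 2B|² ≥ 0`, where `B`
is the contraction of `h̃` with `nH/(n + 2)`.
-/

noncomputable section

namespace LagrangianSimons

set_option maxSynthPendingDepth 5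

/-! ### Connections on trivial bundles -/

section Connections

variable {E X W : Type*} [NormedAddCommGroup E] [NormedSpace ℝ E]
  [NormedAddCommGroup X] [NormedSpace ℝ X] [NormedAddCommGroup W] [NormedSpace ℝ W]

/-- The covariant derivative `u ↦ ∇_u s = ∂_u s + ρ(u) s` of a section `s` of the trivial bundle
with fibre `W`, for the connection with connection form `ρ`. -/
def connDeriv (ρ : E → E →L[ℝ] W →L[ℝ] W) (s : E → W) (x : E) : E →L[ℝ] W :=
  fderiv ℝ s x + (ρ x).flip (s x)

/-- The curvature `dρ + ρ ∧ ρ` of the connection with connection form `ρ`. -/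
def connCurvature (ρ : E → E →L[ℝ] W →L[ℝ] W) (x u v : E) : W →L[ℝ] W :=
  fderiv ℝ ρ x u v - fderiv ℝ ρ x v u + (ρ x u).comp (ρ x v) - (ρ x v).comp (ρ x u)

/-- The connection form induced by `Γ` and `ρ` on the bundle of homomorphisms from `X` to `W`. -/
def homConn (Γ : E → E →L[ℝ] X →L[ℝ] X) (ρ : E → E →L[ℝ] W →L[ℝ] W) (x : E) :
    E →L[ℝ] (X →L[ℝ] W) →L[ℝ] X →L[ℝ] W :=
  (ContinuousLinearMap.compL ℝ X W W).comp (ρ x)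
    - (ContinuousLinearMap.compL ℝ X X W).flip.comp (Γ x)

/-- The pullback under `F` of the connection form `ρ`. -/
def pullbackConn (ρ : X → X →L[ℝ] W →L[ℝ] W) (F : E → X) (x : E) : E →L[ℝ] W →L[ℝ] W :=
  (ρ (F x)).comp (fderiv ℝ F x)

/-- The pairing `β` on the fibre `W` is parallel at `x`, that is, `∇` satisfies the product rule for
`β`. -/
def IsParallelPairing (ρ : E → E →L[ℝ] W →L[ℝ] W) (β : E → W →L[ℝ] W →L[ℝ] ℝ) (x : E) : Prop :=
  ∀ u a b, fderiv ℝ β x u a b = β x (ρ x u a) b + β x a (ρ x u b)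

/-- The bundle map `τ` is parallel at `x`, that is, it commutes with covariant differentiation. -/
def IsParallelMap (ρ : E → E →L[ℝ] X →L[ℝ] X) (σ : E → E →L[ℝ] W →L[ℝ] W) (τ : E → X →L[ℝ] W)
    (x : E) : Prop :=
  ∀ u a, fderiv ℝ τ x u a = τ x (ρ x u a) - σ x u (τ x a)

/-- Composition with `φ` and `ψ` in the two arguments of a bilinear form. -/
def bilinearCompL (φ ψ : X →L[ℝ] W) : (W →L[ℝ] W →L[ℝ] ℝ) →L[ℝ] X →L[ℝ] X →L[ℝ] ℝ :=
  (ContinuousLinearMap.compL ℝ X W (X →L[ℝ] ℝ)).flip φ ∘L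
    ContinuousLinearMap.compL ℝ W (W →L[ℝ] ℝ) (X →L[ℝ] ℝ)
      ((ContinuousLinearMap.compL ℝ X W ℝ).flip ψ)

variable {Γ : E → E →L[ℝ] X →L[ℝ] X} {ρ : E → E →L[ℝ] W →L[ℝ] W} {s : E → W} {x : E} {V : Set E}

lemma differentiableAt_of_contDiffOn (hV : IsOpen V) (hx : x ∈ V) (hs : ContDiffOn ℝ ∞ s V) :
    DifferentiableAt ℝ s x :=
  (hs.contDiffAt (hV.mem_nhds hx)).differentiableAt (by simp)

lemma fderiv_clm_apply_apply {L : E → X →L[ℝ] W} {t : E → X} (hL : DifferentiableAt ℝ L x)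
    (ht : DifferentiableAt ℝ t x) (u : E) :
    fderiv ℝ (fun y => L y (t y)) x u = fderiv ℝ L x u (t x) + L x (fderiv ℝ t x u) := by
  simp [fderiv_clm_apply hL ht, add_comm]

lemma fderiv_clm_apply_const {L : E → X →L[ℝ] W} (hL : DifferentiableAt ℝ L x) (u : E) (a : X) :
    fderiv ℝ (fun y => L y a) x u = fderiv ℝ L x u a := by
  simp [fderiv_clm_apply_apply hL (differentiableAt_const a)]

lemma fderiv_apply_apply_comm {B : E → X →L[ℝ] X →L[ℝ] W} (hB : DifferentiableAt ℝ B x)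
    (hsymm : ∀ᶠ y in nhds x, ∀ a b, B y a b = B y b a) (u : E) (a b : X) :
    fderiv ℝ B x u a b = fderiv ℝ B x u b a := by
  have hBv : ∀ v, DifferentiableAt ℝ (fun y => B y v) x := fun v =>
    hB.clm_apply (differentiableAt_const v)
  have hcongr : (fun y => B y a b) =ᶠ[nhds x] fun y => B y b a := hsymm.mono fun y hy => hy a b
  rw [← fderiv_clm_apply_const hB, ← fderiv_clm_apply_const (hBv a), hcongr.fderiv_eq,
    fderiv_clm_apply_const (hBv b), fderiv_clm_apply_const hB]

lemma connDeriv_apply (ρ : E → E →L[ℝ] W →L[ℝ] W) (s : E → W) (x u : E) :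
    connDeriv ρ s x u = fderiv ℝ s x u + ρ x u (s x) := rfl

@[simp]
lemma homConn_apply (Γ : E → E →L[ℝ] X →L[ℝ] X) (ρ : E → E →L[ℝ] W →L[ℝ] W) (x u : E)
    (φ : X →L[ℝ] W) (a : X) : homConn Γ ρ x u φ a = ρ x u (φ a) - φ (Γ x u a) := rfl

lemma connDeriv_congr {t : E → W} (hst : s =ᶠ[nhds x] t) :
    connDeriv ρ s x = connDeriv ρ t x := by
  rw [connDeriv, connDeriv, hst.fderiv_eq, hst.eq_of_nhds]

lemma connDeriv_apply_apply_comm {B : E → X →L[ℝ] X →L[ℝ] W} (hB : DifferentiableAt ℝ B x)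
    (hsymm : ∀ᶠ y in nhds x, ∀ a b, B y a b = B y b a) (u : E) (a b : X) :
    connDeriv (homConn Γ (homConn Γ ρ)) B x u a b
      = connDeriv (homConn Γ (homConn Γ ρ)) B x u b a := by
  simp only [connDeriv_apply, add_apply, sub_apply, homConn_apply,
    fderiv_apply_apply_comm hB hsymm u a b, hsymm.self_of_nhds a, hsymm.self_of_nhds (Γ x u a)]
  abel

lemma contDiffOn_connDeriv (hV : IsOpen V) (hρ : ContDiffOn ℝ ∞ ρ V) (hs : ContDiffOn ℝ ∞ s V) :
    ContDiffOn ℝ ∞ (connDeriv ρ s) V := by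
  have hflip : ContDiffOn ℝ ∞ (fun y => (ρ y).flip) V :=
    (ContinuousLinearMap.flipₗᵢ ℝ E W W).contDiff.comp_contDiffOn hρ
  exact (hs.fderiv_of_isOpen hV (by simp)).add (hflip.clm_apply hs)

lemma contDiffOn_homConn (hΓ : ContDiffOn ℝ ∞ Γ V) (hρ : ContDiffOn ℝ ∞ ρ V) :
    ContDiffOn ℝ ∞ (homConn Γ ρ) V :=
  (contDiffOn_const.clm_comp hρ).sub (contDiffOn_const.clm_comp hΓ)

lemma connDeriv_apply_const {φ : E → X →L[ℝ] W} (hφ : DifferentiableAt ℝ φ x) (u : E) (a : X) :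
    connDeriv (homConn Γ ρ) φ x u a
      = connDeriv ρ (fun y => φ y a) x u - φ x (Γ x u a) := by
  simp only [connDeriv_apply, fderiv_clm_apply_const hφ, add_apply, homConn_apply]
  abel

lemma connDeriv_const_smul (hs : DifferentiableAt ℝ s x) (r : ℝ) (u : E) :
    connDeriv ρ (fun y => r • s y) x u = r • connDeriv ρ s x u := by
  simp [connDeriv_apply, fderiv_fun_const_smul hs]

lemma connDeriv_apply_const_apply_const {B : E → X →L[ℝ] X →L[ℝ] W} (hB : DifferentiableAt ℝ B x)
    (u : E) (a b : X) :
    connDeriv (homConn Γ (homConn Γ ρ)) B x u a b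
      = connDeriv ρ (fun y => B y a b) x u - B x (Γ x u a) b - B x a (Γ x u b) := by
  rw [connDeriv_apply_const hB, sub_apply,
    connDeriv_apply_const (hB.clm_apply (differentiableAt_const a))]
  abel

namespace IsParallelMap

lemma connDeriv_comm {τ : E → X →L[ℝ] W} {t : E → X} (h : IsParallelMap Γ ρ τ x)
    (hτ : DifferentiableAt ℝ τ x) (ht : DifferentiableAt ℝ t x) (u : E) :
    connDeriv ρ (fun y => τ y (t y)) x u = τ x (connDeriv Γ t x u) := by
  simp only [connDeriv_apply, fderiv_clm_apply_apply hτ ht, h u, map_add]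
  abel

lemma of_const {τ : X →L[ℝ] W} (h : ∀ u a, ρ x u (τ a) = τ (Γ x u a)) :
    IsParallelMap Γ ρ (fun _ => τ) x := fun u a => by
  simp [h]

lemma connDeriv_connDeriv_comm {Λ : E → E →L[ℝ] E →L[ℝ] E} {τ : E → X →L[ℝ] W} {t : E → X}
    (hV : IsOpen V) (hx : x ∈ V) (h : ∀ y ∈ V, IsParallelMap Γ ρ τ y) (hΓ : ContDiffOn ℝ ∞ Γ V)
    (hρ : ContDiffOn ℝ ∞ ρ V) (hτ : ContDiffOn ℝ ∞ τ V) (ht : ContDiffOn ℝ ∞ t V) (u v : E) :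
    connDeriv (homConn Λ ρ) (connDeriv ρ fun y => τ y (t y)) x u v
      = τ x (connDeriv (homConn Λ Γ) (connDeriv Γ t) x u v) := by
  have hDt := differentiableAt_of_contDiffOn hV hx (contDiffOn_connDeriv hV hΓ ht)
  have hDτt := differentiableAt_of_contDiffOn hV hx
    (contDiffOn_connDeriv hV hρ (hτ.clm_apply ht))
  have hcomm : ∀ y ∈ V, ∀ w, connDeriv ρ (fun z => τ z (t z)) y w = τ y (connDeriv Γ t y w) :=
    fun y hy => (h y hy).connDeriv_comm (differentiableAt_of_contDiffOn hV hy hτ)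
      (differentiableAt_of_contDiffOn hV hy ht)
  have hcongr : (fun y => connDeriv ρ (fun z => τ z (t z)) y v)
      =ᶠ[nhds x] fun y => τ y (connDeriv Γ t y v) := by
    filter_upwards [hV.mem_nhds hx] with y hy using hcomm y hy v
  rw [connDeriv_apply_const hDτt, connDeriv_apply_const hDt, connDeriv_congr hcongr, hcomm x hx,
    (h x hx).connDeriv_comm (differentiableAt_of_contDiffOn hV hx hτ)
      (hDt.clm_apply (differentiableAt_const v)), map_sub]

lemma comp {Y : Type*} [NormedAddCommGroup Y] [NormedSpace ℝ Y] {σ : E → E →L[ℝ] Y →L[ℝ] Y}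
    {τ : E → X →L[ℝ] W} {φ : E → W →L[ℝ] Y} (hφ : IsParallelMap ρ σ φ x)
    (hτ : IsParallelMap Γ ρ τ x) (hφx : DifferentiableAt ℝ φ x) (hτx : DifferentiableAt ℝ τ x) :
    IsParallelMap Γ σ (fun y => (φ y).comp (τ y)) x := fun u a => by
  rw [fderiv_clm_comp hφx hτx]
  simp [hτ u a, hφ u (τ x a)]

lemma id_sub_const_smul {τ : E → W →L[ℝ] W} (hτ : IsParallelMap ρ ρ τ x)
    (hτx : DifferentiableAt ℝ τ x) (r : ℝ) :
    IsParallelMap ρ ρ (fun y => .id ℝ W - r • τ y) x := fun u a => by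
  rw [fderiv_const_sub, fderiv_fun_const_smul hτx]
  simp only [neg_apply, smul_apply, hτ u a, sub_apply, ContinuousLinearMap.id_apply, map_sub,
    map_smul, smul_sub]
  abel

lemma smulRight {b : E → W} (hb : DifferentiableAt ℝ b x) (hpar : connDeriv ρ b x = 0) :
    IsParallelMap (homConn Γ 0) (homConn Γ ρ)
      (fun y => (ContinuousLinearMap.smulRightL ℝ X W).flip (b y)) x := fun u l => by
  have hbu : fderiv ℝ b x u = -ρ x u (b x) :=
    eq_neg_of_add_eq_zero_left (congrArg (fun L : E →L[ℝ] W => L u) hpar)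
  have hderiv := ((ContinuousLinearMap.smulRightL ℝ X W).flip.hasFDerivAt.comp x
    hb.hasFDerivAt).fderiv
  simp only [Function.comp_def] at hderiv
  ext a
  simp [hderiv, hbu]
  abel

end IsParallelMap

lemma map_connDeriv_of_map_eq {τ : W →L[ℝ] W} (hρ : ∀ u a, ρ x u (τ a) = τ (ρ x u a))
    (hs : DifferentiableAt ℝ s x) (hτ : ∀ᶠ y in nhds x, τ (s y) = s y) (u : E) :
    τ (connDeriv ρ s x u) = connDeriv ρ s x u := by
  rw [← (IsParallelMap.of_const hρ).connDeriv_comm (differentiableAt_const τ) hs,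
    connDeriv_congr hτ]

lemma IsParallelPairing.fderiv_apply_apply {β : E → W →L[ℝ] W →L[ℝ] ℝ} {t : E → W}
    (hpar : IsParallelPairing ρ β x) (hβ : DifferentiableAt ℝ β x) (hs : DifferentiableAt ℝ s x)
    (ht : DifferentiableAt ℝ t x) (u : E) :
    fderiv ℝ (fun y => β y (s y) (t y)) x u
      = β x (connDeriv ρ s x u) (t x) + β x (s x) (connDeriv ρ t x u) := by
  rw [fderiv_clm_apply_apply (hβ.clm_apply hs) ht, fderiv_clm_apply_apply hβ hs, add_apply, hpar]
  simp only [connDeriv_apply, map_add, add_apply]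
  ring

lemma fderiv_connDeriv_apply (hρ : DifferentiableAt ℝ ρ x) (hs : ContDiffAt ℝ 2 s x) (u v : E) :
    fderiv ℝ (fun y => connDeriv ρ s y v) x u = fderiv ℝ (fderiv ℝ s) x u v
      + (fderiv ℝ ρ x u v (s x) + ρ x v (fderiv ℝ s x u)) := by
  have hs₁ : DifferentiableAt ℝ s x := hs.differentiableAt (by norm_num)
  have hs₂ : DifferentiableAt ℝ (fderiv ℝ s) x :=
    (hs.fderiv_right (m := 1) (by norm_num)).differentiableAt (by norm_num)
  have hρv : DifferentiableAt ℝ (fun y => ρ y v) x := hρ.clm_apply (differentiableAt_const v)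
  simp only [connDeriv_apply]
  rw [fderiv_fun_add (hs₂.clm_apply (differentiableAt_const v)) (hρv.clm_apply hs₁), add_apply,
    fderiv_clm_apply_const hs₂, fderiv_clm_apply_apply hρv hs₁, fderiv_clm_apply_const hρ]

lemma fderiv_fderiv_comm (hs : ContDiffAt ℝ 2 s x) (u v : E) :
    fderiv ℝ (fderiv ℝ s) x u v = fderiv ℝ (fderiv ℝ s) x v u :=
  hs.isSymmSndFDerivAt (by simp) u v

/-- No bracket term appears because the vector fields `u` and `v` are constant. -/
lemma connDeriv_connDeriv_sub (hρ : DifferentiableAt ℝ ρ x) (hs : ContDiffAt ℝ 2 s x) (u v : E) :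
    connDeriv ρ (fun y => connDeriv ρ s y v) x u - connDeriv ρ (fun y => connDeriv ρ s y u) x v
      = connCurvature ρ x u v (s x) := by
  rw [connDeriv_apply, connDeriv_apply ρ (fun y => connDeriv ρ s y u),
    fderiv_connDeriv_apply hρ hs, fderiv_connDeriv_apply hρ hs, fderiv_fderiv_comm hs u v]
  simp only [connDeriv_apply, connCurvature, map_add, add_apply, sub_apply,
    ContinuousLinearMap.comp_apply]
  abel

theorem ricci_identity {Γ : E → E →L[ℝ] E →L[ℝ] E} (hΓ : ∀ u v, Γ x u v = Γ x v u)
    (hρ : DifferentiableAt ℝ ρ x) (hs : ContDiffAt ℝ 2 s x)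
    (hs' : DifferentiableAt ℝ (connDeriv ρ s) x) (u v : E) :
    connDeriv (homConn Γ ρ) (connDeriv ρ s) x u v - connDeriv (homConn Γ ρ) (connDeriv ρ s) x v u
      = connCurvature ρ x u v (s x) := by
  rw [connDeriv_apply_const hs', connDeriv_apply_const hs', hΓ v u, sub_sub_sub_cancel_right,
    connDeriv_connDeriv_sub hρ hs]

lemma connCurvature_apply_of_parallel (hρ : DifferentiableAt ℝ ρ x) (hs : ContDiffAt ℝ 2 s x)
    (hpar : ∀ᶠ y in nhds x, connDeriv ρ s y = 0) (u v : E) :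
    connCurvature ρ x u v (s x) = 0 := by
  have hzero : ∀ w, (fun y => connDeriv ρ s y w) =ᶠ[nhds x] 0 := fun w => by
    filter_upwards [hpar] with y hy
    simp [hy]
  rw [← connDeriv_connDeriv_sub hρ hs, connDeriv_congr (hzero v), connDeriv_congr (hzero u)]
  simp [connDeriv_apply]

lemma IsParallelPairing.fderiv_fderiv_apply_apply {β : E → W →L[ℝ] W →L[ℝ] ℝ}
    (hρ : DifferentiableAt ℝ ρ x) (hβ : ContDiffAt ℝ 2 β x)
    (hpar : ∀ᶠ y in nhds x, IsParallelPairing ρ β y) (u v : E) (a b : W) :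
    fderiv ℝ (fun y => fderiv ℝ (fun y => β y a b) y v) x u
      = β x (connDeriv ρ (fun y => connDeriv ρ (fun _ => a) y v) x u) b
        + β x (connDeriv ρ (fun _ => a) x v) (connDeriv ρ (fun _ => b) x u)
        + (β x (connDeriv ρ (fun _ => a) x u) (connDeriv ρ (fun _ => b) x v)
        + β x a (connDeriv ρ (fun y => connDeriv ρ (fun _ => b) y v) x u)) := by
  have hβ' : ∀ᶠ y in nhds x, DifferentiableAt ℝ β y :=
    (hβ.eventually (by simp)).mono fun y hy => hy.differentiableAt (by norm_num)
  have hβx := hβ'.self_of_nhds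
  have hconst : ∀ c : W, DifferentiableAt ℝ (fun y => connDeriv ρ (fun _ => c) y v) x := fun c => by
    simp only [connDeriv_apply, fderiv_fun_const, Pi.zero_apply, zero_apply, zero_add]
    exact (hρ.clm_apply (differentiableAt_const v)).clm_apply (differentiableAt_const c)
  have hfirst : (fun y => fderiv ℝ (fun y => β y a b) y v) =ᶠ[nhds x] fun y =>
      β y (connDeriv ρ (fun _ => a) y v) b + β y a (connDeriv ρ (fun _ => b) y v) := by
    filter_upwards [hpar, hβ'] with y hy hβy
    exact hy.fderiv_apply_apply hβy (differentiableAt_const a) (differentiableAt_const b) v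
  rw [hfirst.fderiv_eq, fderiv_fun_add
    ((hβx.clm_apply (hconst a)).clm_apply (differentiableAt_const b))
    ((hβx.clm_apply (differentiableAt_const a)).clm_apply (hconst b)), add_apply,
    hpar.self_of_nhds.fderiv_apply_apply hβx (hconst a) (differentiableAt_const b),
    hpar.self_of_nhds.fderiv_apply_apply hβx (differentiableAt_const a) (hconst b)]

lemma IsParallelPairing.connCurvature_skew {β : E → W →L[ℝ] W →L[ℝ] ℝ}
    (hρ : DifferentiableAt ℝ ρ x) (hβ : ContDiffAt ℝ 2 β x)
    (hpar : ∀ᶠ y in nhds x, IsParallelPairing ρ β y) (u v : E) (a b : W) :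
    β x (connCurvature ρ x u v a) b = -β x a (connCurvature ρ x u v b) := by
  have hsymm : fderiv ℝ (fun y => fderiv ℝ (fun y => β y a b) y v) x u
      = fderiv ℝ (fun y => fderiv ℝ (fun y => β y a b) y u) x v := by
    have hφ : ContDiffAt ℝ 2 (fun y => β y a b) x :=
      (hβ.clm_apply contDiffAt_const).clm_apply contDiffAt_const
    have hφ' : DifferentiableAt ℝ (fderiv ℝ fun y => β y a b) x :=
      (hφ.fderiv_right (m := 1) (by norm_num)).differentiableAt (by norm_num)
    rw [fderiv_clm_apply_const hφ', fderiv_clm_apply_const hφ', fderiv_fderiv_comm hφ]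
  rw [IsParallelPairing.fderiv_fderiv_apply_apply hρ hβ hpar,
    IsParallelPairing.fderiv_fderiv_apply_apply hρ hβ hpar] at hsymm
  rw [← connDeriv_connDeriv_sub hρ contDiffAt_const, ← connDeriv_connDeriv_sub hρ contDiffAt_const,
    map_sub, map_sub, sub_apply]
  linarith

lemma connCurvature_zero (u v : E) :
    connCurvature (0 : E → E →L[ℝ] W →L[ℝ] W) x u v = 0 := by
  simp [connCurvature]

lemma fderiv_homConn_apply (hΓ : DifferentiableAt ℝ Γ x) (hρ : DifferentiableAt ℝ ρ x) (u v : E)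
    (φ : X →L[ℝ] W) :
    fderiv ℝ (homConn Γ ρ) x u v φ = (fderiv ℝ ρ x u v).comp φ - φ.comp (fderiv ℝ Γ x u v) := by
  have hρ' := (differentiableAt_const (ContinuousLinearMap.compL ℝ X W W) (x := x)).clm_comp hρ
  have hΓ' :=
    (differentiableAt_const (ContinuousLinearMap.compL ℝ X X W).flip (x := x)).clm_comp hΓ
  unfold homConn
  rw [fderiv_fun_sub hρ' hΓ', fderiv_clm_comp (differentiableAt_const _) hρ,
    fderiv_clm_comp (differentiableAt_const _) hΓ]
  ext a
  simp

lemma connCurvature_homConn (hΓ : DifferentiableAt ℝ Γ x) (hρ : DifferentiableAt ℝ ρ x) (u v : E)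
    (φ : X →L[ℝ] W) (a : X) :
    connCurvature (homConn Γ ρ) x u v φ a
      = connCurvature ρ x u v (φ a) - φ (connCurvature Γ x u v a) := by
  simp only [connCurvature, add_apply, sub_apply, fderiv_homConn_apply hΓ hρ,
    ContinuousLinearMap.comp_apply, homConn_apply, map_add, map_sub]
  abel

lemma connCurvature_swap (ρ : E → E →L[ℝ] W →L[ℝ] W) (x u v : E) :
    connCurvature ρ x u v = -connCurvature ρ x v u := by
  simp only [connCurvature]
  abel

lemma connCurvature_add_left (ρ : E → E →L[ℝ] W →L[ℝ] W) (x u u' v : E) :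
    connCurvature ρ x (u + u') v = connCurvature ρ x u v + connCurvature ρ x u' v := by
  simp only [connCurvature, map_add, add_apply, ContinuousLinearMap.comp_add,
    ContinuousLinearMap.add_comp]
  abel

lemma connCurvature_bianchi {Γ : E → E →L[ℝ] E →L[ℝ] E} (hΓ : DifferentiableAt ℝ Γ x)
    (hsymm : ∀ᶠ y in nhds x, ∀ u v, Γ y u v = Γ y v u) (u v w : E) :
    connCurvature Γ x u v w + connCurvature Γ x v w u + connCurvature Γ x w u v = 0 := by
  have hΓx := hsymm.self_of_nhds
  have hdΓ := fderiv_apply_apply_comm hΓ hsymm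
  simp only [connCurvature, add_apply, sub_apply, ContinuousLinearMap.comp_apply]
  rw [hdΓ u w v, hdΓ v w u, hdΓ w v u, hΓx w u, hΓx w v, hΓx v u]
  abel

lemma connCurvature_pullbackConn {ρ : X → X →L[ℝ] W →L[ℝ] W} {F : E → X}
    (hρ : DifferentiableAt ℝ ρ (F x)) (hF : ContDiffAt ℝ 2 F x) (u v : E) :
    connCurvature (pullbackConn ρ F) x u v
      = connCurvature ρ (F x) (fderiv ℝ F x u) (fderiv ℝ F x v) := by
  have hF₁ : DifferentiableAt ℝ F x := hF.differentiableAt (by norm_num)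
  have hF₂ : DifferentiableAt ℝ (fderiv ℝ F) x :=
    (hF.fderiv_right (m := 1) (by norm_num)).differentiableAt (by norm_num)
  have hρF : DifferentiableAt ℝ (fun y => ρ (F y)) x := hρ.comp x hF₁
  have hderiv : ∀ a b, fderiv ℝ (pullbackConn ρ F) x a b
      = fderiv ℝ ρ (F x) (fderiv ℝ F x a) (fderiv ℝ F x b)
        + ρ (F x) (fderiv ℝ (fderiv ℝ F) x a b) := fun a b => by
    unfold pullbackConn
    rw [fderiv_clm_comp hρF hF₂, show (fun y => ρ (F y)) = ρ ∘ F from rfl, fderiv_comp x hρ hF₁]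
    simp [add_comm]
  rw [connCurvature, hderiv, hderiv, fderiv_fderiv_comm hF u v]
  simp only [connCurvature, pullbackConn, ContinuousLinearMap.comp_apply, add_sub_add_right_eq_sub]

lemma fderiv_comp_apply {Y : Type*} [NormedAddCommGroup Y] [NormedSpace ℝ Y] {φ : X → Y}
    {F : E → X} (hφ : DifferentiableAt ℝ φ (F x)) (hF : DifferentiableAt ℝ F x) (u : E) :
    fderiv ℝ (fun y => φ (F y)) x u = fderiv ℝ φ (F x) (fderiv ℝ F x u) :=
  congrArg (fun L : E →L[ℝ] Y => L u) (fderiv_comp x hφ hF)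

lemma IsParallelPairing.pullback {ρ : X → X →L[ℝ] W →L[ℝ] W} {β : X → W →L[ℝ] W →L[ℝ] ℝ}
    {F : E → X} (h : IsParallelPairing ρ β (F x)) (hβ : DifferentiableAt ℝ β (F x))
    (hF : DifferentiableAt ℝ F x) :
    IsParallelPairing (pullbackConn ρ F) (fun y => β (F y)) x := fun u a b => by
  rw [fderiv_comp_apply hβ hF]
  exact h _ a b

lemma IsParallelMap.pullback {ρ : X → X →L[ℝ] W →L[ℝ] W} {τ : X → W →L[ℝ] W}
    {F : E → X} (h : IsParallelMap ρ ρ τ (F x)) (hτ : DifferentiableAt ℝ τ (F x))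
    (hF : DifferentiableAt ℝ F x) :
    IsParallelMap (pullbackConn ρ F) (pullbackConn ρ F) (fun y => τ (F y)) x := fun u a => by
  rw [fderiv_comp_apply hτ hF]
  exact h _ a

lemma contDiffOn_pullbackConn {ρ : X → X →L[ℝ] W →L[ℝ] W} {F : E → X} {U : Set X}
    (hV : IsOpen V) (hρ : ContDiffOn ℝ ∞ ρ U) (hF : ContDiffOn ℝ ∞ F V) (hVU : Set.MapsTo F V U) :
    ContDiffOn ℝ ∞ (pullbackConn ρ F) V :=
  (hρ.comp hF hVU).clm_comp (hF.fderiv_of_isOpen hV (by simp))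

end Connections

/-! ### Riemannian metrics on open subsets of coordinate space -/

section Metric

variable {m : ℕ}

/-- Trilinear forms on coordinate space. -/
abbrev Cubic (m : ℕ) : Type := Coord m →L[ℝ] Coord m →L[ℝ] Coord m →L[ℝ] ℝ

-- Shortcuts: instance search on nested spaces of continuous linear maps is exponential in the
-- depth of the nesting.
instance : NormedAddCommGroup (Cubic m) := inferInstance

instance : NormedSpace ℝ (Cubic m) := inferInstance

instance : AddCommGroup (Cubic m) := inferInstance

instance : AddCommMonoid (Cubic m) := inferInstance

instance : TopologicalSpace (Cubic m) := inferInstance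

instance : Module ℝ (Cubic m) := inferInstance

instance : IsTopologicalAddGroup (Cubic m) := inferInstance

/-- The cyclic rotation `(u, v, w) ↦ P(w, u, v)` of the arguments of a trilinear form. -/
def rotate : Cubic m →L[ℝ] Cubic m :=
  (ContinuousLinearMap.compL ℝ (Coord m) _ _
      (ContinuousLinearMap.flipₗᵢ ℝ (Coord m) (Coord m) ℝ).toContinuousLinearEquiv).comp
    (ContinuousLinearMap.flipₗᵢ ℝ (Coord m) (Coord m)
      (Coord m →L[ℝ] ℝ)).toContinuousLinearEquiv.toContinuousLinearMap

lemma rotate_apply (P : Cubic m) (u v w : Coord m) : rotate P u v w = P w u v := rfl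

/-- `g` is a smooth Riemannian metric on the open set `V` of coordinate space. -/
structure IsMetricOn (g : Coord m → Coord m →L[ℝ] Coord m →L[ℝ] ℝ) (V : Set (Coord m)) :
    Prop where
  isOpen : IsOpen V
  smooth : ContDiffOn ℝ ∞ g V
  symm : ∀ y ∈ V, ∀ u v, g y u v = g y v u
  pos : ∀ y ∈ V, ∀ u, u ≠ 0 → 0 < g y u u

/-- The vector `♯l` dual to the covector `l`. -/
def sharp (g : Coord m → Coord m →L[ℝ] Coord m →L[ℝ] ℝ) (y : Coord m) :
    (Coord m →L[ℝ] ℝ) →L[ℝ] Coord m :=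
  ∑ k, ∑ l, invMetric g y k l •
    (ContinuousLinearMap.apply ℝ ℝ (basisVec l)).smulRight (basisVec k)

/-- The Koszul expression `koszul g y` as a trilinear form. -/
def koszulL (g : Coord m → Coord m →L[ℝ] Coord m →L[ℝ] ℝ) (y : Coord m) : Cubic m :=
  (1 / 2 : ℝ) • (fderiv ℝ g y + (fderiv ℝ g y).flip - rotate (fderiv ℝ g y))

/-- The connection form `u ↦ Γ(u, ·)` of the Levi-Civita connection. -/
def christoffelL (g : Coord m → Coord m →L[ℝ] Coord m →L[ℝ] ℝ) (y : Coord m) :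
    Coord m →L[ℝ] Coord m →L[ℝ] Coord m :=
  (ContinuousLinearMap.compL ℝ (Coord m) _ _ (sharp g y)).comp (koszulL g y)

lemma sum_smul_basisVec (v : Coord m) : ∑ i, v i • basisVec i = v := by
  ext j
  simp [basisVec, Finset.sum_apply, Pi.single_apply]

lemma sum_proj_smul_basisVec (l : Coord m →L[ℝ] ℝ) :
    ∑ i, l (basisVec i) • (EuclideanSpace.proj i : Coord m →L[ℝ] ℝ) = l := by
  ext v
  conv_rhs => rw [← sum_smul_basisVec v]
  simp [mul_comm]

variable {g : Coord m → Coord m →L[ℝ] Coord m →L[ℝ] ℝ} {V : Set (Coord m)} {x : Coord m}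

lemma sharp_apply (y : Coord m) (l : Coord m →L[ℝ] ℝ) :
    sharp g y l = ∑ k, ∑ j, (invMetric g y k j * l (basisVec j)) • basisVec k := by
  simp [sharp, smul_smul]

lemma koszulL_apply (y u v w : Coord m) : koszulL g y u v w = koszul g y u v w := by
  simp [koszulL, koszul, rotate_apply]

@[simp]
lemma christoffelL_apply (y u v : Coord m) : christoffelL g y u v = christoffel g y u v := by
  rw [christoffelL, ContinuousLinearMap.comp_apply, ContinuousLinearMap.compL_apply,
    ContinuousLinearMap.comp_apply, sharp_apply]
  simp only [koszulL_apply, christoffel]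

variable {W : Type*} [NormedAddCommGroup W] [NormedSpace ℝ W]

namespace IsMetricOn

lemma ext_inner (h : IsMetricOn g V) (hx : x ∈ V) {u v : Coord m}
    (huv : ∀ w, g x u w = g x v w) : u = v := by
  by_contra hne
  have hpos := h.pos x hx (u - v) (sub_ne_zero.2 hne)
  rw [(g x).map_sub, sub_apply, huv, sub_self] at hpos
  exact lt_irrefl _ hpos

lemma differentiableAt_of_contDiffOn (h : IsMetricOn g V) (hx : x ∈ V) {s : Coord m → W}
    (hs : ContDiffOn ℝ ∞ s V) : DifferentiableAt ℝ s x :=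
  LagrangianSimons.differentiableAt_of_contDiffOn h.isOpen hx hs

lemma isSymm_gram (h : IsMetricOn g V) (hx : x ∈ V) : (gram g x).IsSymm := by
  ext i j
  simp [gram, h.symm x hx (basisVec j)]

lemma isUnit_det_gram (h : IsMetricOn g V) (hx : x ∈ V) : IsUnit (gram g x).det := by
  rw [← Matrix.isUnit_iff_isUnit_det, ← Matrix.mulVec_injective_iff_isUnit,
    ← Matrix.coe_mulVecLin, ← LinearMap.ker_eq_bot, LinearMap.ker_eq_bot']
  intro v hv
  have hinner : ∀ i, g x (basisVec i) (WithLp.toLp 2 v) = 0 := fun i => by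
    rw [← sum_smul_basisVec (WithLp.toLp 2 v), ← show _ = (0 : ℝ) from congrFun hv i]
    simp [Matrix.mulVec, dotProduct, gram, mul_comm]
  have hzero : (WithLp.toLp 2 v : Coord m) = 0 := h.ext_inner hx fun w => by
    rw [h.symm x hx, ← sum_smul_basisVec w]
    simp [hinner]
  simpa using congrArg (WithLp.ofLp) hzero

lemma invMetric_comm (h : IsMetricOn g V) (hx : x ∈ V) (k l : Fin m) :
    invMetric g x k l = invMetric g x l k := by
  have hinv : (gram g x)⁻¹.IsSymm := by
    rw [Matrix.IsSymm, Matrix.transpose_nonsing_inv, (h.isSymm_gram hx).eq]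
  exact hinv.apply l k

lemma inner_sharp (h : IsMetricOn g V) (hx : x ∈ V) (l : Coord m →L[ℝ] ℝ) (w : Coord m) :
    g x (sharp g x l) w = l w := by
  have hcontract : ∀ j i, ∑ k, invMetric g x k j * g x (basisVec k) (basisVec i)
      = if j = i then 1 else 0 := fun j i => by
    rw [← Matrix.one_apply, ← Matrix.nonsing_inv_mul _ (h.isUnit_det_gram hx), Matrix.mul_apply]
    exact Finset.sum_congr rfl fun k _ => by rw [h.invMetric_comm hx]; rfl
  have hbasis : ∀ i, g x (sharp g x l) (basisVec i) = l (basisVec i) := fun i => by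
    calc g x (sharp g x l) (basisVec i)
        = ∑ j, l (basisVec j) * ∑ k, invMetric g x k j * g x (basisVec k) (basisVec i) := by
          simp only [sharp_apply, map_sum, map_smul, sum_apply, smul_apply, smul_eq_mul,
            Finset.mul_sum]
          rw [Finset.sum_comm]
          exact Finset.sum_congr rfl fun _ _ => Finset.sum_congr rfl fun _ _ => by ring
      _ = l (basisVec i) := by simp [hcontract]
  rw [← sum_smul_basisVec w]
  simp [hbasis]

lemma sharp_inner (h : IsMetricOn g V) (hx : x ∈ V) (w : Coord m) : sharp g x (g x w) = w :=
  h.ext_inner hx fun v => h.inner_sharp hx (g x w) v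

lemma inner_christoffel (h : IsMetricOn g V) (hx : x ∈ V) (u v w : Coord m) :
    g x (christoffel g x u v) w = koszul g x u v w := by
  rw [← christoffelL_apply, ← koszulL_apply]
  exact h.inner_sharp hx (koszulL g x u v) w

lemma contDiffOn_fderiv (h : IsMetricOn g V) : ContDiffOn ℝ ∞ (fderiv ℝ g) V :=
  h.smooth.fderiv_of_isOpen h.isOpen (by simp)

/-- The musical isomorphism `u ↦ g(u, ·)`. -/
def flatEquiv (h : IsMetricOn g V) (hx : x ∈ V) : Coord m ≃L[ℝ] (Coord m →L[ℝ] ℝ) :=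
  ContinuousLinearEquiv.equivOfInverse (g x) (sharp g x) (h.sharp_inner hx)
    fun l => ContinuousLinearMap.ext fun w => h.inner_sharp hx l w

lemma contDiffOn_sharp (h : IsMetricOn g V) : ContDiffOn ℝ ∞ (sharp g) V := by
  have hinverse : ContDiffOn ℝ ∞ (ContinuousLinearMap.inverse ∘ g) V := fun y hy =>
    (contDiffAt_map_inverse (h.flatEquiv hy)).comp_contDiffWithinAt y (h.smooth y hy)
  exact hinverse.congr fun y hy =>
    (ContinuousLinearMap.inverse_equiv (h.flatEquiv hy)).symm

lemma contDiffOn_invMetric (h : IsMetricOn g V) (k l : Fin m) :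
    ContDiffOn ℝ ∞ (fun y => invMetric g y k l) V := by
  have hcoord : ContDiffOn ℝ ∞ (fun y => (EuclideanSpace.proj k : Coord m →L[ℝ] ℝ)
      (sharp g y (EuclideanSpace.proj l))) V :=
    contDiffOn_const.clm_apply (h.contDiffOn_sharp.clm_apply contDiffOn_const)
  refine hcoord.congr fun y _ => ?_
  simp [sharp_apply, basisVec]

lemma contDiffOn_christoffelL (h : IsMetricOn g V) : ContDiffOn ℝ ∞ (christoffelL g) V := by
  have hflip : ContDiffOn ℝ ∞ (fun y => (fderiv ℝ g y).flip) V :=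
    (ContinuousLinearMap.flipₗᵢ ℝ (Coord m) (Coord m) (Coord m →L[ℝ] ℝ)).contDiff.comp_contDiffOn
      h.contDiffOn_fderiv
  have hkoszul : ContDiffOn ℝ ∞ (koszulL g) V :=
    ((h.contDiffOn_fderiv.add hflip).sub
      (rotate.contDiff.comp_contDiffOn h.contDiffOn_fderiv)).const_smul _
  exact (contDiffOn_const.clm_apply h.contDiffOn_sharp).clm_comp hkoszul

lemma differentiableAt_christoffelL (h : IsMetricOn g V) (hx : x ∈ V) :
    DifferentiableAt ℝ (christoffelL g) x :=
  h.differentiableAt_of_contDiffOn hx h.contDiffOn_christoffelL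

lemma fderiv_symm (h : IsMetricOn g V) (hx : x ∈ V) (w u v : Coord m) :
    fderiv ℝ g x w u v = fderiv ℝ g x w v u :=
  fderiv_apply_apply_comm (h.differentiableAt_of_contDiffOn hx h.smooth)
    (by filter_upwards [h.isOpen.mem_nhds hx] with y hy using h.symm y hy) w u v

lemma christoffel_symm (h : IsMetricOn g V) (hx : x ∈ V) (u v : Coord m) :
    christoffel g x u v = christoffel g x v u := by
  refine h.ext_inner hx fun w => ?_
  rw [h.inner_christoffel hx, h.inner_christoffel hx]
  simp only [koszul, h.fderiv_symm hx w u v]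
  ring

lemma fderiv_metric (h : IsMetricOn g V) (hx : x ∈ V) (w u v : Coord m) :
    fderiv ℝ g x w u v = g x (christoffel g x w u) v + g x u (christoffel g x w v) := by
  rw [h.symm x hx u, h.inner_christoffel hx, h.inner_christoffel hx]
  simp only [koszul, h.fderiv_symm hx w v u]
  ring

end IsMetricOn

end Metric

/-! ### Traces and parallel pairings -/

section Trace

variable {m : ℕ} {g : Coord m → Coord m →L[ℝ] Coord m →L[ℝ] ℝ} {V : Set (Coord m)} {x : Coord m}
  {W : Type*} [NormedAddCommGroup W] [NormedSpace ℝ W] {ρ : Coord m → Coord m →L[ℝ] W →L[ℝ] W}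

/-- The trace of a vector-valued bilinear form with respect to the metric `g` at `y`. -/
def metricTrace (g : Coord m → Coord m →L[ℝ] Coord m →L[ℝ] ℝ) (y : Coord m) :
    (Coord m →L[ℝ] Coord m →L[ℝ] W) →L[ℝ] W :=
  ∑ k, ∑ l, invMetric g y k l •
    (ContinuousLinearMap.apply ℝ W (basisVec l)).comp
      (ContinuousLinearMap.apply ℝ (Coord m →L[ℝ] W) (basisVec k))

/-- The pairing `⟨φ, ψ⟩ = g^{kl} β(φ ∂_k, ψ ∂_l)` of `W`-valued one-forms induced by a pairing `β`
on `W`. -/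
def homPairing (g : Coord m → Coord m →L[ℝ] Coord m →L[ℝ] ℝ)
    (β : Coord m → W →L[ℝ] W →L[ℝ] ℝ) (y : Coord m) :
    (Coord m →L[ℝ] W) →L[ℝ] (Coord m →L[ℝ] W) →L[ℝ] ℝ :=
  ∑ k, ∑ l, invMetric g y k l •
    (β y).bilinearComp (ContinuousLinearMap.apply ℝ W (basisVec k))
      (ContinuousLinearMap.apply ℝ W (basisVec l))

/-- `e` is an orthonormal frame of the metric `g` at `y`. -/
def IsOrthonormalFrame (g : Coord m → Coord m →L[ℝ] Coord m →L[ℝ] ℝ) (y : Coord m)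
    (e : Fin m → Coord m) : Prop :=
  ∀ a b, g y (e a) (e b) = if a = b then 1 else 0

lemma metricTrace_apply (y : Coord m) (B : Coord m →L[ℝ] Coord m →L[ℝ] W) :
    metricTrace g y B = ∑ k, ∑ l, invMetric g y k l • B (basisVec k) (basisVec l) := by
  simp [metricTrace]

lemma homPairing_apply (β : Coord m → W →L[ℝ] W →L[ℝ] ℝ) (y : Coord m)
    (φ ψ : Coord m →L[ℝ] W) :
    homPairing g β y φ ψ = metricTrace g y ((β y).bilinearComp φ ψ) := by
  simp [homPairing, metricTrace_apply]

lemma homPairing_eq_sum_invMetric (β : Coord m → W →L[ℝ] W →L[ℝ] ℝ) (y : Coord m)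
    (φ ψ : Coord m →L[ℝ] W) :
    homPairing g β y φ ψ
      = ∑ k, ∑ l, invMetric g y k l * β y (φ (basisVec k)) (ψ (basisVec l)) := by
  simp [homPairing]

lemma exists_orthonormal_basis {E : Type*} [AddCommGroup E] [Module ℝ E] [FiniteDimensional ℝ E]
    (b : LinearMap.BilinForm ℝ E) (hsymm : ∀ u v, b u v = b v u) (hpos : ∀ u, u ≠ 0 → 0 < b u u) :
    ∃ e : Module.Basis (Fin (Module.finrank ℝ E)) ℝ E,
      ∀ i j, b (e i) (e j) = if i = j then 1 else 0 := by
  let core : InnerProductSpace.Core ℝ E :=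
    { inner := fun u v => b u v
      conj_inner_symm := fun u v => by simp [hsymm u v]
      re_inner_nonneg := fun u => by
        rcases eq_or_ne u 0 with rfl | hu
        · simp
        · exact (hpos u hu).le
      add_left := fun u v w => by simp
      smul_left := fun u v r => by simp
      definite := fun u hu => by
        by_contra hne
        exact (hpos u hne).ne' hu }
  let _ := core.toNormedAddCommGroup
  let _ := InnerProductSpace.ofCore core.toCore
  refine ⟨(stdOrthonormalBasis ℝ E).toBasis, fun i j => ?_⟩
  rw [OrthonormalBasis.coe_toBasis]
  exact orthonormal_iff_ite.1 (stdOrthonormalBasis ℝ E).orthonormal i j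

lemma IsOrthonormalFrame.sum_inner_smul {e : Fin m → Coord m} (he : IsOrthonormalFrame g x e)
    (w : Coord m) : ∑ a, g x (e a) w • e a = w := by
  have hinner : ∀ (c : Fin m → ℝ) a, g x (e a) (∑ b, c b • e b) = c a := fun c a => by
    simp [he a]
  have hindep : LinearIndependent ℝ e := Fintype.linearIndependent_iff.2 fun c hc a => by
    rw [← hinner c a, hc, map_zero]
  obtain ⟨c, rfl⟩ := (Submodule.mem_span_range_iff_exists_fun ℝ).1
    ((hindep.span_eq_top_of_card_eq_finrank' (by simp)).ge (Submodule.mem_top (x := w)))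
  simp [hinner]

namespace IsMetricOn

lemma exists_orthonormalFrame (h : IsMetricOn g V) (hx : x ∈ V) :
    ∃ e, IsOrthonormalFrame g x e := by
  obtain ⟨e, he⟩ := exists_orthonormal_basis (g x).toBilinForm (h.symm x hx) (h.pos x hx)
  exact ⟨e.reindex (finCongr (by simp)), fun a b => by
    simpa using he (Fin.cast (by simp) a) (Fin.cast (by simp) b)⟩

lemma metricTrace_eq_sum_sharp (h : IsMetricOn g V) (hx : x ∈ V)
    (B : Coord m →L[ℝ] Coord m →L[ℝ] W) :
    metricTrace g x B = ∑ k, B (basisVec k) (sharp g x (EuclideanSpace.proj k)) := by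
  rw [metricTrace_apply]
  refine Finset.sum_congr rfl fun k _ => ?_
  simp [sharp_apply, basisVec, h.invMetric_comm hx k]

lemma metricTrace_eq (h : IsMetricOn g V) (hx : x ∈ V) {e : Fin m → Coord m}
    (he : IsOrthonormalFrame g x e) (B : Coord m →L[ℝ] Coord m →L[ℝ] W) :
    metricTrace g x B = ∑ a, B (e a) (e a) := by
  have hsharp : ∀ k, sharp g x (EuclideanSpace.proj k) = ∑ a, e a k • e a := fun k => by
    conv_lhs => rw [← he.sum_inner_smul (sharp g x (EuclideanSpace.proj k))]
    exact Finset.sum_congr rfl fun a _ => by rw [h.symm x hx, h.inner_sharp hx]; rfl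
  calc metricTrace g x B = ∑ k, ∑ a, e a k • B (basisVec k) (e a) := by
        simp only [h.metricTrace_eq_sum_sharp hx, hsharp, map_sum, map_smul]
    _ = ∑ a, B (∑ k, e a k • basisVec k) (e a) := by
        rw [Finset.sum_comm]
        simp only [map_sum, map_smul, sum_apply, smul_apply]
    _ = ∑ a, B (e a) (e a) := by simp only [sum_smul_basisVec]

lemma homPairing_eq (h : IsMetricOn g V) (hx : x ∈ V) {e : Fin m → Coord m}
    (he : IsOrthonormalFrame g x e) (β : Coord m → W →L[ℝ] W →L[ℝ] ℝ) (φ ψ : Coord m →L[ℝ] W) :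
    homPairing g β x φ ψ = ∑ a, β x (φ (e a)) (ψ (e a)) := by
  simp [homPairing_apply, h.metricTrace_eq hx he]

lemma contDiffOn_metricTrace (h : IsMetricOn g V) :
    ContDiffOn ℝ ∞ (metricTrace (W := W) g) V :=
  ContDiffOn.sum fun k _ => ContDiffOn.sum fun l _ =>
    (h.contDiffOn_invMetric k l).smul contDiffOn_const

lemma contDiffOn_homPairing (h : IsMetricOn g V) {β : Coord m → W →L[ℝ] W →L[ℝ] ℝ}
    (hβ : ContDiffOn ℝ ∞ β V) : ContDiffOn ℝ ∞ (homPairing g β) V :=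
  ContDiffOn.sum fun k _ => ContDiffOn.sum fun l _ => (h.contDiffOn_invMetric k l).smul
    ((bilinearCompL (ContinuousLinearMap.apply ℝ W (basisVec k))
      (ContinuousLinearMap.apply ℝ W (basisVec l))).contDiff.comp_contDiffOn hβ)

lemma isParallelPairing_metric (h : IsMetricOn g V) (hx : x ∈ V) :
    IsParallelPairing (christoffelL g) g x := fun u a b => by
  rw [h.fderiv_metric hx, christoffelL_apply, christoffelL_apply]

lemma fderiv_sharp_apply (h : IsMetricOn g V) (hx : x ∈ V) (u : Coord m) (l : Coord m →L[ℝ] ℝ) :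
    fderiv ℝ (sharp g) x u l
      = -christoffel g x u (sharp g x l) - sharp g x (l.comp (christoffelL g x u)) := by
  have hg := h.differentiableAt_of_contDiffOn hx h.smooth
  have hsharp := h.differentiableAt_of_contDiffOn hx h.contDiffOn_sharp
  have hconst : (fun y => g y (sharp g y l)) =ᶠ[nhds x] fun _ => l := by
    filter_upwards [h.isOpen.mem_nhds hx] with y hy
    exact ContinuousLinearMap.ext (h.inner_sharp hy l)
  have hderiv := fderiv_clm_apply_apply hg (hsharp.clm_apply (differentiableAt_const l)) u
  rw [hconst.fderiv_eq, fderiv_clm_apply_const hsharp] at hderiv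
  refine h.ext_inner hx fun w => ?_
  have hderiv_w := congrArg (fun φ : Coord m →L[ℝ] ℝ => φ w) hderiv
  simp only [fderiv_fun_const, Pi.zero_apply, zero_apply, add_apply, h.fderiv_metric hx,
    h.inner_sharp hx] at hderiv_w
  simp only [map_sub, map_neg, sub_apply, neg_apply, h.inner_sharp hx,
    ContinuousLinearMap.comp_apply, christoffelL_apply]
  linarith

lemma sum_apply_sharp_comp (B : Coord m →L[ℝ] Coord m →L[ℝ] W) (A : Coord m →L[ℝ] Coord m) :
    ∑ k, B (basisVec k) (sharp g x ((EuclideanSpace.proj k : Coord m →L[ℝ] ℝ).comp A))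
      = ∑ k, B (A (basisVec k)) (sharp g x (EuclideanSpace.proj k)) := by
  have hrow : ∀ k, (EuclideanSpace.proj k : Coord m →L[ℝ] ℝ).comp A
      = ∑ l, A (basisVec l) k • (EuclideanSpace.proj l : Coord m →L[ℝ] ℝ) := fun k =>
    (sum_proj_smul_basisVec _).symm
  simp only [hrow, map_sum, map_smul]
  rw [Finset.sum_comm]
  refine Finset.sum_congr rfl fun l _ => ?_
  conv_rhs => rw [← sum_smul_basisVec (A (basisVec l))]
  simp only [map_sum, map_smul, sum_apply, smul_apply]

lemma isParallelMap_metricTrace (h : IsMetricOn g V) (hx : x ∈ V) :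
    IsParallelMap (homConn (christoffelL g) (homConn (christoffelL g) ρ)) ρ (metricTrace g) x := by
  intro u B
  have htrace := h.differentiableAt_of_contDiffOn hx (h.contDiffOn_metricTrace (W := W))
  have hsharp := h.differentiableAt_of_contDiffOn hx h.contDiffOn_sharp
  have hsum : (fun y => metricTrace g y B)
      =ᶠ[nhds x] fun y => ∑ k, B (basisVec k) (sharp g y (EuclideanSpace.proj k)) := by
    filter_upwards [h.isOpen.mem_nhds hx] with y hy using h.metricTrace_eq_sum_sharp hy B
  have hterm : ∀ k, HasFDerivAt (fun y => B (basisVec k) (sharp g y (EuclideanSpace.proj k)))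
      ((B (basisVec k)).comp ((fderiv ℝ (sharp g) x).flip (EuclideanSpace.proj k))) x := fun k =>
    (B (basisVec k)).hasFDerivAt.comp x
      (by simpa using hsharp.hasFDerivAt.clm_apply (hasFDerivAt_const (EuclideanSpace.proj k) x))
  rw [← fderiv_clm_apply_const htrace, hsum.fderiv_eq, h.metricTrace_eq_sum_sharp hx,
    h.metricTrace_eq_sum_sharp hx, (HasFDerivAt.fun_sum fun k _ => hterm k).fderiv]
  simp only [sum_apply, ContinuousLinearMap.comp_apply, ContinuousLinearMap.flip_apply, map_sub,
    h.fderiv_sharp_apply hx, sum_apply_sharp_comp, map_neg, map_sum, homConn_apply, sub_apply,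
    Finset.sum_neg_distrib, Finset.sum_sub_distrib, christoffelL_apply]
  abel

end IsMetricOn

lemma fderiv_bilinearComp {β : Coord m → W →L[ℝ] W →L[ℝ] ℝ} (hβ : DifferentiableAt ℝ β x)
    (u : Coord m) (φ ψ : Coord m →L[ℝ] W) :
    fderiv ℝ (fun y => (β y).bilinearComp φ ψ) x u = (fderiv ℝ β x u).bilinearComp φ ψ := by
  have hcomp := ((bilinearCompL φ ψ).hasFDerivAt.comp x hβ.hasFDerivAt).fderiv
  exact congrArg (fun L => L u) hcomp

lemma IsMetricOn.isParallelPairing_homPairing (h : IsMetricOn g V) (hx : x ∈ V)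
    {β : Coord m → W →L[ℝ] W →L[ℝ] ℝ} (hβ : ContDiffOn ℝ ∞ β V)
    (hpar : IsParallelPairing ρ β x) :
    IsParallelPairing (homConn (christoffelL g) ρ) (homPairing g β) x := fun u φ ψ => by
  have hβx := h.differentiableAt_of_contDiffOn hx hβ
  have hP := h.differentiableAt_of_contDiffOn hx (h.contDiffOn_homPairing hβ)
  have htrace := h.differentiableAt_of_contDiffOn hx (h.contDiffOn_metricTrace (W := ℝ))
  have hB : DifferentiableAt ℝ (fun y => (β y).bilinearComp φ ψ) x :=
    (bilinearCompL φ ψ).differentiableAt.comp x hβx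
  rw [← fderiv_clm_apply_const hP,
    ← fderiv_clm_apply_const (hP.clm_apply (differentiableAt_const φ))]
  simp only [homPairing_apply]
  rw [fderiv_clm_apply_apply htrace hB, fderiv_bilinearComp hβx,
    h.isParallelMap_metricTrace (ρ := 0) hx, Pi.zero_apply, zero_apply, zero_apply, sub_zero,
    ← map_add, ← map_add]
  congr 1
  ext a b
  simp only [add_apply, ContinuousLinearMap.bilinearComp_apply, homConn_apply, map_sub, sub_apply,
    hpar u (φ a) (ψ b), Pi.zero_apply, zero_apply]
  ring

lemma IsMetricOn.laplacian_pairing (h : IsMetricOn g V) (hx : x ∈ V)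
    {β : Coord m → W →L[ℝ] W →L[ℝ] ℝ} (hβ : ContDiffOn ℝ ∞ β V)
    (hpar : ∀ y ∈ V, IsParallelPairing ρ β y)
    (hsymm : ∀ y ∈ V, ∀ s t, β y s t = β y t s) (hρ : ContDiffOn ℝ ∞ ρ V) {s : Coord m → W}
    (hs : ContDiffOn ℝ ∞ s V) :
    (1 / 2 : ℝ) * laplacian g (fun y => β y (s y) (s y)) x
      = β x (metricTrace g x (connDeriv (homConn (christoffelL g) ρ) (connDeriv ρ s) x)) (s x)
        + homPairing g β x (connDeriv ρ s x) (connDeriv ρ s x) := by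
  have hdiff {W : Type _} [NormedAddCommGroup W] [NormedSpace ℝ W] {t : Coord m → W}
      (ht : ContDiffOn ℝ ∞ t V) : ∀ y ∈ V, DifferentiableAt ℝ t y := fun y hy =>
    h.differentiableAt_of_contDiffOn hy ht
  have hDs : ContDiffOn ℝ ∞ (connDeriv ρ s) V := contDiffOn_connDeriv h.isOpen hρ hs
  have hgrad : ∀ y ∈ V, ∀ v, fderiv ℝ (fun z => β z (s z) (s z)) y v
      = 2 * β y (connDeriv ρ s y v) (s y) := fun y hy v => by
    rw [(hpar y hy).fderiv_apply_apply (hdiff hβ y hy) (hdiff hs y hy) (hdiff hs y hy),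
      hsymm y hy (s y), two_mul]
  have hhess : ∀ u v, fderiv ℝ (fun y => fderiv ℝ (fun z => β z (s z) (s z)) y v) x u
      - fderiv ℝ (fun z => β z (s z) (s z)) x (christoffel g x u v)
      = 2 * (β x (connDeriv (homConn (christoffelL g) ρ) (connDeriv ρ s) x u v) (s x)
        + β x (connDeriv ρ s x u) (connDeriv ρ s x v)) := fun u v => by
    have hcongr : (fun y => fderiv ℝ (fun z => β z (s z) (s z)) y v)
        =ᶠ[nhds x] fun y => 2 * β y (connDeriv ρ s y v) (s y) := by
      filter_upwards [h.isOpen.mem_nhds hx] with y hy using hgrad y hy v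
    have hDsv : DifferentiableAt ℝ (fun y => connDeriv ρ s y v) x :=
      (hdiff hDs x hx).clm_apply (differentiableAt_const v)
    rw [hcongr.fderiv_eq, hgrad x hx, fderiv_const_mul (((hdiff hβ x hx).clm_apply
      hDsv).clm_apply (hdiff hs x hx)), smul_apply, (hpar x hx).fderiv_apply_apply (hdiff hβ x hx)
      hDsv (hdiff hs x hx), connDeriv_apply_const (hdiff hDs x hx), hsymm x hx (connDeriv ρ s x v)]
    simp only [smul_eq_mul, map_sub, sub_apply, christoffelL_apply]
    ring
  simp only [laplacian, hhess, homPairing_apply, metricTrace_apply, map_sum, map_smul, sum_apply,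
    smul_apply, smul_eq_mul, ContinuousLinearMap.bilinearComp_apply, Finset.mul_sum,
    ← Finset.sum_add_distrib]
  exact Finset.sum_congr rfl fun _ _ => Finset.sum_congr rfl fun _ _ => by ring

end Trace

/-! ### Calculus of cubic forms -/

section CubicForms

variable {m : ℕ} {g : Coord m → Coord m →L[ℝ] Coord m →L[ℝ] ℝ} {V : Set (Coord m)} {x : Coord m}
  {P : Coord m → Cubic m}

/-- The connection form induced on trilinear forms by the Levi-Civita connection. -/
def cubicConn (g : Coord m → Coord m →L[ℝ] Coord m →L[ℝ] ℝ) :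
    Coord m → Coord m →L[ℝ] Cubic m →L[ℝ] Cubic m :=
  homConn (christoffelL g) (homConn (christoffelL g) (homConn (christoffelL g) 0))

/-- The covariant derivative `u ↦ ∇_u P` of a field of trilinear forms. -/
def cubicCov (g : Coord m → Coord m →L[ℝ] Coord m →L[ℝ] ℝ) (P : Coord m → Cubic m) :
    Coord m → Coord m →L[ℝ] Cubic m :=
  connDeriv (cubicConn g) P

/-- The second covariant derivative `(u, v) ↦ ∇²_{u,v} P` of a field of trilinear forms. -/
def cubicHess (g : Coord m → Coord m →L[ℝ] Coord m →L[ℝ] ℝ) (P : Coord m → Cubic m) :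
    Coord m → Coord m →L[ℝ] Coord m →L[ℝ] Cubic m :=
  connDeriv (homConn (christoffelL g) (cubicConn g)) (cubicCov g P)

/-- The inner product of trilinear forms induced by the metric. -/
def cubicPairing (g : Coord m → Coord m →L[ℝ] Coord m →L[ℝ] ℝ) :
    Coord m → Cubic m →L[ℝ] Cubic m →L[ℝ] ℝ :=
  homPairing g (homPairing g (homPairing g fun _ => ContinuousLinearMap.mul ℝ ℝ))

/-- The transposition of the first two arguments of a trilinear form. -/
def transpose12 : Cubic m →L[ℝ] Cubic m :=
  (ContinuousLinearMap.flipₗᵢ ℝ (Coord m) (Coord m)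
    (Coord m →L[ℝ] ℝ)).toContinuousLinearEquiv.toContinuousLinearMap

/-- The transposition of the last two arguments of a trilinear form. -/
def transpose23 : Cubic m →L[ℝ] Cubic m :=
  ContinuousLinearMap.compL ℝ (Coord m) _ _
    (ContinuousLinearMap.flipₗᵢ ℝ (Coord m) (Coord m) ℝ).toContinuousLinearEquiv

/-- Total symmetry of a trilinear form, encoded by two generating transpositions. -/
structure IsSymmCubic (P : Cubic m) : Prop where
  swap12 : ∀ a b c, P a b c = P b a c
  swap23 : ∀ a b c, P a b c = P a c b

/-- The sum of the cyclic rotations of a trilinear form. -/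
def cyclicSum : Cubic m →L[ℝ] Cubic m := .id ℝ (Cubic m) + rotate + rotate.comp rotate

/-- The symmetric product `l ↦ l(u) b(v, w) + l(v) b(w, u) + l(w) b(u, v)` of covectors with the
bilinear form `b`. -/
def symProd (b : Coord m →L[ℝ] Coord m →L[ℝ] ℝ) : (Coord m →L[ℝ] ℝ) →L[ℝ] Cubic m :=
  cyclicSum.comp
    ((ContinuousLinearMap.smulRightL ℝ (Coord m) (Coord m →L[ℝ] Coord m →L[ℝ] ℝ)).flip b)

/-- The trace-free part of a totally symmetric trilinear form. -/
def tracefreePart (g : Coord m → Coord m →L[ℝ] Coord m →L[ℝ] ℝ) (y : Coord m) :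
    Cubic m →L[ℝ] Cubic m :=
  .id ℝ (Cubic m) - (1 / ((m : ℝ) + 2)) • (symProd (g y)).comp (metricTrace g y)

lemma cubicConn_apply (y u a b c : Coord m) (P : Cubic m) :
    cubicConn g y u P a b c = -(P (christoffel g y u a) b c + P a (christoffel g y u b) c
      + P a b (christoffel g y u c)) := by
  simp only [cubicConn, homConn_apply, sub_apply, Pi.zero_apply, zero_apply, christoffelL_apply]
  ring

lemma transpose12_apply (P : Cubic m) (u v w : Coord m) : transpose12 P u v w = P v u w := rfl

lemma transpose23_apply (P : Cubic m) (u v w : Coord m) : transpose23 P u v w = P u w v := rfl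

lemma cubicConn_transpose12 (y u : Coord m) (Q : Cubic m) :
    cubicConn g y u (transpose12 Q) = transpose12 (cubicConn g y u Q) := by
  ext a b c
  simp only [cubicConn_apply, transpose12_apply]
  ring

lemma cubicConn_transpose23 (y u : Coord m) (Q : Cubic m) :
    cubicConn g y u (transpose23 Q) = transpose23 (cubicConn g y u Q) := by
  ext a b c
  simp only [cubicConn_apply, transpose23_apply]
  ring

lemma isSymmCubic_iff {Q : Cubic m} : IsSymmCubic Q ↔ transpose12 Q = Q ∧ transpose23 Q = Q := by
  refine ⟨fun h => ⟨?_, ?_⟩, fun h => ⟨fun a b c => ?_, fun a b c => ?_⟩⟩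
  · ext a b c
    exact h.swap12 b a c
  · ext a b c
    exact h.swap23 a c b
  · exact congrArg (fun R : Cubic m => R b a c) h.1
  · exact congrArg (fun R : Cubic m => R a c b) h.2

lemma cyclicSum_apply (P : Cubic m) (u v w : Coord m) :
    cyclicSum P u v w = P u v w + P w u v + P v w u := rfl

lemma symProd_apply (b : Coord m →L[ℝ] Coord m →L[ℝ] ℝ) (l : Coord m →L[ℝ] ℝ)
    (u v w : Coord m) :
    symProd b l u v w = l u * b v w + l v * b w u + l w * b u v := by
  rw [symProd, ContinuousLinearMap.comp_apply, cyclicSum_apply]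
  simp only [ContinuousLinearMap.flip_apply, ContinuousLinearMap.smulRightL_apply_apply,
    ContinuousLinearMap.smulRight_apply, smul_apply, smul_eq_mul]
  ring

lemma tracefreePart_apply (y : Coord m) (P : Cubic m) :
    tracefreePart g y P = P - (1 / ((m : ℝ) + 2)) • symProd (g y) (metricTrace g y P) := rfl

lemma cubicCov_apply (hP : DifferentiableAt ℝ P x) (u a b d : Coord m) :
    cubicCov g P x u a b d = fderiv ℝ (fun y => P y a b d) x u
      - P x (christoffel g x u a) b d - P x a (christoffel g x u b) d
      - P x a b (christoffel g x u d) := by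
  have hPa := hP.clm_apply (differentiableAt_const a)
  rw [fderiv_clm_apply_const (hPa.clm_apply (differentiableAt_const b)),
    fderiv_clm_apply_const hPa, fderiv_clm_apply_const hP, cubicCov, connDeriv_apply]
  simp only [add_apply, cubicConn_apply]
  ring

lemma covTwoTensor_eq_connDeriv {S : Coord m → Coord m → Coord m → ℝ}
    {B : Coord m → Coord m →L[ℝ] Coord m →L[ℝ] ℝ} (hB : DifferentiableAt ℝ B x)
    (hS : ∀ᶠ y in nhds x, ∀ v w, S y v w = B y v w) (u v w : Coord m) :
    covTwoTensor g S x u v w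
      = connDeriv (homConn (christoffelL g) (homConn (christoffelL g) 0)) B x u v w := by
  have hcongr : (fun y => S y v w) =ᶠ[nhds x] fun y => B y v w := hS.mono fun y hy => hy v w
  rw [connDeriv_apply_const_apply_const hB, covTwoTensor, hcongr.fderiv_eq]
  simp [connDeriv_apply, hS.self_of_nhds]

namespace IsMetricOn

lemma contDiffOn_cubicConn (h : IsMetricOn g V) : ContDiffOn ℝ ∞ (cubicConn g) V :=
  contDiffOn_homConn h.contDiffOn_christoffelL <| contDiffOn_homConn h.contDiffOn_christoffelL <|
    contDiffOn_homConn h.contDiffOn_christoffelL contDiffOn_const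

lemma contDiffOn_cubicCov (h : IsMetricOn g V) (hP : ContDiffOn ℝ ∞ P V) :
    ContDiffOn ℝ ∞ (cubicCov g P) V :=
  contDiffOn_connDeriv h.isOpen h.contDiffOn_cubicConn hP

lemma contDiffOn_cubicPairing (h : IsMetricOn g V) : ContDiffOn ℝ ∞ (cubicPairing g) V :=
  h.contDiffOn_homPairing <| h.contDiffOn_homPairing <| h.contDiffOn_homPairing contDiffOn_const

lemma isParallelPairing_cubicPairing (h : IsMetricOn g V) (hx : x ∈ V) :
    IsParallelPairing (cubicConn g) (cubicPairing g) x := by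
  have hmul : IsParallelPairing 0 (fun _ => ContinuousLinearMap.mul ℝ ℝ) x := fun u a b => by simp
  exact h.isParallelPairing_homPairing hx
    (h.contDiffOn_homPairing (h.contDiffOn_homPairing contDiffOn_const)) <|
    h.isParallelPairing_homPairing hx (h.contDiffOn_homPairing contDiffOn_const) <|
    h.isParallelPairing_homPairing hx contDiffOn_const hmul

lemma cubicPairing_eq (h : IsMetricOn g V) (hx : x ∈ V) {e : Fin m → Coord m}
    (he : IsOrthonormalFrame g x e) (P Q : Cubic m) :
    cubicPairing g x P Q = ∑ a, ∑ b, ∑ c, P (e a) (e b) (e c) * Q (e a) (e b) (e c) := by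
  simp only [cubicPairing, h.homPairing_eq hx he, ContinuousLinearMap.mul_apply']

lemma cubicPairing_comm (h : IsMetricOn g V) (hx : x ∈ V) (P Q : Cubic m) :
    cubicPairing g x P Q = cubicPairing g x Q P := by
  obtain ⟨e, he⟩ := h.exists_orthonormalFrame hx
  simp only [h.cubicPairing_eq hx he, mul_comm]

lemma laplacian_normSq (h : IsMetricOn g V) (hx : x ∈ V) (hP : ContDiffOn ℝ ∞ P V) :
    (1 / 2 : ℝ) * laplacian g (fun y => cubicPairing g y (P y) (P y)) x
      = cubicPairing g x (metricTrace g x (cubicHess g P x)) (P x)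
        + homPairing g (cubicPairing g) x (cubicCov g P x) (cubicCov g P x) :=
  h.laplacian_pairing hx h.contDiffOn_cubicPairing
    (fun _ hy => h.isParallelPairing_cubicPairing hy) (fun _ hy => h.cubicPairing_comm hy)
    h.contDiffOn_cubicConn hP

lemma contDiffOn_symProd (h : IsMetricOn g V) : ContDiffOn ℝ ∞ (fun y => symProd (g y)) V :=
  contDiffOn_const.clm_comp <| (ContinuousLinearMap.smulRightL ℝ (Coord m)
    (Coord m →L[ℝ] Coord m →L[ℝ] ℝ)).flip.contDiff.comp_contDiffOn h.smooth

lemma isParallelMap_symProd (h : IsMetricOn g V) (hx : x ∈ V) :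
    IsParallelMap (homConn (christoffelL g) 0) (cubicConn g) (fun y => symProd (g y)) x := by
  have hg := h.differentiableAt_of_contDiffOn hx h.smooth
  have hparallel : connDeriv (homConn (christoffelL g) (homConn (christoffelL g) 0)) g x = 0 := by
    ext u a b
    simp [connDeriv_apply, h.fderiv_metric hx]
    ring
  have hcyclic : ∀ u P, cubicConn g x u (cyclicSum P) = cyclicSum (cubicConn g x u P) := by
    intro u P
    ext a b c
    simp only [cubicConn_apply, cyclicSum_apply]
    ring
  exact (IsParallelMap.of_const hcyclic).comp (IsParallelMap.smulRight hg hparallel)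
    (differentiableAt_const _) ((ContinuousLinearMap.differentiable _).differentiableAt.comp x hg)

lemma contDiffOn_tracefreePart (h : IsMetricOn g V) : ContDiffOn ℝ ∞ (tracefreePart g) V :=
  contDiffOn_const.sub ((h.contDiffOn_symProd.clm_comp h.contDiffOn_metricTrace).const_smul _)

lemma isParallelMap_tracefreePart (h : IsMetricOn g V) (hx : x ∈ V) :
    IsParallelMap (cubicConn g) (cubicConn g) (tracefreePart g) x := by
  have hsymProd := h.differentiableAt_of_contDiffOn hx h.contDiffOn_symProd
  have htrace :=
    h.differentiableAt_of_contDiffOn hx (h.contDiffOn_metricTrace (W := Coord m →L[ℝ] ℝ))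
  exact ((h.isParallelMap_symProd hx).comp (h.isParallelMap_metricTrace hx) hsymProd
    htrace).id_sub_const_smul (hsymProd.clm_comp htrace) _

lemma cubicHess_tracefreePart (h : IsMetricOn g V) (hx : x ∈ V) (hP : ContDiffOn ℝ ∞ P V)
    (u v : Coord m) :
    cubicHess g (fun y => tracefreePart g y (P y)) x u v
      = tracefreePart g x (cubicHess g P x u v) :=
  IsParallelMap.connDeriv_connDeriv_comm h.isOpen hx
    (fun _ hy => h.isParallelMap_tracefreePart hy) h.contDiffOn_cubicConn h.contDiffOn_cubicConn
    h.contDiffOn_tracefreePart hP u v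

lemma cubicHess_map_of_map_eq (h : IsMetricOn g V) (hx : x ∈ V) (hP : ContDiffOn ℝ ∞ P V)
    {τ : Cubic m →L[ℝ] Cubic m} (hτ : ∀ y u Q, cubicConn g y u (τ Q) = τ (cubicConn g y u Q))
    (hτP : ∀ y ∈ V, τ (P y) = P y) (u v : Coord m) :
    τ (cubicHess g P x u v) = cubicHess g P x u v := by
  have hcov : ∀ y ∈ V, cubicCov g (fun z => τ (P z)) y = cubicCov g P y := fun y hy =>
    connDeriv_congr (by filter_upwards [h.isOpen.mem_nhds hy] with z hz using hτP z hz)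
  have hcomm := IsParallelMap.connDeriv_connDeriv_comm (Λ := christoffelL g) h.isOpen hx
    (fun y _ => IsParallelMap.of_const (hτ y)) h.contDiffOn_cubicConn h.contDiffOn_cubicConn
    contDiffOn_const hP u v
  rw [cubicHess, cubicCov, ← hcomm]
  congr 2
  exact connDeriv_congr (by filter_upwards [h.isOpen.mem_nhds hx] with y hy using hcov y hy)

lemma isSymmCubic_cubicCov (h : IsMetricOn g V) (hx : x ∈ V) (hP : ContDiffOn ℝ ∞ P V)
    (hsymm : ∀ y ∈ V, IsSymmCubic (P y)) (u : Coord m) : IsSymmCubic (cubicCov g P x u) := by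
  have hP := h.differentiableAt_of_contDiffOn hx hP
  have hnear : ∀ᶠ y in nhds x, transpose12 (P y) = P y ∧ transpose23 (P y) = P y := by
    filter_upwards [h.isOpen.mem_nhds hx] with y hy using isSymmCubic_iff.1 (hsymm y hy)
  exact isSymmCubic_iff.2
    ⟨map_connDeriv_of_map_eq (cubicConn_transpose12 x) hP (hnear.mono fun _ hy => hy.1) u,
      map_connDeriv_of_map_eq (cubicConn_transpose23 x) hP (hnear.mono fun _ hy => hy.2) u⟩

lemma isSymmCubic_cubicHess (h : IsMetricOn g V) (hx : x ∈ V) (hP : ContDiffOn ℝ ∞ P V)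
    (hsymm : ∀ y ∈ V, IsSymmCubic (P y)) (u v : Coord m) : IsSymmCubic (cubicHess g P x u v) :=
  isSymmCubic_iff.2
    ⟨h.cubicHess_map_of_map_eq hx hP cubicConn_transpose12
      (fun y hy => (isSymmCubic_iff.1 (hsymm y hy)).1) u v,
    h.cubicHess_map_of_map_eq hx hP cubicConn_transpose23
      (fun y hy => (isSymmCubic_iff.1 (hsymm y hy)).2) u v⟩

lemma cubicHess_codazzi (h : IsMetricOn g V) (hx : x ∈ V) (hP : ContDiffOn ℝ ∞ P V)
    (hcod : ∀ y ∈ V, ∀ u v, cubicCov g P y u v = cubicCov g P y v u) (u v w : Coord m) :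
    cubicHess g P x u v w = cubicHess g P x u w v :=
  connDeriv_apply_apply_comm (h.differentiableAt_of_contDiffOn hx (h.contDiffOn_cubicCov hP))
    (by filter_upwards [h.isOpen.mem_nhds hx] with y hy using hcod y hy) u v w

lemma connCurvature_christoffelL (h : IsMetricOn g V) (hx : x ∈ V) (u v w : Coord m) :
    connCurvature (christoffelL g) x u v w = curvature g x u v w := by
  have hΓ := h.differentiableAt_christoffelL hx
  have hderiv : ∀ a b c, fderiv ℝ (fun y => christoffel g y b c) x a
      = fderiv ℝ (christoffelL g) x a b c := fun a b c => by
    simp only [← christoffelL_apply]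
    rw [fderiv_clm_apply_const (hΓ.clm_apply (differentiableAt_const b)),
      fderiv_clm_apply_const hΓ]
  simp [connCurvature, curvature, hderiv]

lemma connCurvature_cubicConn (h : IsMetricOn g V) (hx : x ∈ V) (u v : Coord m) (P : Cubic m)
    (a b c : Coord m) :
    connCurvature (cubicConn g) x u v P a b c = -(P (curvature g x u v a) b c
      + P a (curvature g x u v b) c + P a b (curvature g x u v c)) := by
  have hΓ := h.differentiableAt_christoffelL hx
  have hΓ₀ : ContDiffOn ℝ ∞ (0 : Coord m → Coord m →L[ℝ] ℝ →L[ℝ] ℝ) V := contDiffOn_const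
  have hΓ₁ := contDiffOn_homConn h.contDiffOn_christoffelL hΓ₀
  have hΓ₂ := contDiffOn_homConn h.contDiffOn_christoffelL hΓ₁
  rw [cubicConn, connCurvature_homConn hΓ (h.differentiableAt_of_contDiffOn hx hΓ₂), sub_apply,
    sub_apply, connCurvature_homConn hΓ (h.differentiableAt_of_contDiffOn hx hΓ₁), sub_apply,
    connCurvature_homConn hΓ (h.differentiableAt_of_contDiffOn hx hΓ₀), connCurvature_zero]
  simp only [h.connCurvature_christoffelL hx, zero_apply]
  ring

lemma cubicHess_sub_cubicHess_swap (h : IsMetricOn g V) (hx : x ∈ V) (hP : ContDiffOn ℝ ∞ P V)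
    (u v : Coord m) :
    cubicHess g P x u v - cubicHess g P x v u = connCurvature (cubicConn g) x u v (P x) :=
  ricci_identity (ρ := cubicConn g)
    (fun u v => by simp only [christoffelL_apply, h.christoffel_symm hx u v])
    (h.differentiableAt_of_contDiffOn hx h.contDiffOn_cubicConn)
    ((hP.contDiffAt (h.isOpen.mem_nhds hx)).of_le ENat.LEInfty.out)
    (h.differentiableAt_of_contDiffOn hx (h.contDiffOn_cubicCov hP)) u v

lemma isSymmCubic_tracefreePart (h : IsMetricOn g V) (hx : x ∈ V) {P : Cubic m}
    (hP : IsSymmCubic P) : IsSymmCubic (tracefreePart g x P) := by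
  have hsymm := h.symm x hx
  refine ⟨fun a b c => ?_, fun a b c => ?_⟩
  all_goals
    simp only [tracefreePart_apply, sub_apply, smul_apply, symProd_apply, smul_eq_mul]
  · rw [hP.swap12 a b c, hsymm a c, hsymm b c, hsymm a b]
    ring
  · rw [hP.swap23 a b c, hsymm a b, hsymm b c, hsymm c a]
    ring

lemma connDeriv_metricTrace_cubicCov (h : IsMetricOn g V) (hx : x ∈ V) (hP : ContDiffOn ℝ ∞ P V)
    (u : Coord m) :
    connDeriv (homConn (christoffelL g) (homConn (christoffelL g) 0))
        (fun y => metricTrace g y (cubicCov g P y)) x u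
      = metricTrace g x (cubicHess g P x u) :=
  (h.isParallelMap_metricTrace (W := Coord m →L[ℝ] Coord m →L[ℝ] ℝ) hx).connDeriv_comm
    (h.differentiableAt_of_contDiffOn hx h.contDiffOn_metricTrace)
    (h.differentiableAt_of_contDiffOn hx (h.contDiffOn_cubicCov hP)) u

lemma metricTrace_symProd (h : IsMetricOn g V) (hx : x ∈ V) (l : Coord m →L[ℝ] ℝ) :
    metricTrace g x (symProd (g x) l) = ((m : ℝ) + 2) • l := by
  obtain ⟨e, he⟩ := h.exists_orthonormalFrame hx
  ext w
  have hw := congrArg l (he.sum_inner_smul w)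
  simp only [map_sum, map_smul, smul_eq_mul] at hw
  simp only [h.metricTrace_eq hx he, sum_apply, symProd_apply, Finset.sum_add_distrib, he _ _,
    if_true, mul_one, Finset.sum_const, Finset.card_univ, Fintype.card_fin, nsmul_eq_mul,
    smul_apply, smul_eq_mul, h.symm x hx w, mul_comm (l (e _)), hw]
  ring

lemma metricTrace_tracefreePart (h : IsMetricOn g V) (hx : x ∈ V) (P : Cubic m) :
    metricTrace g x (tracefreePart g x P) = 0 := by
  have hm : (m : ℝ) + 2 ≠ 0 := by positivity
  rw [tracefreePart_apply, map_sub, map_smul, h.metricTrace_symProd hx, smul_smul,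
    one_div_mul_cancel hm, one_smul, sub_self]

lemma cubicPairing_symProd_eq_zero (h : IsMetricOn g V) (hx : x ∈ V) (l : Coord m →L[ℝ] ℝ)
    {P : Cubic m} (hP : IsSymmCubic P) (htr : metricTrace g x P = 0) :
    cubicPairing g x (symProd (g x) l) P = 0 := by
  obtain ⟨e, he⟩ := h.exists_orthonormalFrame hx
  have hzero : ∀ w, ∑ a, P (e a) (e a) w = 0 := fun w => by
    simpa [h.metricTrace_eq hx he] using congrArg (fun L : Coord m →L[ℝ] ℝ => L w) htr
  have hzero' : ∀ w, ∑ a, P w (e a) (e a) = 0 := fun w => by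
    simpa only [hP.swap12 w, hP.swap23 _ w] using hzero w
  have hzero'' : ∀ w, ∑ a, P (e a) w (e a) = 0 := fun w => by
    simpa only [hP.swap12 _ w] using hzero' w
  have hcollapse : ∀ a, (∑ b, ∑ c, symProd (g x) l (e a) (e b) (e c) * P (e a) (e b) (e c))
      = l (e a) * ∑ b, P (e a) (e b) (e b) + ∑ b, l (e b) * P (e a) (e b) (e a)
        + ∑ c, l (e c) * P (e a) (e a) (e c) := fun a => by
    simp only [symProd_apply, he _ _, add_mul, Finset.sum_add_distrib, Finset.mul_sum, mul_ite,
      mul_one, mul_zero, ite_mul, zero_mul, Finset.sum_ite_eq, Finset.sum_ite_eq', Finset.mem_univ,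
      if_true]
    rw [Finset.sum_comm (f := fun b c => ite _ _ _)]
    simp only [Finset.sum_ite_eq, Finset.mem_univ, if_true]
  rw [h.cubicPairing_eq hx he]
  simp only [hcollapse, hzero', mul_zero, zero_add, Finset.sum_add_distrib]
  rw [Finset.sum_comm, Finset.sum_comm (f := fun a c => l (e c) * P (e a) (e a) (e c))]
  simp only [← Finset.mul_sum, hzero, hzero'', mul_zero, Finset.sum_const_zero, add_zero]

lemma cubicPairing_tracefreePart (h : IsMetricOn g V) (hx : x ∈ V) (Q : Cubic m)
    {P : Cubic m} (hP : IsSymmCubic P) (htr : metricTrace g x P = 0) :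
    cubicPairing g x (tracefreePart g x Q) P = cubicPairing g x Q P := by
  rw [tracefreePart_apply, map_sub, map_smul, sub_apply, smul_apply,
    h.cubicPairing_symProd_eq_zero hx _ hP htr, smul_zero, sub_zero]

end IsMetricOn

end CubicForms

/-! ### Commutators of symmetric matrices -/

section Commutator

open Matrix

variable {ι : Type*} [Fintype ι]

/-- The square `tr(Aᵀ A)` of the Frobenius norm. -/
def frobSq (A : Matrix ι ι ℝ) : ℝ := (Aᵀ * A).trace

lemma frobSq_eq_sum (A : Matrix ι ι ℝ) : frobSq A = ∑ i, ∑ j, A i j ^ 2 := by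
  simp only [frobSq, trace, diag_apply, mul_apply, transpose_apply, ← sq]
  exact Finset.sum_comm

lemma frobSq_nonneg (A : Matrix ι ι ℝ) : 0 ≤ frobSq A := by
  rw [frobSq_eq_sum]
  positivity

lemma frobSq_eq_zero {A : Matrix ι ι ℝ} : frobSq A = 0 ↔ A = 0 := by
  rw [frobSq, ← conjTranspose_eq_transpose_of_trivial, trace_conjTranspose_mul_self_eq_zero_iff]

lemma frobSq_add_smul (A B : Matrix ι ι ℝ) (r : ℝ) :
    frobSq (A + r • B) = frobSq A + 2 * r * (Bᵀ * A).trace + r ^ 2 * frobSq B := by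
  have hsymm : (Aᵀ * B).trace = (Bᵀ * A).trace := by
    rw [← trace_transpose, transpose_mul, transpose_transpose]
  simp only [frobSq, transpose_add, transpose_smul, Matrix.add_mul, Matrix.mul_add,
    Matrix.smul_mul, Matrix.mul_smul, trace_add, trace_smul, smul_eq_mul, hsymm]
  ring

lemma frobSq_conjStarAlgAut [DecidableEq ι] (U : unitary (Matrix ι ι ℝ)) (A : Matrix ι ι ℝ) :
    frobSq (Unitary.conjStarAlgAut ℝ _ U A) = frobSq A := by
  simp only [frobSq, ← conjTranspose_eq_transpose_of_trivial, ← star_eq_conjTranspose,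
    ← map_star, ← map_mul]
  rw [Unitary.conjStarAlgAut_apply, trace_mul_comm, ← Matrix.mul_assoc, Unitary.coe_star_mul_self,
    Matrix.one_mul]

lemma frobSq_lie_diagonal_le [DecidableEq ι] (d : ι → ℝ) (B : Matrix ι ι ℝ) :
    frobSq ⁅diagonal d, B⁆ ≤ 2 * frobSq (diagonal d) * frobSq B := by
  have hd : frobSq (diagonal d) = ∑ i, d i ^ 2 := by
    rw [frobSq, diagonal_transpose, diagonal_mul_diagonal, trace_diagonal]
    simp only [sq]
  have hsub_sq : ∀ i j, (d i - d j) ^ 2 ≤ 2 * ∑ k, d k ^ 2 := fun i j => by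
    rcases eq_or_ne i j with rfl | hij
    · rw [sub_self, zero_pow two_ne_zero]
      positivity
    · have hpair : d i ^ 2 + d j ^ 2 ≤ ∑ k, d k ^ 2 := by
        rw [← Finset.sum_pair hij (f := fun k => d k ^ 2)]
        exact Finset.sum_le_univ_sum_of_nonneg fun _ => sq_nonneg _
      nlinarith [sq_nonneg (d i + d j)]
  rw [hd, frobSq_eq_sum, frobSq_eq_sum B]
  simp only [Ring.lie_def, Matrix.sub_apply, diagonal_mul, mul_diagonal]
  rw [Finset.mul_sum]
  refine Finset.sum_le_sum fun i _ => ?_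
  rw [Finset.mul_sum]
  refine Finset.sum_le_sum fun j _ => ?_
  calc (d i * B i j - B i j * d j) ^ 2 = (d i - d j) ^ 2 * B i j ^ 2 := by ring
    _ ≤ _ := mul_le_mul_of_nonneg_right (hsub_sq i j) (sq_nonneg _)

lemma frobSq_lie_le {A : Matrix ι ι ℝ} (hA : A.IsSymm) (B : Matrix ι ι ℝ) :
    frobSq ⁅A, B⁆ ≤ 2 * frobSq A * frobSq B := by
  classical
  have hherm : A.IsHermitian := by
    rwa [Matrix.IsHermitian, conjTranspose_eq_transpose_of_trivial]
  set φ := Unitary.conjStarAlgAut ℝ _ hherm.eigenvectorUnitary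
  have hAφ : A = φ (diagonal hherm.eigenvalues) := hherm.spectral_theorem
  obtain ⟨B', rfl⟩ : ∃ B', φ B' = B := φ.surjective B
  have hlie : ⁅φ (diagonal hherm.eigenvalues), φ B'⁆ = φ ⁅diagonal hherm.eigenvalues, B'⁆ := by
    simp only [Ring.lie_def, map_sub, map_mul]
  rw [hAφ, hlie, frobSq_conjStarAlgAut, frobSq_conjStarAlgAut, frobSq_conjStarAlgAut]
  exact frobSq_lie_diagonal_le _ _

/-- The Gram determinant appears because `⁅A, B⁆` only depends on the component of `B` orthogonal
to `A`. -/
lemma frobSq_lie_le_gram {A : Matrix ι ι ℝ} (hA : A.IsSymm) (B : Matrix ι ι ℝ) :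
    frobSq ⁅A, B⁆ ≤ 2 * (frobSq A * frobSq B - (Aᵀ * B).trace ^ 2) := by
  rcases eq_or_ne (frobSq A) 0 with hzero | hne
  · simp [frobSq_eq_zero.1 hzero, frobSq, Ring.lie_def]
  · set r := -((Aᵀ * B).trace / frobSq A) with hr
    have hlie : ⁅A, B + r • A⁆ = ⁅A, B⁆ := by
      simp [Ring.lie_def, Matrix.mul_add, Matrix.add_mul]
    calc frobSq ⁅A, B⁆ = frobSq ⁅A, B + r • A⁆ := by rw [hlie]
      _ ≤ 2 * frobSq A * frobSq (B + r • A) := frobSq_lie_le hA _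
      _ = 2 * (frobSq A * frobSq B - (Aᵀ * B).trace ^ 2) := by
        rw [frobSq_add_smul, hr]
        field_simp
        ring

end Commutator

/-! ### The algebraic inequality -/

section AlgebraicInequality

open Matrix

variable {ι : Type*}

section Wedge

variable [DecidableEq ι]

/-- The matrix of `eᵢ ∧ eⱼ`. -/
def wedge (i j : ι) : Matrix ι ι ℝ := single i j 1 - single j i 1

/-- The slices of the symmetric product of the covector `b` with the metric. -/
def kronSym (b : ι → ℝ) (k : ι) : Matrix ι ι ℝ :=
  b k • 1 + vecMulVec (Pi.single k 1) b + vecMulVec b (Pi.single k 1)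

lemma wedge_eq_vecMulVec (i j : ι) :
    wedge i j = vecMulVec (Pi.single i 1) (Pi.single j 1)
      - vecMulVec (Pi.single j 1) (Pi.single i 1) := by
  simp only [wedge, single_eq_single_vecMulVec_single]

lemma wedge_swap (i j : ι) : wedge i j = -wedge j i := by
  rw [wedge, wedge, neg_sub]

lemma transpose_wedge (i j : ι) : (wedge i j)ᵀ = -wedge i j := by
  rw [wedge, transpose_sub, transpose_single, transpose_single, neg_sub]

lemma kronSym_isSymm (b : ι → ℝ) (k : ι) : (kronSym b k).IsSymm := by
  rw [Matrix.IsSymm, kronSym, transpose_add, transpose_add, transpose_smul, transpose_one,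
    transpose_vecMulVec, transpose_vecMulVec, add_right_comm]

end Wedge

variable [Fintype ι]

/-- Total symmetry and vanishing of the traces of a trilinear form, in terms of the matrices `t i`
of its slices `t(eᵢ, ·, ·)`. -/
structure IsTracefreeSymm (t : ι → Matrix ι ι ℝ) : Prop where
  swap : ∀ i j k, t i j k = t j i k
  isSymm : ∀ i, (t i).IsSymm
  trace_eq_zero : ∀ i, (t i).trace = 0

/-- The pairwise inner products of the slices of `t` and `C`. -/
def sliceGram (t C : ι → Matrix ι ι ℝ) : Matrix ι ι ℝ := of fun i j => (t i * C j).trace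

/-- The matrix with rows `t i *ᵥ b`. -/
def sliceMulVec (t : ι → Matrix ι ι ℝ) (b : ι → ℝ) : Matrix ι ι ℝ := of fun i => t i *ᵥ b

/-- The Ricci contraction of a curvature tensor, given by the matrices
`R k m = (⟨R(eₖ, eₘ)eᵢ, eₗ⟩)ᵢₗ`. -/
def ricciContraction (R : ι → ι → Matrix ι ι ℝ) : Matrix ι ι ℝ := of fun m l => ∑ k, R k m k l

/-- The contraction of `t` with the action of the curvature tensor `R` on `C` by derivations. The
action on the first two arguments gives equal contributions for symmetric slices. -/
def curvContraction (R : ι → ι → Matrix ι ι ℝ) (t C : ι → Matrix ι ι ℝ) : ℝ :=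
  2 * ∑ k, ∑ m, (t m * R k m * C k).trace + (ricciContraction R * sliceGram C t).trace

lemma curvContraction_add_left (R R' : ι → ι → Matrix ι ι ℝ) (t C : ι → Matrix ι ι ℝ) :
    curvContraction (R + R') t C = curvContraction R t C + curvContraction R' t C := by
  have hricci : ricciContraction (R + R') = ricciContraction R + ricciContraction R' := by
    ext m l
    simp [ricciContraction, Finset.sum_add_distrib]
  simp only [curvContraction, hricci, Pi.add_apply, Matrix.mul_add, Matrix.add_mul, trace_add,
    Finset.sum_add_distrib]
  ring

lemma curvContraction_add_right (R : ι → ι → Matrix ι ι ℝ) (t C C' : ι → Matrix ι ι ℝ) :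
    curvContraction R t (C + C') = curvContraction R t C + curvContraction R t C' := by
  have hgram : sliceGram (C + C') t = sliceGram C t + sliceGram C' t := by
    ext l m
    simp [sliceGram, Matrix.add_mul]
  simp only [curvContraction, hgram, Pi.add_apply, Matrix.mul_add, trace_add,
    Finset.sum_add_distrib]
  ring

lemma sliceGram_isSymm (t : ι → Matrix ι ι ℝ) : (sliceGram t t).IsSymm := by
  ext i j
  exact trace_mul_comm _ _

lemma trace_mul_eq_zero_of_isSymm_of_skew {A B : Matrix ι ι ℝ} (hA : A.IsSymm) (hB : Bᵀ = -B) :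
    (A * B).trace = 0 := by
  have hneg : (A * B).trace = -(A * B).trace := by
    conv_lhs => rw [← trace_transpose, transpose_mul, hB, hA.eq, Matrix.neg_mul, trace_neg,
      trace_mul_comm]
  linarith

namespace IsTracefreeSymm

variable {t : ι → Matrix ι ι ℝ}

lemma swap_right (h : IsTracefreeSymm t) (i j k : ι) : t i j k = t i k j := (h.isSymm i).apply k j

lemma sum_apply_self (h : IsTracefreeSymm t) (j : ι) : ∑ k, t k k j = 0 := by
  rw [← h.trace_eq_zero j]
  exact Finset.sum_congr rfl fun k _ => by rw [h.swap_right, h.swap, diag_apply]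

lemma sum_mul_apply_left (h : IsTracefreeSymm t) (X : Matrix ι ι ℝ) (j : ι) :
    ∑ k, (t k * X) k j = 0 := by
  simp only [mul_apply]
  rw [Finset.sum_comm]
  simp only [← Finset.sum_mul, h.sum_apply_self, zero_mul, Finset.sum_const_zero]

lemma sum_mul_apply_right (h : IsTracefreeSymm t) (X : Matrix ι ι ℝ) (i : ι) :
    ∑ k, (X * t k) i k = 0 := by
  rw [← h.sum_mul_apply_left Xᵀ i]
  refine Finset.sum_congr rfl fun k _ => ?_
  rw [← transpose_apply (X * t k), transpose_mul, h.isSymm k]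

lemma sum_mul_slice_apply (h : IsTracefreeSymm t) (k j : ι) :
    ∑ m, (t k * t m) m j = sliceGram t t k j := by
  simp only [sliceGram, of_apply, trace, diag_apply, mul_apply]
  refine Finset.sum_congr rfl fun m _ => Finset.sum_congr rfl fun p _ => ?_
  rw [h.swap m, h.swap_right p, h.swap p]

lemma sum_slice_mul_apply (h : IsTracefreeSymm t) (i m : ι) :
    ∑ k, (t k * t m) i k = sliceGram t t i m := by
  simp only [sliceGram, of_apply, trace, diag_apply, mul_apply]
  refine Finset.sum_congr rfl fun k _ => Finset.sum_congr rfl fun p _ => ?_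
  rw [h.swap k]

lemma mulVec_apply_comm (h : IsTracefreeSymm t) (b : ι → ℝ) (i j : ι) :
    (t i *ᵥ b) j = (t j *ᵥ b) i :=
  Finset.sum_congr rfl fun k _ => congrArg (· * b k) (h.swap i j k)

lemma sum_mul_mulVec_apply (h : IsTracefreeSymm t) {R : ι → ι → Matrix ι ι ℝ}
    (hswap : ∀ k m, R m k = -R k m) (b : ι → ℝ) : ∑ k, ∑ m, ((t m * R k m) *ᵥ b) k = 0 := by
  have hneg : ∑ k, ∑ m, ((t m * R k m) *ᵥ b) k = -∑ k, ∑ m, ((t m * R k m) *ᵥ b) k := by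
    conv_lhs => rw [Finset.sum_comm]
    simp only [← Finset.sum_neg_distrib, ← mulVec_mulVec]
    refine Finset.sum_congr rfl fun k _ => Finset.sum_congr rfl fun m _ => ?_
    rw [h.mulVec_apply_comm, hswap, Matrix.neg_mulVec, mulVec_neg, Pi.neg_apply]
  linarith

lemma sliceMulVec_isSymm (h : IsTracefreeSymm t) (b : ι → ℝ) : (sliceMulVec t b).IsSymm := by
  ext i j
  exact h.mulVec_apply_comm b j i

lemma trace_sliceMulVec (h : IsTracefreeSymm t) (b : ι → ℝ) : (sliceMulVec t b).trace = 0 := by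
  simp only [trace, diag_apply, sliceMulVec, of_apply, mulVec, dotProduct]
  rw [Finset.sum_comm]
  simp only [← Finset.sum_mul, h.sum_apply_self, zero_mul, Finset.sum_const_zero]

lemma sliceMulVec_eq_sum (h : IsTracefreeSymm t) (b : ι → ℝ) :
    sliceMulVec t b = ∑ i, b i • t i := by
  ext j k
  simp only [sliceMulVec, of_apply, mulVec, dotProduct, Matrix.sum_apply, Matrix.smul_apply,
    smul_eq_mul]
  exact Finset.sum_congr rfl fun i _ => by rw [h.swap_right, h.swap, h.swap_right, mul_comm]

lemma trace_vecMulVec_mul_sliceGram (h : IsTracefreeSymm t) (b : ι → ℝ) :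
    (vecMulVec b b * sliceGram t t).trace = frobSq (sliceMulVec t b) := by
  rw [frobSq, (h.sliceMulVec_isSymm b).eq, h.sliceMulVec_eq_sum, Finset.sum_mul_sum, vecMulVec_mul,
    trace_vecMulVec]
  simp only [trace_sum, Matrix.smul_mul, Matrix.mul_smul, trace_smul, smul_eq_mul, dotProduct,
    vecMul, Finset.mul_sum, sliceGram, of_apply]
  rw [Finset.sum_comm]

/-- Antisymmetrizing in the two slices turns `tr(tₘ ⁅tₘ, tₖ⁆ tₖ)` into a sum of squares. -/
lemma curvContraction_lie (h : IsTracefreeSymm t) :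
    curvContraction (fun k m => ⁅t m, t k⁆) t t
      = ∑ k, ∑ m, frobSq ⁅t m, t k⁆ + frobSq (sliceGram t t) := by
  have hsq : ∀ k m, frobSq ⁅t m, t k⁆
      = (t m * ⁅t m, t k⁆ * t k).trace + (t k * ⁅t k, t m⁆ * t m).trace := fun k m => by
    simp only [frobSq, Ring.lie_def, transpose_sub, transpose_mul, (h.isSymm _).eq]
    rw [trace_mul_cycle (t m) _ (t k), trace_mul_cycle (t k) _ (t m), ← trace_add]
    congr 1
    simp only [Matrix.sub_mul, Matrix.mul_sub, Matrix.mul_assoc]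
    abel
  have hricci : ricciContraction (fun k m => ⁅t m, t k⁆) = (sliceGram t t)ᵀ := by
    rw [sliceGram_isSymm]
    ext m l
    simp only [ricciContraction, of_apply, Ring.lie_def, Matrix.sub_apply, Finset.sum_sub_distrib,
      h.sum_mul_apply_left, h.sum_mul_slice_apply, sub_zero]
  simp only [hsq, Finset.sum_add_distrib]
  rw [Finset.sum_comm (f := fun k m => (t k * ⁅t k, t m⁆ * t m).trace), curvContraction, hricci,
    frobSq, two_mul]

lemma sum_frobSq_lie_le (h : IsTracefreeSymm t) :
    ∑ k, ∑ m, frobSq ⁅t m, t k⁆ ≤ 2 * ((sliceGram t t).trace ^ 2 - frobSq (sliceGram t t)) := by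
  have hgram : ∀ i j, sliceGram t t i j = ((t i)ᵀ * t j).trace := fun i j => by
    rw [h.isSymm i, sliceGram, of_apply]
  calc ∑ k, ∑ m, frobSq ⁅t m, t k⁆
      ≤ ∑ k, ∑ m, 2 * (sliceGram t t k k * sliceGram t t m m - sliceGram t t m k ^ 2) := by
        gcongr with k _ m _
        rw [hgram, hgram, hgram, mul_comm (trace _)]
        exact frobSq_lie_le_gram (h.isSymm m) (t k)
    _ = 2 * ((sliceGram t t).trace ^ 2 - frobSq (sliceGram t t)) := by
        rw [frobSq_eq_sum, Finset.sum_comm (f := fun i j => sliceGram t t i j ^ 2), sq, trace,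
          Finset.sum_mul_sum]
        simp only [← Finset.mul_sum, Finset.sum_sub_distrib, diag_apply]

end IsTracefreeSymm

variable [DecidableEq ι]

/-- The Kulkarni–Nomizu product of `P` with the metric. -/
def kulkarniNomizu (P : Matrix ι ι ℝ) (k m : ι) : Matrix ι ι ℝ := P * wedge m k + wedge m k * P

/-- The Gauss equation of a Lagrangian submanifold with second fundamental form `C`. -/
def gaussCurvature (c : ℝ) (C : ι → Matrix ι ι ℝ) (k m : ι) : Matrix ι ι ℝ :=
  ⁅C m, C k⁆ + kulkarniNomizu ((c / 2) • 1) k m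

lemma trace_mul_wedge_mul (A B : Matrix ι ι ℝ) (i j : ι) :
    (A * wedge i j * B).trace = (B * A) j i - (B * A) i j := by
  rw [trace_mul_cycle, wedge, Matrix.mul_sub, trace_sub, trace_mul_single, trace_mul_single]
  simp

lemma ricciContraction_kulkarniNomizu (P : Matrix ι ι ℝ) :
    ricciContraction (kulkarniNomizu P) = Pᵀ + (1 - (Fintype.card ι : ℝ)) • P - P.trace • 1 := by
  ext m l
  simp [ricciContraction, kulkarniNomizu, wedge, Matrix.mul_sub, Matrix.sub_mul, mul_apply,
    single_apply, Finset.sum_add_distrib, trace, one_apply, ite_and]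
  ring

lemma IsTracefreeSymm.curvContraction_kulkarniNomizu {t : ι → Matrix ι ι ℝ}
    (h : IsTracefreeSymm t) (P : Matrix ι ι ℝ) :
    curvContraction (kulkarniNomizu P) t t
      = -((Fintype.card ι + 2) * (P * sliceGram t t).trace + P.trace * (sliceGram t t).trace) := by
  have hterm : ∀ k m, (t m * kulkarniNomizu P k m * t k).trace
      = (t k * (t m * P)) k m - (t k * t m * P) m k
        + ((P * t k * t m) k m - (P * (t k * t m)) m k) := fun k m => by
    have hexpand : t m * kulkarniNomizu P k m * t k
        = t m * P * wedge m k * t k + t m * wedge m k * (P * t k) := by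
      simp only [kulkarniNomizu, Matrix.mul_add, Matrix.add_mul, Matrix.mul_assoc]
    rw [hexpand, trace_add, trace_mul_wedge_mul, trace_mul_wedge_mul]
    simp only [Matrix.mul_assoc]
  have hleft : ∑ k, ∑ m, (t k * t m * P) m k = (P * sliceGram t t).trace := by
    rw [trace_mul_comm, trace]
    refine Finset.sum_congr rfl fun k _ => ?_
    simp only [diag_apply, mul_apply (M := t k * t _), mul_apply (M := sliceGram t t),
      ← h.sum_mul_slice_apply, Finset.sum_mul]
    exact Finset.sum_comm
  have hright : ∑ k, ∑ m, (P * (t k * t m)) m k = (P * sliceGram t t).trace := by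
    rw [Finset.sum_comm, trace]
    refine Finset.sum_congr rfl fun m _ => ?_
    simp only [diag_apply, mul_apply (M := P), ← h.sum_slice_mul_apply, Finset.mul_sum]
    exact Finset.sum_comm
  have hricci : (Pᵀ * sliceGram t t).trace = (P * sliceGram t t).trace := by
    rw [← trace_transpose, transpose_mul, transpose_transpose, sliceGram_isSymm, trace_mul_comm]
  simp only [curvContraction, hterm, Finset.sum_add_distrib, Finset.sum_sub_distrib, hleft, hright,
    h.sum_mul_apply_right, Finset.sum_const_zero, ricciContraction_kulkarniNomizu, Matrix.add_mul,
    Matrix.sub_mul, Matrix.smul_mul, Matrix.one_mul, trace_add, trace_sub, trace_smul, hricci,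
    smul_eq_mul]
  rw [Finset.sum_comm (f := fun k m => (t k * (t m * P)) k m)]
  simp only [h.sum_mul_apply_left, Finset.sum_const_zero]
  ring

lemma kulkarniNomizu_add (P Q : Matrix ι ι ℝ) :
    kulkarniNomizu (P + Q) = kulkarniNomizu P + kulkarniNomizu Q := by
  ext1 k
  ext1 m
  simp only [kulkarniNomizu, Pi.add_apply, Matrix.add_mul, Matrix.mul_add]
  abel

lemma kulkarniNomizu_swap (P : Matrix ι ι ℝ) (k m : ι) :
    kulkarniNomizu P m k = -kulkarniNomizu P k m := by
  rw [kulkarniNomizu, wedge_swap k m, Matrix.mul_neg, Matrix.neg_mul, ← neg_add, kulkarniNomizu]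

lemma transpose_kulkarniNomizu {P : Matrix ι ι ℝ} (hP : P.IsSymm) (k m : ι) :
    (kulkarniNomizu P k m)ᵀ = -kulkarniNomizu P k m := by
  rw [kulkarniNomizu, transpose_add, transpose_mul, transpose_mul, transpose_wedge, hP.eq,
    Matrix.neg_mul, Matrix.mul_neg, neg_add_rev]

lemma gaussCurvature_swap (c : ℝ) (C : ι → Matrix ι ι ℝ) (k m : ι) :
    gaussCurvature c C m k = -gaussCurvature c C k m := by
  rw [gaussCurvature, kulkarniNomizu_swap, Ring.lie_def, ← neg_sub, ← neg_add, ← Ring.lie_def,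
    gaussCurvature]

lemma transpose_gaussCurvature (c : ℝ) {C : ι → Matrix ι ι ℝ} (hC : ∀ k, (C k).IsSymm) (k m : ι) :
    (gaussCurvature c C k m)ᵀ = -gaussCurvature c C k m := by
  have hscalar : ((c / 2) • 1 : Matrix ι ι ℝ).IsSymm := isSymm_one.smul _
  rw [gaussCurvature, transpose_add, transpose_kulkarniNomizu hscalar, Ring.lie_def, transpose_sub,
    transpose_mul, transpose_mul, (hC k).eq, (hC m).eq, neg_add, neg_sub]

lemma lie_kronSym (b : ι → ℝ) (k m : ι) :
    ⁅kronSym b m, kronSym b k⁆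
      = kulkarniNomizu (vecMulVec b b + ((b ⬝ᵥ b) / 2) • 1) k m := by
  simp only [Ring.lie_def, kronSym, kulkarniNomizu, wedge_eq_vecMulVec, Matrix.add_mul,
    Matrix.mul_add, Matrix.mul_sub, Matrix.sub_mul, Matrix.smul_mul, Matrix.mul_smul,
    Matrix.one_mul, Matrix.mul_one, vecMulVec_mul_vecMulVec, dotProduct_comm _ b,
    dotProduct_single_one, vecMulVec_smul]
  rw [Pi.single_comm]
  module

namespace IsTracefreeSymm

variable {t : ι → Matrix ι ι ℝ}

lemma lie_kronSym_add_lie_kronSym (h : IsTracefreeSymm t) (b : ι → ℝ) (k m : ι) :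
    ⁅t m, kronSym b k⁆ + ⁅kronSym b m, t k⁆ = kulkarniNomizu (sliceMulVec t b) k m := by
  have hcol : ∀ i j, t i *ᵥ Pi.single j 1 = t j *ᵥ Pi.single i 1 := fun i j => by
    ext p
    simp [h.swap_right i, h.swap_right j, h.swap i]
  have hmul : ∀ i, sliceMulVec t b *ᵥ Pi.single i 1 = t i *ᵥ b := fun i => by
    ext p
    simp [sliceMulVec, h.mulVec_apply_comm b i]
  have hvec : ∀ i, Pi.single i 1 ᵥ* sliceMulVec t b = t i *ᵥ b := fun i => by
    ext p
    simp [sliceMulVec]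
  have hsymm : ∀ i (v : ι → ℝ), v ᵥ* t i = t i *ᵥ v := fun i v => by
    rw [← mulVec_transpose, (h.isSymm i).eq]
  simp only [Ring.lie_def, kronSym, kulkarniNomizu, wedge_eq_vecMulVec, Matrix.add_mul,
    Matrix.mul_add, Matrix.mul_sub, Matrix.sub_mul, Matrix.smul_mul, Matrix.mul_smul,
    Matrix.one_mul, Matrix.mul_one, mul_vecMulVec, vecMulVec_mul, hmul, hvec, hsymm, hcol k m]
  abel

lemma sliceGram_kronSym (h : IsTracefreeSymm t) (b : ι → ℝ) :
    sliceGram (kronSym b) t = (2 : ℝ) • sliceMulVec t b := by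
  ext k m
  have hsymm : ∀ v : ι → ℝ, v ᵥ* t m = t m *ᵥ v := fun v => by
    rw [← mulVec_transpose, (h.isSymm m).eq]
  simp only [sliceGram, sliceMulVec, of_apply, Matrix.smul_apply, h.mulVec_apply_comm b k,
    kronSym, Matrix.add_mul, Matrix.smul_mul, Matrix.one_mul, trace_add, trace_smul,
    h.trace_eq_zero, vecMulVec_mul, hsymm, trace_vecMulVec, smul_zero, zero_add,
    single_one_dotProduct]
  rw [← hsymm (Pi.single k 1), dotProduct_comm, ← dotProduct_mulVec]
  simp only [single_one_dotProduct, smul_eq_mul]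
  ring

lemma curvContraction_kronSym (h : IsTracefreeSymm t) {R : ι → ι → Matrix ι ι ℝ}
    (hswap : ∀ k m, R m k = -R k m) (hskew : ∀ k m, (R k m)ᵀ = -R k m) (b : ι → ℝ) :
    curvContraction R t (kronSym b) = 0 := by
  have hterm : ∀ k m, (t m * R k m * kronSym b k).trace
      = (t m * R k m).col k ⬝ᵥ b + ((t m * R k m) *ᵥ b) k := fun k m => by
    simp [kronSym, Matrix.mul_add, trace_mul_eq_zero_of_isSymm_of_skew (h.isSymm m) (hskew k m),
      mul_vecMulVec]
  have hfirst : ∀ m, ∑ k, (t m * R k m).col k ⬝ᵥ b = -(ricciContraction R m ⬝ᵥ t m *ᵥ b) :=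
    fun m => by
      have hcol : ∑ k, (R k m).col k = -ricciContraction R m := by
        ext q
        have hentry : ∀ k, R k m q k = -R k m k q := fun k => by
          rw [← transpose_apply (R k m), hskew, Matrix.neg_apply]
        simp [hentry, ricciContraction]
      have hsum : ∑ k, (t m * R k m).col k = -(t m *ᵥ ricciContraction R m) := by
        rw [← mulVec_neg, ← hcol, mulVec_sum]
        rfl
      rw [← sum_dotProduct, hsum, neg_dotProduct, dotProduct_mulVec, ← mulVec_transpose,
        (h.isSymm m).eq]
  have hricci : (ricciContraction R * sliceGram (kronSym b) t).trace
      = 2 * ∑ m, ricciContraction R m ⬝ᵥ t m *ᵥ b := by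
    rw [h.sliceGram_kronSym, Matrix.mul_smul, trace_smul, smul_eq_mul, trace]
    refine congrArg (2 * ·) (Finset.sum_congr rfl fun m _ => Finset.sum_congr rfl fun l _ => ?_)
    exact congrArg (ricciContraction R m l * ·) (h.mulVec_apply_comm b l m)
  simp only [curvContraction, hterm, Finset.sum_add_distrib, h.sum_mul_mulVec_apply hswap, hricci]
  rw [Finset.sum_comm]
  simp only [hfirst, Finset.sum_neg_distrib]
  ring

lemma gaussCurvature_add_kronSym (h : IsTracefreeSymm t) (b : ι → ℝ) (c : ℝ) :
    gaussCurvature c (t + kronSym b) = (fun k m => ⁅t m, t k⁆)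
      + kulkarniNomizu (sliceMulVec t b + vecMulVec b b + ((c + b ⬝ᵥ b) / 2) • 1) := by
  funext k m
  have hlie : ⁅t m + kronSym b m, t k + kronSym b k⁆
      = ⁅t m, t k⁆ + (⁅t m, kronSym b k⁆ + ⁅kronSym b m, t k⁆) + ⁅kronSym b m, kronSym b k⁆ := by
    simp only [Ring.lie_def, Matrix.add_mul, Matrix.mul_add]
    abel
  simp only [gaussCurvature, Pi.add_apply, hlie, h.lie_kronSym_add_lie_kronSym, lie_kronSym]
  have hscalar : ((c + b ⬝ᵥ b) / 2) • (1 : Matrix ι ι ℝ)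
      = ((b ⬝ᵥ b) / 2) • (1 : Matrix ι ι ℝ) + (c / 2) • (1 : Matrix ι ι ℝ) := by
    rw [← add_smul]
    ring_nf
  simp only [hscalar, kulkarniNomizu_add, Pi.add_apply]
  abel

theorem curvContraction_gaussCurvature_le [Nonempty ι] (h : IsTracefreeSymm t) (b : ι → ℝ)
    (c : ℝ) :
    ((Fintype.card ι : ℝ) + 1) * c * (sliceGram t t).trace
        + (Fintype.card ι + 2) * (b ⬝ᵥ b) * (sliceGram t t).trace
        - (Fintype.card ι + 3) / 2 * (sliceGram t t).trace ^ 2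
      ≤ -curvContraction (gaussCurvature c (t + kronSym b)) t (t + kronSym b) := by
  set B := sliceMulVec t b with hB
  set P := B + vecMulVec b b + ((c + b ⬝ᵥ b) / 2) • 1 with hP
  have hcurv : gaussCurvature c (t + kronSym b) = (fun k m => ⁅t m, t k⁆) + kulkarniNomizu P :=
    h.gaussCurvature_add_kronSym b c
  have hkron : curvContraction (gaussCurvature c (t + kronSym b)) t (kronSym b) = 0 :=
    h.curvContraction_kronSym (gaussCurvature_swap c _)
      (transpose_gaussCurvature c fun k => (h.isSymm k).add (kronSym_isSymm b k)) b
  rw [curvContraction_add_right, hkron, add_zero, hcurv, curvContraction_add_left,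
    h.curvContraction_lie, h.curvContraction_kulkarniNomizu]
  have hPG : (P * sliceGram t t).trace = (B * sliceGram t t).trace + frobSq B
      + (c + b ⬝ᵥ b) / 2 * (sliceGram t t).trace := by
    simp [hP, hB, Matrix.add_mul, h.trace_vecMulVec_mul_sliceGram]
  have hP_trace : P.trace = b ⬝ᵥ b + (c + b ⬝ᵥ b) / 2 * Fintype.card ι := by
    simp [hP, hB, h.trace_sliceMulVec]
  have hsq : 0 ≤ frobSq (sliceGram t t) + 4 * (B * sliceGram t t).trace + 4 * frobSq B := by
    have hnonneg := frobSq_nonneg (sliceGram t t + (2 : ℝ) • B)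
    rw [frobSq_add_smul, (h.sliceMulVec_isSymm b).eq] at hnonneg
    linarith
  have hcard : (1 : ℝ) ≤ Fintype.card ι := by exact_mod_cast Fintype.card_pos
  have hlie_nonneg : 0 ≤ ∑ k, ∑ m, frobSq ⁅t m, t k⁆ :=
    Finset.sum_nonneg fun _ _ => Finset.sum_nonneg fun _ _ => frobSq_nonneg _
  have hlie_le := h.sum_frobSq_lie_le
  have hgram_nonneg := frobSq_nonneg (sliceGram t t)
  rw [hPG, hP_trace]
  nlinarith

end IsTracefreeSymm

end AlgebraicInequality

/-! ### Kähler curvature tensors -/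

section KaehlerCurvature

variable {W : Type*} [AddCommGroup W]

/-- A curvature tensor on `W`: a quadrilinear form with the symmetries of the Riemann tensor. Only
additivity in the first argument is required, as the symmetries carry it over to the others. -/
structure IsCurvatureTensor (R : W → W → W → W → ℝ) : Prop where
  add_fst : ∀ x x' y z w, R (x + x') y z w = R x y z w + R x' y z w
  swap_fst_snd : ∀ x y z w, R y x z w = -R x y z w
  swap_trd_fth : ∀ x y z w, R x y w z = -R x y z w
  bianchi : ∀ x y z w, R x y z w + R y z x w + R z x y w = 0

variable {R S : W → W → W → W → ℝ}

namespace IsCurvatureTensor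

lemma pair_symm (h : IsCurvatureTensor R) (x y z w : W) : R x y z w = R z w x y := by
  linarith [h.bianchi x y z w, h.bianchi y z w x, h.bianchi z w x y, h.bianchi w x y z,
    h.swap_trd_fth y z x w, h.swap_trd_fth z w x y, h.swap_trd_fth w x y z,
    h.swap_trd_fth x y z w, h.swap_fst_snd x z y w, h.swap_trd_fth x z y w,
    h.swap_fst_snd y w z x, h.swap_trd_fth y w z x]

lemma add_snd (h : IsCurvatureTensor R) (x y y' z w : W) :
    R x (y + y') z w = R x y z w + R x y' z w := by
  rw [h.swap_fst_snd, h.add_fst, h.swap_fst_snd x y, h.swap_fst_snd x y']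
  ring

lemma add_trd (h : IsCurvatureTensor R) (x y z z' w : W) :
    R x y (z + z') w = R x y z w + R x y z' w := by
  rw [h.pair_symm, h.add_fst, h.pair_symm x y z, h.pair_symm x y z']

lemma add_fth (h : IsCurvatureTensor R) (x y z w w' : W) :
    R x y z (w + w') = R x y z w + R x y z w' := by
  rw [h.pair_symm, h.add_snd, h.pair_symm x y z w, h.pair_symm x y z w']

lemma neg_fst (h : IsCurvatureTensor R) (x y z w : W) : R (-x) y z w = -R x y z w :=
  (AddMonoidHom.mk' (R · y z w) fun a b => h.add_fst a b y z w).map_neg x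

lemma neg_snd (h : IsCurvatureTensor R) (x y z w : W) : R x (-y) z w = -R x y z w :=
  (AddMonoidHom.mk' (R x · z w) fun a b => h.add_snd x a b z w).map_neg y

lemma neg_trd (h : IsCurvatureTensor R) (x y z w : W) : R x y (-z) w = -R x y z w :=
  (AddMonoidHom.mk' (R x y · w) fun a b => h.add_trd x y a b w).map_neg z

lemma neg_fth (h : IsCurvatureTensor R) (x y z w : W) : R x y z (-w) = -R x y z w :=
  (AddMonoidHom.mk' (R x y z ·) fun a b => h.add_fth x y z a b).map_neg w

lemma sub_const_mul (hR : IsCurvatureTensor R) (hS : IsCurvatureTensor S) (c : ℝ) :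
    IsCurvatureTensor fun x y z w => R x y z w - c * S x y z w where
  add_fst x x' y z w := by rw [hR.add_fst, hS.add_fst]; ring
  swap_fst_snd x y z w := by rw [hR.swap_fst_snd x, hS.swap_fst_snd x]; ring
  swap_trd_fth x y z w := by rw [hR.swap_trd_fth x, hS.swap_trd_fth x]; ring
  bianchi x y z w := by linear_combination hR.bianchi x y z w - c * hS.bianchi x y z w

theorem eq_zero_of_sectional_eq_zero (h : IsCurvatureTensor R) (hsec : ∀ x y, R x y x y = 0)
    (x y z w : W) : R x y z w = 0 := by
  have hfst_trd : ∀ x y z, R x y z y = 0 := fun x y z => by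
    have hsum := hsec (x + z) y
    simp only [h.add_fst, h.add_trd, hsec] at hsum
    linarith [h.pair_symm x y z y]
  have hsnd_fth : ∀ x y z w, R x w z y = -R x y z w := fun x y z w => by
    have hsum := hfst_trd x (y + w) z
    simp only [h.add_snd, h.add_fth, hfst_trd] at hsum
    linarith
  have hcyclic : ∀ x y z w, R y z x w = R x y z w := fun x y z w => by
    rw [h.swap_fst_snd, hsnd_fth, neg_neg, h.pair_symm, h.swap_fst_snd, h.swap_trd_fth, neg_neg]
  linarith [h.bianchi x y z w, hcyclic x y z w, hcyclic y z x w]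

end IsCurvatureTensor

variable [Module ℝ W] {J : W →ₗ[ℝ] W}

/-- A curvature tensor of Kähler type with respect to the complex structure `J`. -/
structure IsKaehlerCurvature (J : W →ₗ[ℝ] W) (R : W → W → W → W → ℝ) : Prop
    extends IsCurvatureTensor R where
  J_sq : ∀ x, J (J x) = -x
  map_J_trd_fth : ∀ x y z w, R x y (J z) (J w) = R x y z w

namespace IsKaehlerCurvature

lemma sub_const_mul (hR : IsKaehlerCurvature J R) (hS : IsKaehlerCurvature J S) (c : ℝ) :
    IsKaehlerCurvature J fun x y z w => R x y z w - c * S x y z w where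
  toIsCurvatureTensor := hR.toIsCurvatureTensor.sub_const_mul hS.toIsCurvatureTensor c
  J_sq := hR.J_sq
  map_J_trd_fth x y z w := by rw [hR.map_J_trd_fth, hS.map_J_trd_fth]

lemma map_J_fst_snd (h : IsKaehlerCurvature J R) (x y z w : W) :
    R (J x) (J y) z w = R x y z w := by
  rw [h.pair_symm, h.map_J_trd_fth, h.pair_symm x y]

lemma map_J_snd_comm (h : IsKaehlerCurvature J R) (x y z w : W) :
    R y (J x) z w = R x (J y) z w := by
  rw [← h.map_J_fst_snd, h.J_sq, h.neg_snd, ← h.swap_fst_snd]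

lemma map_J_fth_comm (h : IsKaehlerCurvature J R) (x y z w : W) :
    R z w y (J x) = R z w x (J y) := by
  rw [h.pair_symm, h.map_J_snd_comm, h.pair_symm]

lemma holomorphic_polarization (h : IsKaehlerCurvature J R) (hol : ∀ x, R x (J x) x (J x) = 0)
    (x y : W) : R x (J x) y (J y) + 2 * R x (J y) x (J y) = 0 := by
  have hadd := hol (x + y)
  have hsub := hol (x + -y)
  simp only [map_add, map_neg, h.add_fst, h.add_snd, h.add_trd, h.add_fth, h.neg_fst, h.neg_snd,
    h.neg_trd, h.neg_fth, hol] at hadd hsub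
  have hyxyx : R y (J x) y (J x) = R x (J y) x (J y) := by
    rw [h.map_J_snd_comm, h.map_J_fth_comm]
  linarith [h.map_J_fth_comm x y x (J y), h.map_J_snd_comm x y x (J y), h.pair_symm y (J y) x (J x)]

theorem sectional_eq_zero (h : IsKaehlerCurvature J R) (hol : ∀ x, R x (J x) x (J x) = 0)
    (x y : W) : R x y x y = 0 := by
  have hthree : ∀ x y, 3 * R x (J y) x (J y) + R x y x y = 0 := fun x y => by
    have hswap : R (J x) y x (J y) = -R x (J y) x (J y) := by
      rw [h.swap_fst_snd, h.map_J_snd_comm]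
    have hJ : R y x (J x) (J y) = -R x y x y := by rw [h.map_J_trd_fth, h.swap_fst_snd]
    linarith [h.bianchi x (J x) y (J y), h.holomorphic_polarization hol x y]
  have hthree_J := hthree x (J y)
  rw [h.J_sq, h.neg_snd, h.neg_fth] at hthree_J
  linarith [hthree x y]

end IsKaehlerCurvature

/-- The curvature tensor of constant holomorphic sectional curvature `4` determined by an inner
product `b` and a complex structure `J`. -/
def modelCurvature (b : LinearMap.BilinForm ℝ W) (J : W →ₗ[ℝ] W) (x y z w : W) : ℝ :=
  b y z * b x w - b x z * b y w + b (J y) z * b (J x) w - b (J x) z * b (J y) w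
    + 2 * (b x (J y) * b (J z) w)

section Model

variable {b : LinearMap.BilinForm ℝ W}

lemma isKaehlerCurvature_modelCurvature (hJ : ∀ x, J (J x) = -x) (b_symm : ∀ x y, b x y = b y x)
    (b_skew : ∀ x y, b (J x) y = -b x (J y)) : IsKaehlerCurvature J (modelCurvature b J) := by
  have hanti : ∀ u v, b u (J v) = -b v (J u) := fun u v => by rw [b_symm, b_skew]
  refine ⟨⟨fun x x' y z w => ?_, fun x y z w => ?_, fun x y z w => ?_, fun x y z w => ?_⟩, hJ,
    fun x y z w => ?_⟩
  · simp only [modelCurvature, map_add, LinearMap.add_apply]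
    ring
  · simp only [modelCurvature, b_skew]
    rw [hanti y x]
    ring
  · simp only [modelCurvature, b_skew]
    rw [hanti w z]
    ring
  · simp only [modelCurvature, b_skew]
    rw [b_symm z y, b_symm z x, b_symm x y, hanti z x, hanti z y, hanti y x]
    ring
  · simp only [modelCurvature, b_skew, hJ, map_neg, LinearMap.neg_apply]
    ring

theorem IsKaehlerCurvature.eq_const_mul_modelCurvature (h : IsKaehlerCurvature J R) {c : ℝ}
    (b_symm : ∀ x y, b x y = b y x) (b_J : ∀ x y, b (J x) (J y) = b x y)
    (hol : ∀ x, R x (J x) (J x) x = 4 * c * b x x ^ 2) (x y z w : W) :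
    R x y z w = c * modelCurvature b J x y z w := by
  have b_skew : ∀ u v, b (J u) v = -b u (J v) := fun u v => by
    rw [← b_J (J u) v, h.J_sq, map_neg, LinearMap.neg_apply]
  have b_self_J : ∀ u, b u (J u) = 0 := fun u => by linarith [b_symm u (J u), b_skew u u]
  have hdiff :=
    h.sub_const_mul (isKaehlerCurvature_modelCurvature h.J_sq b_symm b_skew) c
  refine sub_eq_zero.mp <| hdiff.eq_zero_of_sectional_eq_zero (hdiff.sectional_eq_zero fun u => ?_)
    x y z w
  simp only [modelCurvature, h.swap_trd_fth u (J u) (J u), hol, b_skew, b_self_J, h.J_sq, map_neg,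
    LinearMap.neg_apply]
  ring

end Model

end KaehlerCurvature

section AmbientCurvature

variable {m : ℕ} {G : Coord m → Coord m →L[ℝ] Coord m →L[ℝ] ℝ}
  {J : Coord m → Coord m →L[ℝ] Coord m} {V : Set (Coord m)} {x : Coord m}

lemma isParallelMap_of_covEnd_eq_zero (hJ : DifferentiableAt ℝ J x)
    (hpar : ∀ u v, covEnd G J x u v = 0) :
    IsParallelMap (christoffelL G) (christoffelL G) J x := fun u v => by
  rw [christoffelL_apply, christoffelL_apply, ← fderiv_clm_apply_const hJ, eq_sub_iff_add_eq,
    ← sub_eq_zero]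
  exact hpar u v

lemma connDeriv_homConn_christoffelL (hJ : DifferentiableAt ℝ J x) (u v : Coord m) :
    connDeriv (homConn (christoffelL G) (christoffelL G)) J x u v = covEnd G J x u v := by
  simp only [connDeriv_apply, add_apply, homConn_apply, covEnd, fderiv_clm_apply_const hJ,
    christoffelL_apply]
  abel

namespace IsMetricOn

lemma curvature_bianchi (h : IsMetricOn G V) (hx : x ∈ V) (u v w : Coord m) :
    curvature G x u v w + curvature G x v w u + curvature G x w u v = 0 := by
  simp only [← h.connCurvature_christoffelL hx]
  refine connCurvature_bianchi (h.differentiableAt_christoffelL hx) ?_ u v w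
  filter_upwards [h.isOpen.mem_nhds hx] with y hy a b
  simpa only [christoffelL_apply] using h.christoffel_symm hy a b

lemma curvature_skew (h : IsMetricOn G V) (hx : x ∈ V) (u v w z : Coord m) :
    G x (curvature G x u v z) w = -G x (curvature G x u v w) z := by
  have hskew := IsParallelPairing.connCurvature_skew (h.differentiableAt_christoffelL hx)
    ((h.smooth.contDiffAt (h.isOpen.mem_nhds hx)).of_le (by norm_cast))
    (by filter_upwards [h.isOpen.mem_nhds hx] with y hy using h.isParallelPairing_metric hy)
    u v z w
  rw [h.connCurvature_christoffelL hx, h.connCurvature_christoffelL hx] at hskew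
  rw [hskew, h.symm x hx]

lemma curvature_map_of_parallel (h : IsMetricOn G V) (hx : x ∈ V) (hJ : ContDiffOn ℝ ∞ J V)
    (hpar : ∀ y ∈ V, ∀ u v, covEnd G J y u v = 0) (u v w : Coord m) :
    curvature G x u v (J x w) = J x (curvature G x u v w) := by
  have hΓ := h.differentiableAt_christoffelL hx
  have hparallel : ∀ᶠ y in nhds x,
      connDeriv (homConn (christoffelL G) (christoffelL G)) J y = 0 := by
    filter_upwards [h.isOpen.mem_nhds hx] with y hy
    ext1 a
    ext1 b
    exact (connDeriv_homConn_christoffelL (h.differentiableAt_of_contDiffOn hy hJ) a b).trans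
      (hpar y hy a b)
  have hρ := h.differentiableAt_of_contDiffOn hx
    (contDiffOn_homConn h.contDiffOn_christoffelL h.contDiffOn_christoffelL)
  have hcurv := connCurvature_apply_of_parallel hρ
    ((hJ.contDiffAt (h.isOpen.mem_nhds hx)).of_le (by norm_cast)) hparallel u v
  have happly := congrArg (fun L : Coord m →L[ℝ] Coord m => L w) hcurv
  simp only [connCurvature_homConn hΓ hΓ, h.connCurvature_christoffelL hx] at happly
  exact sub_eq_zero.mp happly

theorem inner_curvature_eq_modelCurvature (h : IsMetricOn G V) (hx : x ∈ V)
    (hJ : ContDiffOn ℝ ∞ J V) (hsq : ∀ v, J x (J x v) = -v)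
    (horth : ∀ v w, G x (J x v) (J x w) = G x v w)
    (hpar : ∀ y ∈ V, ∀ u v, covEnd G J y u v = 0) {c : ℝ}
    (hol : ∀ v, G x (curvature G x v (J x v) (J x v)) v = 4 * c * (G x v v) ^ 2)
    (u v w z : Coord m) :
    G x (curvature G x u v w) z = c * modelCurvature (G x).toBilinForm (J x) u v w z := by
  have hkaehler : IsKaehlerCurvature (J x : Coord m →ₗ[ℝ] Coord m)
      fun a b d e => G x (curvature G x a b d) e := by
    refine ⟨⟨fun a a' b d e => ?_, fun a b d e => ?_, fun a b d e => h.curvature_skew hx a b d e,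
      fun a b d e => ?_⟩, hsq, fun a b d e => ?_⟩
    · simp only [← h.connCurvature_christoffelL hx, connCurvature_add_left, add_apply, map_add]
    · simp only [← h.connCurvature_christoffelL hx]
      rw [connCurvature_swap, neg_apply, map_neg, neg_apply]
    · rw [← add_apply, ← add_apply, ← map_add, ← map_add, h.curvature_bianchi hx, map_zero,
        zero_apply]
    · simp only [ContinuousLinearMap.coe_coe, h.curvature_map_of_parallel hx hJ hpar, horth]
  exact hkaehler.eq_const_mul_modelCurvature (b := (G x).toBilinForm) (h.symm x hx) horth hol
    u v w z

end IsMetricOn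

end AmbientCurvature

/-! ### Immersions in coordinates -/

section Immersions

variable {n m : ℕ}

/-- The coordinate expression `F` on `U` of an immersion into the Riemannian manifold given by the
metric `G` on the coordinate domain `V`. -/
structure IsImmersionChart (G : Coord m → Coord m →L[ℝ] Coord m →L[ℝ] ℝ) (F : Coord n → Coord m)
    (U : Set (Coord n)) (V : Set (Coord m)) : Prop where
  metric : IsMetricOn G V
  isOpen : IsOpen U
  smooth : ContDiffOn ℝ ∞ F U
  mapsTo : Set.MapsTo F U V
  injective : ∀ y ∈ U, Function.Injective (fderiv ℝ F y)

/-- The pullback of the ambient Levi-Civita connection to the fields along `F`. -/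
def alongConn (G : Coord m → Coord m →L[ℝ] Coord m →L[ℝ] ℝ) (F : Coord n → Coord m) :
    Coord n → Coord n →L[ℝ] Coord m →L[ℝ] Coord m :=
  pullbackConn (christoffelL G) F

/-- The second fundamental form as a smooth field of bilinear maps, namely the covariant derivative
`(u, v) ↦ (∇_u dF) v` of the differential. -/
def shapeTensor (G : Coord m → Coord m →L[ℝ] Coord m →L[ℝ] ℝ) (F : Coord n → Coord m) :
    Coord n → Coord n →L[ℝ] Coord n →L[ℝ] Coord m :=
  connDeriv (homConn (christoffelL (indMetric G F)) (alongConn G F)) (fderiv ℝ F)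

/-- The covariant derivative of the second fundamental form, for the ambient connection (the
tangential component is not removed) and the Levi-Civita connection of the induced metric. -/
def covShapeTensor (G : Coord m → Coord m →L[ℝ] Coord m →L[ℝ] ℝ) (F : Coord n → Coord m) :
    Coord n → Coord n →L[ℝ] Coord n →L[ℝ] Coord n →L[ℝ] Coord m :=
  connDeriv (homConn (christoffelL (indMetric G F))
    (homConn (christoffelL (indMetric G F)) (alongConn G F))) (shapeTensor G F)

variable {G : Coord m → Coord m →L[ℝ] Coord m →L[ℝ] ℝ} {F : Coord n → Coord m}
  {U : Set (Coord n)} {V : Set (Coord m)} {x : Coord n}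

@[simp]
lemma indMetric_apply (y u v : Coord n) :
    indMetric G F y u v = G (F y) (fderiv ℝ F y u) (fderiv ℝ F y v) := rfl

lemma covAlong_eq_connDeriv (Y : Coord n → Coord m) (y u : Coord n) :
    covAlong G F Y y u = connDeriv (alongConn G F) Y y u := by
  rw [covAlong, connDeriv_apply, ← christoffelL_apply]
  rfl

namespace IsImmersionChart

lemma differentiableAt_of_contDiffOn {W : Type*} [NormedAddCommGroup W] [NormedSpace ℝ W]
    {Y : Coord n → W} (h : IsImmersionChart G F U V) (hx : x ∈ U) (hY : ContDiffOn ℝ ∞ Y U) :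
    DifferentiableAt ℝ Y x :=
  LagrangianSimons.differentiableAt_of_contDiffOn h.isOpen hx hY

lemma contDiffOn_fderiv (h : IsImmersionChart G F U V) : ContDiffOn ℝ ∞ (fderiv ℝ F) U :=
  h.smooth.fderiv_of_isOpen h.isOpen (by simp)

lemma contDiffOn_fderiv_apply (h : IsImmersionChart G F U V) (u : Coord n) :
    ContDiffOn ℝ ∞ (fun y => fderiv ℝ F y u) U := h.contDiffOn_fderiv.clm_apply contDiffOn_const

lemma contDiffOn_metric_apply (h : IsImmersionChart G F U V) {Y Z : Coord n → Coord m}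
    (hY : ContDiffOn ℝ ∞ Y U) (hZ : ContDiffOn ℝ ∞ Z U) :
    ContDiffOn ℝ ∞ (fun y => G (F y) (Y y) (Z y)) U :=
  ((h.metric.smooth.comp h.smooth h.mapsTo).clm_apply hY).clm_apply hZ

lemma isMetricOn (h : IsImmersionChart G F U V) : IsMetricOn (indMetric G F) U where
  isOpen := h.isOpen
  smooth := contDiffOn_clm_apply.2 fun u => contDiffOn_clm_apply.2 fun v =>
    h.contDiffOn_metric_apply (h.contDiffOn_fderiv_apply u) (h.contDiffOn_fderiv_apply v)
  symm _ hy _ _ := h.metric.symm _ (h.mapsTo hy) _ _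
  pos y hy _ hu := h.metric.pos _ (h.mapsTo hy) _ fun hzero =>
    hu (h.injective y hy (hzero.trans (map_zero _).symm))

lemma contDiffOn_alongConn (h : IsImmersionChart G F U V) : ContDiffOn ℝ ∞ (alongConn G F) U :=
  contDiffOn_pullbackConn h.isOpen h.metric.contDiffOn_christoffelL h.smooth h.mapsTo

lemma isParallelPairing_metric (h : IsImmersionChart G F U V) (hx : x ∈ U) :
    IsParallelPairing (alongConn G F) (fun y => G (F y)) x :=
  (h.metric.isParallelPairing_metric (h.mapsTo hx)).pullback
    (h.metric.differentiableAt_of_contDiffOn (h.mapsTo hx) h.metric.smooth)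
    (h.differentiableAt_of_contDiffOn hx h.smooth)

lemma fderiv_metric_apply (h : IsImmersionChart G F U V) (hx : x ∈ U) {Y Z : Coord n → Coord m}
    (hY : ContDiffOn ℝ ∞ Y U) (hZ : ContDiffOn ℝ ∞ Z U) (u : Coord n) :
    fderiv ℝ (fun y => G (F y) (Y y) (Z y)) x u
      = G (F x) (connDeriv (alongConn G F) Y x u) (Z x)
        + G (F x) (Y x) (connDeriv (alongConn G F) Z x u) :=
  (h.isParallelPairing_metric hx).fderiv_apply_apply
    (h.differentiableAt_of_contDiffOn hx (h.metric.smooth.comp h.smooth h.mapsTo))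
    (h.differentiableAt_of_contDiffOn hx hY) (h.differentiableAt_of_contDiffOn hx hZ) u

lemma contDiffOn_shapeTensor (h : IsImmersionChart G F U V) :
    ContDiffOn ℝ ∞ (shapeTensor G F) U :=
  contDiffOn_connDeriv h.isOpen
    (contDiffOn_homConn h.isMetricOn.contDiffOn_christoffelL h.contDiffOn_alongConn)
    h.contDiffOn_fderiv

lemma contDiffOn_shapeTensor_apply (h : IsImmersionChart G F U V) (u v : Coord n) :
    ContDiffOn ℝ ∞ (fun y => shapeTensor G F y u v) U :=
  (h.contDiffOn_shapeTensor.clm_apply contDiffOn_const).clm_apply contDiffOn_const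

lemma gauss_formula (h : IsImmersionChart G F U V) (hx : x ∈ U) (u v : Coord n) :
    connDeriv (alongConn G F) (fun y => fderiv ℝ F y v) x u
      = shapeTensor G F x u v + fderiv ℝ F x (christoffel (indMetric G F) x u v) := by
  rw [shapeTensor, connDeriv_apply_const (h.differentiableAt_of_contDiffOn hx h.contDiffOn_fderiv),
    christoffelL_apply, sub_add_cancel]

lemma connDeriv_shapeTensor_apply (h : IsImmersionChart G F U V) (hx : x ∈ U) (u v w : Coord n) :
    connDeriv (alongConn G F) (fun y => shapeTensor G F y v w) x u
      = covShapeTensor G F x u v w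
        + shapeTensor G F x (christoffel (indMetric G F) x u v) w
        + shapeTensor G F x v (christoffel (indMetric G F) x u w) := by
  rw [covShapeTensor, connDeriv_apply_const_apply_const
    (h.differentiableAt_of_contDiffOn hx h.contDiffOn_shapeTensor), christoffelL_apply,
    christoffelL_apply]
  abel

lemma shapeTensor_symm (h : IsImmersionChart G F U V) (hx : x ∈ U) (u v : Coord n) :
    shapeTensor G F x u v = shapeTensor G F x v u := by
  have hF : ContDiffAt ℝ 2 F x :=
    (h.smooth.contDiffAt (h.isOpen.mem_nhds hx)).of_le (by norm_cast)
  simp only [shapeTensor, connDeriv_apply, add_apply, homConn_apply, alongConn, pullbackConn,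
    ContinuousLinearMap.comp_apply, christoffelL_apply, fderiv_fderiv_comm hF u v,
    h.isMetricOn.christoffel_symm hx u v, h.metric.christoffel_symm (h.mapsTo hx)
    (fderiv ℝ F x u)]

/-- The trilinear form `⟨B(u, v), dF w⟩` is symmetric in `u, v` and, as both connections are
metric, skew in `v, w`. -/
lemma inner_shapeTensor_tangent (h : IsImmersionChart G F U V) (hx : x ∈ U) (u v w : Coord n) :
    G (F x) (shapeTensor G F x u v) (fderiv ℝ F x w) = 0 := by
  have hsymm := h.metric.symm _ (h.mapsTo hx)
  have hskew : ∀ a b c, G (F x) (shapeTensor G F x a b) (fderiv ℝ F x c)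
      = -G (F x) (shapeTensor G F x a c) (fderiv ℝ F x b) := fun a b c => by
    have hind := h.isMetricOn.fderiv_metric hx a b c
    have hamb := h.fderiv_metric_apply hx (h.contDiffOn_fderiv_apply b)
      (h.contDiffOn_fderiv_apply c) a
    have hg := h.differentiableAt_of_contDiffOn hx h.isMetricOn.smooth
    rw [← fderiv_clm_apply_const hg, ← fderiv_clm_apply_const
      (hg.clm_apply (differentiableAt_const b))] at hind
    simp only [indMetric_apply] at hind
    rw [hind, h.gauss_formula hx, h.gauss_formula hx, map_add, map_add,
      add_apply] at hamb
    linarith [hsymm (fderiv ℝ F x b) (shapeTensor G F x a c)]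
  have hswap := h.shapeTensor_symm hx
  linarith [hskew u v w, hskew v w u, hskew w u v,
    congrArg (G (F x) · (fderiv ℝ F x w)) (hswap u v),
    congrArg (G (F x) · (fderiv ℝ F x u)) (hswap v w),
    congrArg (G (F x) · (fderiv ℝ F x v)) (hswap w u)]

lemma covShapeTensor_sub_covShapeTensor_swap (h : IsImmersionChart G F U V) (hx : x ∈ U)
    (u v w : Coord n) :
    covShapeTensor G F x u v w - covShapeTensor G F x v u w
      = curvature G (F x) (fderiv ℝ F x u) (fderiv ℝ F x v) (fderiv ℝ F x w)
        - fderiv ℝ F x (curvature (indMetric G F) x u v w) := by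
  have hFx := h.mapsTo hx
  have hg := h.isMetricOn
  have hricci := ricci_identity (Γ := christoffelL (indMetric G F))
    (ρ := homConn (christoffelL (indMetric G F)) (alongConn G F))
    (fun u v => by simp only [christoffelL_apply, hg.christoffel_symm hx u v])
    (h.differentiableAt_of_contDiffOn hx
      (contDiffOn_homConn hg.contDiffOn_christoffelL h.contDiffOn_alongConn))
    ((h.contDiffOn_fderiv.contDiffAt (h.isOpen.mem_nhds hx)).of_le (by norm_cast))
    (h.differentiableAt_of_contDiffOn hx h.contDiffOn_shapeTensor) u v
  have happly := congrArg (fun L : Coord n →L[ℝ] Coord m => L w) hricci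
  rw [connCurvature_homConn (hg.differentiableAt_christoffelL hx)
    (h.differentiableAt_of_contDiffOn hx h.contDiffOn_alongConn), hg.connCurvature_christoffelL hx,
    alongConn, connCurvature_pullbackConn (h.metric.differentiableAt_christoffelL hFx)
    ((h.smooth.contDiffAt (h.isOpen.mem_nhds hx)).of_le (by norm_cast)),
    h.metric.connCurvature_christoffelL hFx] at happly
  exact happly

lemma inner_covShapeTensor_tangent (h : IsImmersionChart G F U V) (hx : x ∈ U)
    (u v w z : Coord n) :
    G (F x) (covShapeTensor G F x u v w) (fderiv ℝ F x z)
      = -G (F x) (shapeTensor G F x v w) (shapeTensor G F x u z) := by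
  have hzero : (fun y => G (F y) (shapeTensor G F y v w) (fderiv ℝ F y z))
      =ᶠ[nhds x] fun _ => 0 := by
    filter_upwards [h.isOpen.mem_nhds hx] with y hy using h.inner_shapeTensor_tangent hy v w z
  have hderiv := h.fderiv_metric_apply hx (h.contDiffOn_shapeTensor_apply v w)
    (h.contDiffOn_fderiv_apply z) u
  rw [hzero.fderiv_eq, h.connDeriv_shapeTensor_apply hx, h.gauss_formula hx] at hderiv
  simp only [map_add, add_apply, h.inner_shapeTensor_tangent hx, fderiv_fun_const, Pi.zero_apply,
    zero_apply] at hderiv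
  linarith

theorem gauss_equation (h : IsImmersionChart G F U V) (hx : x ∈ U) (u v w z : Coord n) :
    indMetric G F x (curvature (indMetric G F) x u v w) z
      = G (F x) (curvature G (F x) (fderiv ℝ F x u) (fderiv ℝ F x v) (fderiv ℝ F x w))
          (fderiv ℝ F x z)
        + G (F x) (shapeTensor G F x v w) (shapeTensor G F x u z)
        - G (F x) (shapeTensor G F x u w) (shapeTensor G F x v z) := by
  have hricci := congrArg (G (F x) · (fderiv ℝ F x z))
    (h.covShapeTensor_sub_covShapeTensor_swap hx u v w)
  simp only [map_sub, sub_apply, h.inner_covShapeTensor_tangent hx] at hricci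
  rw [indMetric_apply]
  linarith

lemma exists_normalProj_eq_sub (h : IsImmersionChart G F U V) (hx : x ∈ U) (w : Coord m) :
    ∃ s, normalProj G F x w = w - fderiv ℝ F x s ∧
      ∀ z, G (F x) w (fderiv ℝ F x z) = indMetric G F x s z := by
  refine ⟨_, ?_, fun z =>
    (h.isMetricOn.inner_sharp hx ((G (F x) w).comp (fderiv ℝ F x)) z).symm⟩
  simp [normalProj, sharp_apply]

lemma inner_normalProj_tangent (h : IsImmersionChart G F U V) (hx : x ∈ U) (w : Coord m)
    (z : Coord n) : G (F x) (normalProj G F x w) (fderiv ℝ F x z) = 0 := by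
  obtain ⟨s, hproj, hs⟩ := h.exists_normalProj_eq_sub hx w
  rw [hproj, map_sub, sub_apply, hs, indMetric_apply, sub_self]

lemma normalProj_add_tangent (h : IsImmersionChart G F U V) (hx : x ∈ U) {w : Coord m}
    (hw : ∀ z, G (F x) w (fderiv ℝ F x z) = 0) (t : Coord n) :
    normalProj G F x (w + fderiv ℝ F x t) = w := by
  obtain ⟨s, hproj, hs⟩ := h.exists_normalProj_eq_sub hx (w + fderiv ℝ F x t)
  have hst : t = s := h.isMetricOn.ext_inner hx fun z => by
    rw [← hs, map_add, add_apply, hw, zero_add, indMetric_apply]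
  rw [hproj, hst, add_sub_cancel_right]

lemma secondFF_eq_shapeTensor (h : IsImmersionChart G F U V) (hx : x ∈ U) (u v : Coord n) :
    secondFF G F x u v = shapeTensor G F x u v := by
  rw [secondFF, covAlong_eq_connDeriv, h.gauss_formula hx,
    h.normalProj_add_tangent hx (h.inner_shapeTensor_tangent hx u v)]

end IsImmersionChart

end Immersions

/-! ### Lagrangian immersions in coordinates -/

section LagrangianCharts

variable {n m : ℕ}

/-- The coordinate expression `F` on `U` of a Lagrangian immersion into a Kähler manifold of
constant holomorphic sectional curvature `4c`, given by `G` and `J` on the coordinate domain `V`. -/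
structure IsLagrangianChart (c : ℝ) (G : Coord m → Coord m →L[ℝ] Coord m →L[ℝ] ℝ)
    (J : Coord m → Coord m →L[ℝ] Coord m) (F : Coord n → Coord m) (U : Set (Coord n))
    (V : Set (Coord m)) : Prop extends IsImmersionChart G F U V where
  J_smooth : ContDiffOn ℝ ∞ J V
  J_sq : ∀ y ∈ V, ∀ v, J y (J y v) = -v
  J_orth : ∀ y ∈ V, ∀ v w, G y (J y v) (J y w) = G y v w
  J_parallel : ∀ y ∈ V, ∀ u v, covEnd G J y u v = 0
  hol : ∀ y ∈ V, ∀ v, G y (curvature G y v (J y v) (J y v)) v = 4 * c * (G y v v) ^ 2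
  isotropic : ∀ y ∈ U, ∀ u v, G (F y) (fderiv ℝ F y u) (J (F y) (fderiv ℝ F y v)) = 0
  normal : ∀ y ∈ U, ∀ w, (∀ u, G (F y) (fderiv ℝ F y u) w = 0) →
    ∃ v, J (F y) (fderiv ℝ F y v) = w

/-- The cubic form `(u, v, w) ↦ ⟨B(u, v), J dF w⟩`, which determines the second fundamental form
`B` of a Lagrangian immersion. -/
def cubicForm (G : Coord m → Coord m →L[ℝ] Coord m →L[ℝ] ℝ)
    (J : Coord m → Coord m →L[ℝ] Coord m) (F : Coord n → Coord m) (y : Coord n) : Cubic n :=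
  (ContinuousLinearMap.compL ℝ (Coord n) (Coord m) (Coord n →L[ℝ] ℝ)
    (((ContinuousLinearMap.compL ℝ (Coord n) (Coord m) ℝ).flip
      ((J (F y)).comp (fderiv ℝ F y))).comp (G (F y)))).comp (shapeTensor G F y)

variable {c : ℝ} {G : Coord m → Coord m →L[ℝ] Coord m →L[ℝ] ℝ}
  {J : Coord m → Coord m →L[ℝ] Coord m} {F : Coord n → Coord m} {U : Set (Coord n)}
  {V : Set (Coord m)} {x : Coord n}

lemma cubicForm_apply (y u v w : Coord n) : cubicForm G J F y u v w =
    G (F y) (shapeTensor G F y u v) (J (F y) (fderiv ℝ F y w)) := rfl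

namespace IsLagrangianChart

lemma contDiffOn_J_apply (h : IsLagrangianChart c G J F U V) {Y : Coord n → Coord m}
    (hY : ContDiffOn ℝ ∞ Y U) : ContDiffOn ℝ ∞ (fun y => J (F y) (Y y)) U :=
  (h.J_smooth.comp h.smooth h.mapsTo).clm_apply hY

lemma connDeriv_J_apply (h : IsLagrangianChart c G J F U V) (hx : x ∈ U) {Y : Coord n → Coord m}
    (hY : ContDiffOn ℝ ∞ Y U) (u : Coord n) :
    connDeriv (alongConn G F) (fun y => J (F y) (Y y)) x u
      = J (F x) (connDeriv (alongConn G F) Y x u) := by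
  have hJ := h.metric.differentiableAt_of_contDiffOn (h.mapsTo hx) h.J_smooth
  have hpar := (isParallelMap_of_covEnd_eq_zero hJ (h.J_parallel _ (h.mapsTo hx))).pullback hJ
    (h.differentiableAt_of_contDiffOn hx h.smooth)
  exact hpar.connDeriv_comm
    (h.differentiableAt_of_contDiffOn hx (h.J_smooth.comp h.smooth h.mapsTo))
    (h.differentiableAt_of_contDiffOn hx hY) u

lemma inner_J_left (h : IsLagrangianChart c G J F U V) (hx : x ∈ U) (a b : Coord m) :
    G (F x) (J (F x) a) b = -G (F x) a (J (F x) b) := by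
  rw [← h.J_orth _ (h.mapsTo hx) (J (F x) a) b, h.J_sq _ (h.mapsTo hx), map_neg, neg_apply]

lemma inner_J_fderiv_left (h : IsLagrangianChart c G J F U V) (hx : x ∈ U) (u v : Coord n) :
    G (F x) (J (F x) (fderiv ℝ F x u)) (fderiv ℝ F x v) = 0 := by
  rw [h.inner_J_left hx, h.isotropic x hx, neg_zero]

lemma exists_J_fderiv_eq (h : IsLagrangianChart c G J F U V) (hx : x ∈ U) {w : Coord m}
    (hw : ∀ z, G (F x) w (fderiv ℝ F x z) = 0) : ∃ s, J (F x) (fderiv ℝ F x s) = w :=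
  h.normal x hx w fun u => by rw [h.metric.symm _ (h.mapsTo hx), hw]

lemma inner_J_of_normal (h : IsLagrangianChart c G J F U V) (hx : x ∈ U) {a b : Coord m}
    (ha : ∀ z, G (F x) a (fderiv ℝ F x z) = 0) (hb : ∀ z, G (F x) b (fderiv ℝ F x z) = 0) :
    G (F x) a (J (F x) b) = 0 := by
  obtain ⟨s, rfl⟩ := h.exists_J_fderiv_eq hx hb
  rw [h.J_sq _ (h.mapsTo hx), map_neg, ha, neg_zero]

lemma inner_normalProj_J (h : IsLagrangianChart c G J F U V) (hx : x ∈ U) (w : Coord m)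
    (z : Coord n) :
    G (F x) (normalProj G F x w) (J (F x) (fderiv ℝ F x z))
      = G (F x) w (J (F x) (fderiv ℝ F x z)) := by
  obtain ⟨s, hproj, -⟩ := h.exists_normalProj_eq_sub hx w
  rw [hproj, map_sub, sub_apply, h.isotropic x hx, sub_zero]

/-- The vectors `J dF e_i` form an orthonormal frame of the normal space. -/
lemma inner_eq_sum_of_normal (h : IsLagrangianChart c G J F U V) (hx : x ∈ U)
    {e : Fin n → Coord n} (he : IsOrthonormalFrame (indMetric G F) x e) {a b : Coord m}
    (hb : ∀ z, G (F x) b (fderiv ℝ F x z) = 0) :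
    G (F x) a b = ∑ i, G (F x) a (J (F x) (fderiv ℝ F x (e i)))
      * G (F x) b (J (F x) (fderiv ℝ F x (e i))) := by
  obtain ⟨s, rfl⟩ := h.exists_J_fderiv_eq hx hb
  conv_lhs => rw [← he.sum_inner_smul s]
  simp only [h.J_orth _ (h.mapsTo hx), map_sum, map_smul, smul_eq_mul, indMetric_apply]
  exact Finset.sum_congr rfl fun i _ => by
    rw [h.metric.symm _ (h.mapsTo hx) (fderiv ℝ F x (e i)), mul_comm]

lemma contDiffOn_cubicForm (h : IsLagrangianChart c G J F U V) :
    ContDiffOn ℝ ∞ (cubicForm G J F) U :=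
  contDiffOn_clm_apply.2 fun u => contDiffOn_clm_apply.2 fun v => contDiffOn_clm_apply.2 fun w =>
    h.contDiffOn_metric_apply (h.contDiffOn_shapeTensor_apply u v)
      (h.contDiffOn_J_apply (h.contDiffOn_fderiv_apply w))

lemma isSymmCubic_cubicForm (h : IsLagrangianChart c G J F U V) (hx : x ∈ U) :
    IsSymmCubic (cubicForm G J F x) := by
  refine ⟨fun u v w => by rw [cubicForm_apply, h.shapeTensor_symm hx, cubicForm_apply],
    fun u v w => ?_⟩
  have hzero : (fun y => G (F y) (fderiv ℝ F y v) (J (F y) (fderiv ℝ F y w))) =ᶠ[nhds x]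
      fun _ => 0 := by
    filter_upwards [h.isOpen.mem_nhds hx] with y hy using h.isotropic y hy v w
  have hderiv := h.fderiv_metric_apply hx (h.contDiffOn_fderiv_apply v)
    (h.contDiffOn_J_apply (h.contDiffOn_fderiv_apply w)) u
  rw [hzero.fderiv_eq, h.connDeriv_J_apply hx (h.contDiffOn_fderiv_apply w),
    h.gauss_formula hx, h.gauss_formula hx] at hderiv
  simp only [map_add, add_apply, h.isotropic x hx, fderiv_fun_const, Pi.zero_apply,
    zero_apply] at hderiv
  rw [cubicForm_apply, cubicForm_apply, h.metric.symm _ (h.mapsTo hx) (shapeTensor G F x u w),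
    h.inner_J_left hx]
  linarith

lemma cubicCov_cubicForm (h : IsLagrangianChart c G J F U V) (hx : x ∈ U) (u v w z : Coord n) :
    cubicCov (indMetric G F) (cubicForm G J F) x u v w z
      = G (F x) (covShapeTensor G F x u v w) (J (F x) (fderiv ℝ F x z)) := by
  have hJB : G (F x) (shapeTensor G F x v w) (J (F x) (shapeTensor G F x u z)) = 0 :=
    h.inner_J_of_normal hx (h.inner_shapeTensor_tangent hx v w) (h.inner_shapeTensor_tangent hx u z)
  have hderiv : fderiv ℝ (fun y => cubicForm G J F y v w z) x u = _ :=
    h.fderiv_metric_apply hx (h.contDiffOn_shapeTensor_apply v w)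
      (h.contDiffOn_J_apply (h.contDiffOn_fderiv_apply z)) u
  rw [cubicCov_apply (h.differentiableAt_of_contDiffOn hx h.contDiffOn_cubicForm), hderiv,
    h.connDeriv_J_apply hx (h.contDiffOn_fderiv_apply z), h.gauss_formula hx,
    h.connDeriv_shapeTensor_apply hx]
  simp only [map_add, add_apply, hJB, cubicForm_apply]
  ring

lemma inner_curvature_fderiv (h : IsLagrangianChart c G J F U V) (hx : x ∈ U) (u v w : Coord n)
    (a : Coord m) :
    G (F x) (curvature G (F x) (fderiv ℝ F x u) (fderiv ℝ F x v) (fderiv ℝ F x w)) a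
      = c * (indMetric G F x v w * G (F x) (fderiv ℝ F x u) a
        - indMetric G F x u w * G (F x) (fderiv ℝ F x v) a) := by
  have hFx := h.mapsTo hx
  rw [h.metric.inner_curvature_eq_modelCurvature hFx h.J_smooth (h.J_sq _ hFx) (h.J_orth _ hFx)
    h.J_parallel (h.hol _ hFx)]
  simp [modelCurvature, h.isotropic x hx, h.inner_J_fderiv_left hx]

theorem codazzi_equation (h : IsLagrangianChart c G J F U V) (hx : x ∈ U)
    (u v : Coord n) :
    cubicCov (indMetric G F) (cubicForm G J F) x u v
      = cubicCov (indMetric G F) (cubicForm G J F) x v u := by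
  ext w z
  have hricci := congrArg (G (F x) · (J (F x) (fderiv ℝ F x z)))
    (h.covShapeTensor_sub_covShapeTensor_swap hx u v w)
  simp only [map_sub, sub_apply, ← h.cubicCov_cubicForm hx, h.inner_curvature_fderiv hx,
    h.isotropic x hx, mul_zero, sub_zero] at hricci
  exact sub_eq_zero.mp hricci

theorem gauss_equation_cubicForm (h : IsLagrangianChart c G J F U V) (hx : x ∈ U)
    {e : Fin n → Coord n} (he : IsOrthonormalFrame (indMetric G F) x e) (u v w z : Coord n) :
    indMetric G F x (curvature (indMetric G F) x u v w) z
      = c * (indMetric G F x v w * indMetric G F x u z - indMetric G F x u w * indMetric G F x v z)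
        + ∑ i, (cubicForm G J F x v w (e i) * cubicForm G J F x u z (e i)
          - cubicForm G J F x u w (e i) * cubicForm G J F x v z (e i)) := by
  rw [h.gauss_equation hx, h.inner_curvature_fderiv hx,
    h.inner_eq_sum_of_normal hx he (h.inner_shapeTensor_tangent hx u z),
    h.inner_eq_sum_of_normal hx he (h.inner_shapeTensor_tangent hx v z), Finset.sum_sub_distrib]
  simp only [cubicForm_apply, indMetric_apply]
  ring

end IsLagrangianChart

end LagrangianCharts

/-! ### The invariants of a Lagrangian immersion in terms of its cubic form -/

section Invariants

variable {n m : ℕ} {c : ℝ} {G : Coord m → Coord m →L[ℝ] Coord m →L[ℝ] ℝ}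
  {J : Coord m → Coord m →L[ℝ] Coord m} {F : Coord n → Coord m} {U : Set (Coord n)}
  {V : Set (Coord m)} {x : Coord n}

/-- The trace-free part of the cubic form, which corresponds to the Lagrangian trace-free second
fundamental form. -/
def tfCubicForm (G : Coord m → Coord m →L[ℝ] Coord m →L[ℝ] ℝ)
    (J : Coord m → Coord m →L[ℝ] Coord m) (F : Coord n → Coord m) (y : Coord n) : Cubic n :=
  tracefreePart (indMetric G F) y (cubicForm G J F y)

namespace IsLagrangianChart

lemma contDiffOn_tfCubicForm (h : IsLagrangianChart c G J F U V) :
    ContDiffOn ℝ ∞ (tfCubicForm G J F) U :=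
  h.isMetricOn.contDiffOn_tracefreePart.clm_apply h.contDiffOn_cubicForm

lemma isSymmCubic_tfCubicForm (h : IsLagrangianChart c G J F U V) (hx : x ∈ U) :
    IsSymmCubic (tfCubicForm G J F x) :=
  h.isMetricOn.isSymmCubic_tracefreePart hx (h.isSymmCubic_cubicForm hx)

lemma metricTrace_tfCubicForm (h : IsLagrangianChart c G J F U V) (hx : x ∈ U) :
    metricTrace (indMetric G F) x (tfCubicForm G J F x) = 0 :=
  h.isMetricOn.metricTrace_tracefreePart hx _

lemma inner_secondFF (h : IsLagrangianChart c G J F U V) (hx : x ∈ U) (u v w : Coord n) :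
    G (F x) (secondFF G F x u v) (J (F x) (fderiv ℝ F x w)) = cubicForm G J F x u v w := by
  rw [h.secondFF_eq_shapeTensor hx, cubicForm_apply]

lemma inner_secondFF_tangent (h : IsLagrangianChart c G J F U V) (hx : x ∈ U) (u v w : Coord n) :
    G (F x) (secondFF G F x u v) (fderiv ℝ F x w) = 0 := by
  rw [h.secondFF_eq_shapeTensor hx, h.inner_shapeTensor_tangent hx]

lemma inner_meanCurv (h : IsLagrangianChart c G J F U V) (hx : x ∈ U) (w : Coord n) :
    G (F x) (meanCurv G F x) (J (F x) (fderiv ℝ F x w)) =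
      (1 / (n : ℝ)) * metricTrace (indMetric G F) x (cubicForm G J F x) w := by
  simp only [meanCurv, metricTrace_apply, map_smul, map_sum, smul_apply, sum_apply, smul_eq_mul,
    h.inner_secondFF hx]

lemma inner_meanCurv_tangent (h : IsLagrangianChart c G J F U V) (hx : x ∈ U) (w : Coord n) :
    G (F x) (meanCurv G F x) (fderiv ℝ F x w) = 0 := by
  simp only [meanCurv, map_smul, map_sum, smul_apply, sum_apply, smul_eq_mul,
    h.inner_secondFF_tangent hx, mul_zero, Finset.sum_const_zero]

lemma inner_tfSecondFF (h : IsLagrangianChart c G J F U V) (hn : n ≠ 0) (hx : x ∈ U)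
    (u v w : Coord n) :
    G (F x) (tfSecondFF G J F x u v) (J (F x) (fderiv ℝ F x w)) = tfCubicForm G J F x u v w := by
  have hFx := h.mapsTo hx
  have hn' : (n : ℝ) ≠ 0 := by exact_mod_cast hn
  simp only [tfSecondFF, tfCubicForm, tracefreePart_apply, symProd_apply, map_sub, map_smul,
    map_add, sub_apply, smul_apply, add_apply, smul_eq_mul, h.inner_secondFF hx,
    h.inner_meanCurv hx, h.J_orth _ hFx, h.metric.symm _ hFx _ (meanCurv G F x), indMetric_apply,
    h.metric.symm _ hFx (fderiv ℝ F x w)]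
  field_simp
  ring

lemma inner_tfSecondFF_tangent (h : IsLagrangianChart c G J F U V) (hx : x ∈ U)
    (u v w : Coord n) : G (F x) (tfSecondFF G J F x u v) (fderiv ℝ F x w) = 0 := by
  simp only [tfSecondFF, map_sub, map_smul, map_add, sub_apply, smul_apply, add_apply, smul_eq_mul,
    h.inner_secondFF_tangent hx, h.inner_meanCurv_tangent hx, h.inner_J_fderiv_left hx, mul_zero,
    add_zero, sub_zero]

lemma contDiffOn_secondFF (h : IsLagrangianChart c G J F U V) (u v : Coord n) :
    ContDiffOn ℝ ∞ (fun y => secondFF G F y u v) U :=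
  (h.contDiffOn_shapeTensor_apply u v).congr fun _ hy => h.secondFF_eq_shapeTensor hy u v

lemma contDiffOn_meanCurv (h : IsLagrangianChart c G J F U V) :
    ContDiffOn ℝ ∞ (meanCurv G F) U :=
  (ContDiffOn.sum fun i _ => ContDiffOn.sum fun j _ =>
    (h.isMetricOn.contDiffOn_invMetric i j).smul (h.contDiffOn_secondFF _ _)).const_smul _

lemma contDiffOn_tfSecondFF (h : IsLagrangianChart c G J F U V) (u v : Coord n) :
    ContDiffOn ℝ ∞ (fun y => tfSecondFF G J F y u v) U := by
  have hJ : ∀ w, ContDiffOn ℝ ∞ (fun y => J (F y) (fderiv ℝ F y w)) U := fun w =>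
    h.contDiffOn_J_apply (h.contDiffOn_fderiv_apply w)
  have hmetric := h.contDiffOn_metric_apply (h.contDiffOn_fderiv_apply u)
    (h.contDiffOn_fderiv_apply v)
  have hH := h.contDiffOn_meanCurv
  exact (h.contDiffOn_secondFF u v).sub ((((hmetric.smul hH).add
    ((h.contDiffOn_metric_apply (hJ u) hH).smul (hJ v))).add
    ((h.contDiffOn_metric_apply (hJ v) hH).smul (hJ u))).const_smul _)

lemma inner_covTfSecondFF (h : IsLagrangianChart c G J F U V) (hn : n ≠ 0) (hx : x ∈ U)
    (u v w z : Coord n) :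
    G (F x) (covTfSecondFF G J F x u v w) (J (F x) (fderiv ℝ F x z)) =
      cubicCov (indMetric G F) (tfCubicForm G J F) x u v w z := by
  have hderiv := h.fderiv_metric_apply hx (h.contDiffOn_tfSecondFF v w)
    (h.contDiffOn_J_apply (h.contDiffOn_fderiv_apply z)) u
  have hcongr : (fun y => G (F y) (tfSecondFF G J F y v w) (J (F y) (fderiv ℝ F y z)))
      =ᶠ[nhds x] fun y => tfCubicForm G J F y v w z := by
    filter_upwards [h.isOpen.mem_nhds hx] with y hy using h.inner_tfSecondFF hn hy v w z
  rw [hcongr.fderiv_eq, h.connDeriv_J_apply hx (h.contDiffOn_fderiv_apply z),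
    h.gauss_formula hx, map_add, map_add, h.inner_J_of_normal hx
    (h.inner_tfSecondFF_tangent hx v w) (h.inner_shapeTensor_tangent hx u z),
    h.inner_tfSecondFF hn hx] at hderiv
  rw [cubicCov_apply (h.differentiableAt_of_contDiffOn hx h.contDiffOn_tfCubicForm), hderiv]
  simp only [covTfSecondFF, normalCov, map_sub, sub_apply, h.inner_tfSecondFF hn hx,
    h.inner_normalProj_J hx, covAlong_eq_connDeriv]
  ring

lemma inner_covTfSecondFF_tangent (h : IsLagrangianChart c G J F U V) (hx : x ∈ U)
    (u v w z : Coord n) : G (F x) (covTfSecondFF G J F x u v w) (fderiv ℝ F x z) = 0 := by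
  simp only [covTfSecondFF, normalCov, map_sub, sub_apply, h.inner_tfSecondFF_tangent hx,
    h.inner_normalProj_tangent hx, sub_zero]

lemma inner_eq_homPairing_of_normal (h : IsLagrangianChart c G J F U V) (hx : x ∈ U)
    {a b : Coord m} {φ ψ : Coord n →L[ℝ] ℝ}
    (ha : ∀ z, G (F x) a (J (F x) (fderiv ℝ F x z)) = φ z)
    (hb : ∀ z, G (F x) b (J (F x) (fderiv ℝ F x z)) = ψ z)
    (hb₀ : ∀ z, G (F x) b (fderiv ℝ F x z) = 0) :
    G (F x) a b = homPairing (indMetric G F) (fun _ => ContinuousLinearMap.mul ℝ ℝ) x φ ψ := by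
  obtain ⟨e, he⟩ := h.isMetricOn.exists_orthonormalFrame hx
  simp only [h.inner_eq_sum_of_normal hx he hb₀, h.isMetricOn.homPairing_eq hx he, ha, hb,
    ContinuousLinearMap.mul_apply']

lemma normSqMeanCurv_eq (h : IsLagrangianChart c G J F U V) (hx : x ∈ U) {e : Fin n → Coord n}
    (he : IsOrthonormalFrame (indMetric G F) x e) :
    normSqMeanCurv G F x =
      ∑ a, ((1 / (n : ℝ)) * metricTrace (indMetric G F) x (cubicForm G J F x) (e a)) ^ 2 := by
  rw [normSqMeanCurv, h.inner_eq_sum_of_normal hx he (h.inner_meanCurv_tangent hx)]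
  simp only [h.inner_meanCurv hx, sq]

lemma normSqTf_eq (h : IsLagrangianChart c G J F U V) (hn : n ≠ 0) (hx : x ∈ U) :
    normSqTf G J F x =
      cubicPairing (indMetric G F) x (tfCubicForm G J F x) (tfCubicForm G J F x) := by
  have hinner : ∀ a b a' b', G (F x) (tfSecondFF G J F x a b) (tfSecondFF G J F x a' b') = _ :=
    fun a b a' b' => h.inner_eq_homPairing_of_normal hx (h.inner_tfSecondFF hn hx a b)
      (h.inner_tfSecondFF hn hx a' b') (h.inner_tfSecondFF_tangent hx a' b')
  simp only [normSqTf, hinner, cubicPairing, homPairing_eq_sum_invMetric, Finset.mul_sum,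
    mul_assoc]

lemma normSqCovTf_eq (h : IsLagrangianChart c G J F U V) (hn : n ≠ 0) (hx : x ∈ U) :
    normSqCovTf G J F x = homPairing (indMetric G F) (cubicPairing (indMetric G F)) x
      (cubicCov (indMetric G F) (tfCubicForm G J F) x)
      (cubicCov (indMetric G F) (tfCubicForm G J F) x) := by
  have hinner : ∀ a b d a' b' d',
      G (F x) (covTfSecondFF G J F x a b d) (covTfSecondFF G J F x a' b' d') = _ :=
    fun a b d a' b' d' => h.inner_eq_homPairing_of_normal hx (h.inner_covTfSecondFF hn hx a b d)
      (h.inner_covTfSecondFF hn hx a' b' d') (h.inner_covTfSecondFF_tangent hx a' b' d')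
  simp only [normSqCovTf, hinner, cubicPairing, homPairing_eq_sum_invMetric, Finset.mul_sum,
    mul_assoc]

lemma isSymmCubic_cubicCov_tfCubicForm (h : IsLagrangianChart c G J F U V) (hx : x ∈ U)
    (u : Coord n) : IsSymmCubic (cubicCov (indMetric G F) (tfCubicForm G J F) x u) :=
  h.isMetricOn.isSymmCubic_cubicCov hx h.contDiffOn_tfCubicForm
    (fun _ hy => h.isSymmCubic_tfCubicForm hy) u

lemma tensorT_eq (h : IsLagrangianChart c G J F U V) (hn : n ≠ 0) (hx : x ∈ U) (v w : Coord n) :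
    tensorT G J F x v w = (1 / (n : ℝ)) *
      metricTrace (indMetric G F) x (cubicCov (indMetric G F) (tfCubicForm G J F) x) v w := by
  have hsymm := h.isSymmCubic_cubicCov_tfCubicForm hx
  simp only [tensorT, h.inner_covTfSecondFF hn hx, metricTrace_apply, sum_apply, smul_apply,
    smul_eq_mul, (hsymm _).swap23 v w, (hsymm _).swap12 v]

lemma covTwoTensor_tensorT (h : IsLagrangianChart c G J F U V) (hn : n ≠ 0) (hx : x ∈ U)
    (u v w : Coord n) :
    covTwoTensor (indMetric G F) (tensorT G J F) x u v w = (1 / (n : ℝ)) *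
      metricTrace (indMetric G F) x (cubicHess (indMetric G F) (tfCubicForm G J F) x u) v w := by
  have hg := h.isMetricOn
  have hdiff : DifferentiableAt ℝ (fun y => metricTrace (indMetric G F) y
      (cubicCov (indMetric G F) (tfCubicForm G J F) y)) x :=
    h.differentiableAt_of_contDiffOn hx (hg.contDiffOn_metricTrace.clm_apply
      (hg.contDiffOn_cubicCov h.contDiffOn_tfCubicForm))
  rw [covTwoTensor_eq_connDeriv (hdiff.fun_const_smul (1 / (n : ℝ)))
    (by filter_upwards [h.isOpen.mem_nhds hx] with y hy using h.tensorT_eq hn hy),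
    connDeriv_const_smul hdiff, hg.connDeriv_metricTrace_cubicCov hx h.contDiffOn_tfCubicForm]
  rfl

lemma innerTfCovT_eq (h : IsLagrangianChart c G J F U V) (hn : n ≠ 0) (hx : x ∈ U) :
    innerTfCovT G J F x = (1 / (n : ℝ)) * cubicPairing (indMetric G F) x (tfCubicForm G J F x)
      ((metricTrace (indMetric G F) x).comp
        (cubicHess (indMetric G F) (tfCubicForm G J F) x)) := by
  have hinner : ∀ i j k,
      G (F x) (tfSecondFF G J F x i j) (J (F x) (fderiv ℝ F x k)) = tfCubicForm G J F x k i j :=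
    fun i j k => by
      rw [h.inner_tfSecondFF hn hx, (h.isSymmCubic_tfCubicForm hx).swap23,
        (h.isSymmCubic_tfCubicForm hx).swap12]
  simp only [innerTfCovT, hinner, h.covTwoTensor_tensorT hn hx, cubicPairing,
    homPairing_eq_sum_invMetric, ContinuousLinearMap.comp_apply, ContinuousLinearMap.mul_apply',
    Finset.mul_sum]
  simp only [mul_assoc, mul_left_comm (1 / (n : ℝ))]

end IsLagrangianChart

end Invariants

/-! ### Simons' identity -/

section SimonsIdentity

variable {m : ℕ} {g : Coord m → Coord m →L[ℝ] Coord m →L[ℝ] ℝ} {V : Set (Coord m)} {x : Coord m}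
  {e : Fin m → Coord m} {P : Coord m → Cubic m} {T : Cubic m}

/-- The slices `(P(eᵢ, eⱼ, eₖ))ⱼₖ` of the components of a trilinear form in a frame. -/
def components (e : Fin m → Coord m) (P : Cubic m) (i : Fin m) : Matrix (Fin m) (Fin m) ℝ :=
  Matrix.of fun j k => P (e i) (e j) (e k)

/-- The components `(⟨R(eₖ, eₗ)eᵢ, eⱼ⟩)ᵢⱼ` of the curvature tensor in a frame. -/
def curvComponents (g : Coord m → Coord m →L[ℝ] Coord m →L[ℝ] ℝ) (x : Coord m)
    (e : Fin m → Coord m) (k l : Fin m) : Matrix (Fin m) (Fin m) ℝ :=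
  Matrix.of fun i j => g x (curvature g x (e k) (e l) (e i)) (e j)

lemma components_apply (P : Cubic m) (i j k : Fin m) :
    components e P i j k = P (e i) (e j) (e k) :=
  rfl

lemma components_symProd (he : IsOrthonormalFrame g x e) (l : Coord m →L[ℝ] ℝ) :
    components e (symProd (g x) l) = kronSym fun i => l (e i) := by
  ext i j k
  simp [components_apply, symProd_apply, he _ _, kronSym, Matrix.one_apply,
    Matrix.vecMulVec_apply, Pi.single_apply, eq_comm]
  ring

lemma components_eq_add_kronSym (he : IsOrthonormalFrame g x e) (P : Cubic m) :
    components e P = components e (tracefreePart g x P)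
      + kronSym fun i => 1 / ((m : ℝ) + 2) * metricTrace g x P (e i) := by
  have hsymProd := components_symProd he ((1 / ((m : ℝ) + 2)) • metricTrace g x P)
  simp only [smul_apply, smul_eq_mul] at hsymProd
  rw [← hsymProd]
  ext i j k
  simp [components_apply, tracefreePart_apply]

namespace IsMetricOn

lemma isTracefreeSymm_components (h : IsMetricOn g V) (hx : x ∈ V)
    (he : IsOrthonormalFrame g x e) (hT : IsSymmCubic T) (htr : metricTrace g x T = 0) :
    IsTracefreeSymm (components e T) where
  swap i j k := hT.swap12 _ _ _
  isSymm i := Matrix.IsSymm.ext fun j k => hT.swap23 _ _ _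
  trace_eq_zero i := by
    have hzero := congrArg (fun l : Coord m →L[ℝ] ℝ => l (e i)) htr
    simpa only [Matrix.trace, Matrix.diag_apply, components_apply, h.metricTrace_eq hx he,
      sum_apply, hT.swap23 _ _ (e i), hT.swap12 _ (e i), zero_apply] using hzero

lemma cubicPairing_eq_trace_sliceGram (h : IsMetricOn g V) (hx : x ∈ V)
    (he : IsOrthonormalFrame g x e) (P : Cubic m) (hT : IsSymmCubic T) :
    cubicPairing g x P T = (sliceGram (components e P) (components e T)).trace := by
  simp only [h.cubicPairing_eq hx he, sliceGram, Matrix.trace, Matrix.diag_apply, Matrix.of_apply,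
    Matrix.mul_apply, components_apply, hT.swap23 _ (e _) (e _)]

lemma curvature_eq_sum_curvComponents (h : IsMetricOn g V) (hx : x ∈ V)
    (he : IsOrthonormalFrame g x e) (k a i : Fin m) :
    curvature g x (e k) (e a) (e i) = ∑ l, curvComponents g x e k a i l • e l := by
  conv_lhs => rw [← he.sum_inner_smul (curvature g x (e k) (e a) (e i))]
  exact Finset.sum_congr rfl fun l _ => by rw [h.symm x hx]; rfl

lemma sum_apply_curvature_mul (h : IsMetricOn g V) (hx : x ∈ V) (he : IsOrthonormalFrame g x e)
    (Q : Cubic m) (hT : IsSymmCubic T) (k a i : Fin m) :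
    ∑ b, ∑ d, Q (curvature g x (e k) (e a) (e i)) (e b) (e d) * T (e a) (e b) (e d)
      = ∑ l, curvComponents g x e k a i l
          * sliceGram (components e Q) (components e T) l a := by
  simp only [h.curvature_eq_sum_curvComponents hx he, map_sum, map_smul, sum_apply, smul_apply,
    smul_eq_mul, Finset.sum_mul, sliceGram, Matrix.of_apply, Matrix.trace, Matrix.diag_apply,
    Matrix.mul_apply, components_apply, Finset.mul_sum, mul_assoc, hT.swap23 _ (e _) (e _)]
  exact Finset.sum_comm_cycle

lemma sum_apply_apply_curvature_mul (h : IsMetricOn g V) (hx : x ∈ V)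
    (he : IsOrthonormalFrame g x e) (Q : Cubic m) (hT : IsSymmCubic T) (k a : Fin m) :
    ∑ b, ∑ d, Q (e k) (curvature g x (e k) (e a) (e b)) (e d) * T (e a) (e b) (e d)
      = (components e T a * curvComponents g x e k a * components e Q k).trace := by
  rw [Matrix.trace_mul_cycle, Matrix.trace_mul_cycle]
  simp only [Matrix.trace, Matrix.diag_apply, Matrix.mul_apply, components_apply,
    h.curvature_eq_sum_curvComponents hx he, map_sum, map_smul, sum_apply, smul_apply, smul_eq_mul,
    hT.swap23 _ (e _) (e _)]

lemma sum_curvature_action_eq_curvContraction (h : IsMetricOn g V) (hx : x ∈ V)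
    (he : IsOrthonormalFrame g x e) {Q : Cubic m} (hQ : IsSymmCubic Q) (hT : IsSymmCubic T) :
    ∑ k, ∑ a, ∑ b, ∑ d, (Q (curvature g x (e k) (e a) (e k)) (e b) (e d)
        + Q (e k) (curvature g x (e k) (e a) (e b)) (e d)
        + Q (e k) (e b) (curvature g x (e k) (e a) (e d))) * T (e a) (e b) (e d)
      = curvContraction (curvComponents g x e) (components e T) (components e Q) := by
  have hthd : ∀ k a, ∑ b, ∑ d,
      Q (e k) (e b) (curvature g x (e k) (e a) (e d)) * T (e a) (e b) (e d)
        = (components e T a * curvComponents g x e k a * components e Q k).trace := fun k a => by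
    rw [← h.sum_apply_apply_curvature_mul hx he Q hT, Finset.sum_comm]
    simp only [hQ.swap23 (e k) (e _), hT.swap23 _ (e _) (e _)]
  have hricci : ∑ k, ∑ a, ∑ l,
      curvComponents g x e k a k l * sliceGram (components e Q) (components e T) l a
        = (ricciContraction (curvComponents g x e)
          * sliceGram (components e Q) (components e T)).trace := by
    simp only [Matrix.trace, Matrix.diag_apply, Matrix.mul_apply, ricciContraction,
      Matrix.of_apply, Finset.sum_mul]
    rw [Finset.sum_comm]
    exact Finset.sum_congr rfl fun a _ => Finset.sum_comm
  simp only [add_mul, Finset.sum_add_distrib, h.sum_apply_curvature_mul hx he Q hT,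
    h.sum_apply_apply_curvature_mul hx he Q hT, hthd, hricci, curvContraction]
  ring

theorem simons_identity (h : IsMetricOn g V) (hx : x ∈ V) (he : IsOrthonormalFrame g x e)
    (hP : ContDiffOn ℝ ∞ P V) (hsymm : ∀ y ∈ V, IsSymmCubic (P y))
    (hcod : ∀ y ∈ V, ∀ u v, cubicCov g P y u v = cubicCov g P y v u) (hT : IsSymmCubic T) :
    cubicPairing g x (metricTrace g x (cubicHess g P x)) T
      = cubicPairing g x ((metricTrace g x).comp (cubicHess g P x)) T
        - curvContraction (curvComponents g x e) (components e T) (components e (P x)) := by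
  have hcomm : ∀ k a b d, cubicHess g P x k k a b d = cubicHess g P x a k k b d
      - (P x (curvature g x k a k) b d + P x k (curvature g x k a b) d
        + P x k b (curvature g x k a d)) := fun k a b d => by
    have hricci := congrArg (fun Q : Cubic m => Q k b d)
      (h.cubicHess_sub_cubicHess_swap hx hP k a)
    rw [h.connCurvature_cubicConn hx, sub_apply, sub_apply, sub_apply] at hricci
    rw [h.cubicHess_codazzi hx hP hcod k k a]
    linarith
  have hdiv : ∑ k, ∑ a, ∑ b, ∑ d, cubicHess g P x (e a) (e k) (e k) (e b) (e d)
        * T (e a) (e b) (e d)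
      = cubicPairing g x ((metricTrace g x).comp (cubicHess g P x)) T := by
    simp only [h.cubicPairing_eq hx he, ContinuousLinearMap.comp_apply, h.metricTrace_eq hx he,
      sum_apply, Finset.sum_mul]
    rw [Finset.sum_comm]
    exact Finset.sum_congr rfl fun a _ => Finset.sum_comm_cycle.symm
  rw [← h.sum_curvature_action_eq_curvContraction hx he (hsymm x hx) hT, ← hdiv,
    h.metricTrace_eq hx he, map_sum, sum_apply]
  simp only [h.cubicPairing_eq hx he, hcomm, sub_mul, Finset.sum_sub_distrib]

lemma sum_symProd_apply (h : IsMetricOn g V) (hx : x ∈ V) (he : IsOrthonormalFrame g x e)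
    (L : Coord m →L[ℝ] Coord m →L[ℝ] ℝ) (u v : Coord m) :
    ∑ a, symProd (g x) (L (e a)) (e a) u v = metricTrace g x L * g x u v + L u v + L v u := by
  have hexpand : ∀ (l : Coord m →L[ℝ] ℝ) u, ∑ a, l (e a) * g x u (e a) = l u := fun l u => by
    simpa [h.symm x hx u, mul_comm] using congrArg l (he.sum_inner_smul u)
  have hfst : ∑ a, L (e a) u * g x v (e a) = L v u := hexpand (L.flip u) v
  have hsnd : ∑ a, L (e a) v * g x (e a) u = L u v := by
    simpa only [h.symm x hx u, ContinuousLinearMap.flip_apply] using hexpand (L.flip v) u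
  simp only [h.metricTrace_eq hx he, symProd_apply, Finset.sum_add_distrib, ← Finset.sum_mul]
  linarith

lemma metricTrace_apply_of_comm (h : IsMetricOn g V) (hx : x ∈ V)
    {K : Coord m →L[ℝ] Cubic m} (hK : ∀ u v, K u v = K v u) (hKu : ∀ u, IsSymmCubic (K u))
    (u : Coord m) : metricTrace g x (K u) = metricTrace g x K u := by
  obtain ⟨e, he⟩ := h.exists_orthonormalFrame hx
  ext v
  simp only [h.metricTrace_eq hx he, sum_apply]
  exact Finset.sum_congr rfl fun a _ => by rw [hK u, (hKu (e a)).swap12 u]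

lemma sum_tracefreePart_apply (h : IsMetricOn g V) (hx : x ∈ V) (he : IsOrthonormalFrame g x e)
    {K : Coord m →L[ℝ] Cubic m} (hK : ∀ u v, K u v = K v u) (hKu : ∀ u, IsSymmCubic (K u))
    (u v : Coord m) :
    ∑ a, tracefreePart g x (K (e a)) (e a) u v
      = (m : ℝ) / ((m : ℝ) + 2) * metricTrace g x K u v
        - 1 / ((m : ℝ) + 2) * (metricTrace g x (metricTrace g x K) * g x u v) := by
  have hcomm : metricTrace g x K v u = metricTrace g x K u v := by
    simp only [metricTrace_apply, sum_apply, smul_apply, (hKu _).swap23 _ v u]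
  have htrace : metricTrace g x K u v = ∑ a, K (e a) (e a) u v := by
    rw [h.metricTrace_eq hx he, sum_apply, sum_apply]
  simp only [tracefreePart_apply, sub_apply, smul_apply, smul_eq_mul, Finset.sum_sub_distrib,
    ← Finset.mul_sum, h.metricTrace_apply_of_comm hx hK hKu, h.sum_symProd_apply hx he, hcomm,
    ← htrace]
  field_simp
  ring

lemma metricTrace_cubicHess_tracefreePart (h : IsMetricOn g V) (hx : x ∈ V)
    (hP : ContDiffOn ℝ ∞ P V) (hsymm : ∀ y ∈ V, IsSymmCubic (P y))
    (hcod : ∀ y ∈ V, ∀ u v, cubicCov g P y u v = cubicCov g P y v u) (u v w : Coord m) :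
    metricTrace g x (cubicHess g (fun y => tracefreePart g y (P y)) x u) v w
      = (m : ℝ) / ((m : ℝ) + 2) * metricTrace g x (cubicHess g P x u) v w
        - 1 / ((m : ℝ) + 2)
          * (metricTrace g x (metricTrace g x (cubicHess g P x u)) * g x v w) := by
  obtain ⟨e, he⟩ := h.exists_orthonormalFrame hx
  rw [← h.sum_tracefreePart_apply hx he (h.cubicHess_codazzi hx hP hcod u)
    (h.isSymmCubic_cubicHess hx hP hsymm u), h.metricTrace_eq hx he, sum_apply, sum_apply]
  simp only [h.cubicHess_tracefreePart hx hP]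

lemma cubicPairing_div_cubicHess_tracefreePart (h : IsMetricOn g V) (hx : x ∈ V)
    (hP : ContDiffOn ℝ ∞ P V) (hsymm : ∀ y ∈ V, IsSymmCubic (P y))
    (hcod : ∀ y ∈ V, ∀ u v, cubicCov g P y u v = cubicCov g P y v u) (hT : IsSymmCubic T)
    (htr : metricTrace g x T = 0) :
    ((m : ℝ) + 2) * cubicPairing g x ((metricTrace g x).comp
        (cubicHess g (fun y => tracefreePart g y (P y)) x)) T
      = m * cubicPairing g x ((metricTrace g x).comp (cubicHess g P x)) T := by
  obtain ⟨e, he⟩ := h.exists_orthonormalFrame hx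
  have hzero : ∀ w, ∑ b, T w (e b) (e b) = 0 := fun w => by
    have hw := congrArg (fun L : Coord m →L[ℝ] ℝ => L w) htr
    simpa only [h.metricTrace_eq hx he, sum_apply, zero_apply, hT.swap23 _ _ w,
      hT.swap12 _ w] using hw
  have hmetric : ∀ (r : ℝ) w, ∑ b, ∑ d, r * g x (e b) (e d) * T w (e b) (e d) = 0 := fun r w => by
    simp only [he _ _, mul_ite, mul_one, mul_zero, ite_mul, zero_mul, Finset.sum_ite_eq,
      Finset.mem_univ, if_true, ← Finset.mul_sum, hzero]
  have hdiv := h.metricTrace_cubicHess_tracefreePart hx hP hsymm hcod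
  simp only [h.cubicPairing_eq hx he, ContinuousLinearMap.comp_apply, hdiv, sub_mul,
    Finset.sum_sub_distrib, ← mul_assoc, hmetric, sub_zero]
  simp only [mul_assoc, ← Finset.mul_sum]
  field_simp

end IsMetricOn

end SimonsIdentity

section SimonsInequality

variable {n m : ℕ} {c : ℝ} {G : Coord m → Coord m →L[ℝ] Coord m →L[ℝ] ℝ}
  {J : Coord m → Coord m →L[ℝ] Coord m} {F : Coord n → Coord m} {U : Set (Coord n)}
  {V : Set (Coord m)} {x : Coord n} {e : Fin n → Coord n}

lemma laplacian_congr {g : Coord n → Coord n →L[ℝ] Coord n →L[ℝ] ℝ} {φ χ : Coord n → ℝ}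
    (hφχ : φ =ᶠ[nhds x] χ) : laplacian g φ x = laplacian g χ x := by
  have hfderiv : ∀ v, (fun y => fderiv ℝ φ y v) =ᶠ[nhds x] fun y => fderiv ℝ χ y v := fun v =>
    (hφχ.fderiv (𝕜 := ℝ)).mono fun y hy => congrArg (· v) hy
  simp only [laplacian, (hfderiv _).fderiv_eq, hφχ.fderiv_eq]

namespace IsLagrangianChart

lemma curvComponents_eq (h : IsLagrangianChart c G J F U V) (hx : x ∈ U)
    (he : IsOrthonormalFrame (indMetric G F) x e) :
    curvComponents (indMetric G F) x e = gaussCurvature c (components e (cubicForm G J F x)) := by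
  have hsymm := h.isSymmCubic_cubicForm hx
  ext k l i j
  have hscalar : kulkarniNomizu ((c / 2) • (1 : Matrix (Fin n) (Fin n) ℝ)) k l
      = c • wedge l k := by
    rw [kulkarniNomizu, Matrix.smul_mul, Matrix.mul_smul, Matrix.one_mul, Matrix.mul_one]
    module
  rw [curvComponents, Matrix.of_apply, h.gauss_equation_cubicForm hx he, gaussCurvature,
    hscalar, Finset.sum_sub_distrib]
  simp only [he _ _, Ring.lie_def, wedge, Matrix.add_apply, Matrix.sub_apply, Matrix.smul_apply,
    Matrix.mul_apply, Matrix.single_apply, components_apply, smul_eq_mul,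
    hsymm.swap23 _ (e _) (e j), ite_and,
    ite_mul, one_mul, zero_mul]
  ring

lemma half_laplacian_normSqTf (h : IsLagrangianChart c G J F U V) (hn : n ≠ 0) (hx : x ∈ U) :
    (1 / 2) * laplacian (indMetric G F) (normSqTf G J F) x
      = cubicPairing (indMetric G F) x (metricTrace (indMetric G F) x
          (cubicHess (indMetric G F) (cubicForm G J F) x)) (tfCubicForm G J F x)
        + normSqCovTf G J F x := by
  have hg := h.isMetricOn
  obtain ⟨e, he⟩ := hg.exists_orthonormalFrame hx
  have hnorm : normSqTf G J F =ᶠ[nhds x] fun y =>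
      cubicPairing (indMetric G F) y (tfCubicForm G J F y) (tfCubicForm G J F y) := by
    filter_upwards [h.isOpen.mem_nhds hx] with y hy using h.normSqTf_eq hn hy
  have hpairing : cubicPairing (indMetric G F) x (metricTrace (indMetric G F) x
        (cubicHess (indMetric G F) (tfCubicForm G J F) x)) (tfCubicForm G J F x)
      = cubicPairing (indMetric G F) x (metricTrace (indMetric G F) x
        (cubicHess (indMetric G F) (cubicForm G J F) x)) (tfCubicForm G J F x) := by
    -- the symmetric-product part of the Hessian of `C` is orthogonal to trace-free tensors
    simp only [hg.metricTrace_eq hx he, map_sum, sum_apply]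
    refine Finset.sum_congr rfl fun a _ => ?_
    refine Eq.trans ?_ (hg.cubicPairing_tracefreePart hx _ (h.isSymmCubic_tfCubicForm hx)
      (h.metricTrace_tfCubicForm hx))
    rw [← hg.cubicHess_tracefreePart hx h.contDiffOn_cubicForm]
    rfl
  rw [laplacian_congr hnorm, hg.laplacian_normSq hx h.contDiffOn_tfCubicForm, hpairing,
    h.normSqCovTf_eq hn hx]

lemma add_two_mul_innerTfCovT (h : IsLagrangianChart c G J F U V) (hn : n ≠ 0) (hx : x ∈ U) :
    ((n : ℝ) + 2) * innerTfCovT G J F x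
      = cubicPairing (indMetric G F) x ((metricTrace (indMetric G F) x).comp
          (cubicHess (indMetric G F) (cubicForm G J F) x)) (tfCubicForm G J F x) := by
  have hg := h.isMetricOn
  have hn' : (n : ℝ) ≠ 0 := by exact_mod_cast hn
  have hdiv := hg.cubicPairing_div_cubicHess_tracefreePart hx h.contDiffOn_cubicForm
    (fun _ hy => h.isSymmCubic_cubicForm hy) (fun _ hy => h.codazzi_equation hy)
    (h.isSymmCubic_tfCubicForm hx) (h.metricTrace_tfCubicForm hx)
  rw [h.innerTfCovT_eq hn hx, hg.cubicPairing_comm hx, mul_left_comm]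
  refine (congrArg (1 / (n : ℝ) * ·) hdiv).trans ?_
  field_simp

lemma normSqMeanCurv_eq_dotProduct (h : IsLagrangianChart c G J F U V) (hn : n ≠ 0) (hx : x ∈ U)
    (he : IsOrthonormalFrame (indMetric G F) x e) {b : Fin n → ℝ}
    (hb : ∀ a, b a
      = 1 / ((n : ℝ) + 2) * metricTrace (indMetric G F) x (cubicForm G J F x) (e a)) :
    (n : ℝ) ^ 2 / ((n : ℝ) + 2) * normSqMeanCurv G F x = ((n : ℝ) + 2) * (b ⬝ᵥ b) := by
  have hn' : (n : ℝ) ≠ 0 := by exact_mod_cast hn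
  rw [h.normSqMeanCurv_eq hx he, dotProduct, Finset.mul_sum, Finset.mul_sum]
  refine Finset.sum_congr rfl fun a _ => ?_
  rw [hb]
  field_simp

theorem simons_inequality (h : IsLagrangianChart c G J F U V) (hn : n ≠ 0) (hx : x ∈ U) :
    (1 / 2) * laplacian (indMetric G F) (normSqTf G J F) x ≥
      ((n : ℝ) + 2) * innerTfCovT G J F x + normSqCovTf G J F x
        + ((n : ℝ) + 1) * c * normSqTf G J F x
        + (n : ℝ) ^ 2 / ((n : ℝ) + 2) * normSqTf G J F x * normSqMeanCurv G F x
        - ((n : ℝ) + 3) / 2 * normSqTf G J F x ^ 2 := by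
  have hg := h.isMetricOn
  have hsymm := h.isSymmCubic_tfCubicForm hx
  obtain ⟨e, he⟩ := hg.exists_orthonormalFrame hx
  have : Nonempty (Fin n) := ⟨⟨0, Nat.pos_of_ne_zero hn⟩⟩
  set t := components e (tfCubicForm G J F x)
  set b : Fin n → ℝ := fun a =>
    1 / ((n : ℝ) + 2) * metricTrace (indMetric G F) x (cubicForm G J F x) (e a)
  have hC : components e (cubicForm G J F x) = t + kronSym b := components_eq_add_kronSym he _
  have hnorm : normSqTf G J F x = (sliceGram t t).trace := by
    rw [h.normSqTf_eq hn hx, hg.cubicPairing_eq_trace_sliceGram hx he _ hsymm]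
  have hmean := h.normSqMeanCurv_eq_dotProduct hn hx he (b := b) fun _ => rfl
  have hsimons := hg.simons_identity hx he h.contDiffOn_cubicForm
    (fun _ hy => h.isSymmCubic_cubicForm hy) (fun _ hy => h.codazzi_equation hy) hsymm
  have hbound := (hg.isTracefreeSymm_components hx he hsymm
    (h.metricTrace_tfCubicForm hx)).curvContraction_gaussCurvature_le b c
  rw [← h.add_two_mul_innerTfCovT hn hx, h.curvComponents_eq hx he, hC] at hsimons
  rw [Fintype.card_fin, ← hmean, ← hnorm] at hbound
  rw [h.half_laplacian_normSqTf hn hx, hsimons]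
  linarith

end IsLagrangianChart

end SimonsInequality

/-! ### Coordinate expressions -/

section Charts

variable {m : ℕ} {N : Type*} [TopologicalSpace N] [ChartedSpace (Coord m) N]
  {ψ : OpenPartialHomeomorph N (Coord m)} {y : Coord m} {q : N}

lemma mdifferentiable_of_mem_maximalAtlas (hψ : ψ ∈ IsManifold.maximalAtlas (𝓡 m) ∞ N) :
    ψ.MDifferentiable (𝓡 m) (𝓡 m) :=
  ⟨(contMDiffOn_of_mem_maximalAtlas hψ).mdifferentiableOn (by simp),
    (contMDiffOn_symm_of_mem_maximalAtlas hψ).mdifferentiableOn (by simp)⟩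

lemma chartDeriv_chartSymmDeriv (hψ : ψ ∈ IsManifold.maximalAtlas (𝓡 m) ∞ N) (hy : y ∈ ψ.target)
    (v : Coord m) : chartDeriv ψ (ψ.symm y) (chartSymmDeriv ψ y v) = v :=
  DFunLike.congr_fun ((mdifferentiable_of_mem_maximalAtlas hψ).comp_symm_deriv hy) v

lemma chartSymmDeriv_chartDeriv (hψ : ψ ∈ IsManifold.maximalAtlas (𝓡 m) ∞ N) (hy : y ∈ ψ.target)
    (v : TangentSpace (𝓡 m) (ψ.symm y)) :
    chartSymmDeriv ψ y (chartDeriv ψ (ψ.symm y) v) = v := by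
  have hcomp := (mdifferentiable_of_mem_maximalAtlas hψ).symm_comp_deriv (ψ.map_target hy)
  rw [ψ.right_inv hy] at hcomp
  exact DFunLike.congr_fun hcomp v

lemma chartSymmDeriv_injective (hψ : ψ ∈ IsManifold.maximalAtlas (𝓡 m) ∞ N) (hy : y ∈ ψ.target) :
    Function.Injective (chartSymmDeriv ψ y) :=
  Function.LeftInverse.injective (chartDeriv_chartSymmDeriv hψ hy)

lemma chartSymmDeriv_endInChart (hψ : ψ ∈ IsManifold.maximalAtlas (𝓡 m) ∞ N) (hy : y ∈ ψ.target)
    (J : ∀ q : N, TangentSpace (𝓡 m) q →L[ℝ] TangentSpace (𝓡 m) q) (v : Coord m) :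
    chartSymmDeriv ψ y (endInChart J ψ y v) = J (ψ.symm y) (chartSymmDeriv ψ y v) :=
  chartSymmDeriv_chartDeriv hψ hy _

lemma endInChart_chartDeriv (hψ : ψ ∈ IsManifold.maximalAtlas (𝓡 m) ∞ N) (hq : q ∈ ψ.source)
    (J : ∀ q : N, TangentSpace (𝓡 m) q →L[ℝ] TangentSpace (𝓡 m) q) (a : TangentSpace (𝓡 m) q) :
    endInChart J ψ (ψ q) (chartDeriv ψ q a) = chartDeriv ψ q (J q a) := by
  obtain ⟨y, hy, rfl⟩ : ∃ y ∈ ψ.target, ψ.symm y = q := ⟨ψ q, ψ.map_source hq, ψ.left_inv hq⟩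
  rw [ψ.right_inv hy]
  exact congrArg (fun w => chartDeriv ψ (ψ.symm y) (J (ψ.symm y) w))
    (chartSymmDeriv_chartDeriv hψ hy a)

variable [IsManifold (𝓡 m) ∞ N]

lemma contMDiffOn_chartSymmDeriv (hψ : ψ ∈ IsManifold.maximalAtlas (𝓡 m) ∞ N) (v : Coord m) :
    ContMDiffOn 𝓘(ℝ, Coord m) (𝓡 m).tangent ∞ (fun y => Bundle.TotalSpace.mk' (Coord m)
      (E := fun q : N => TangentSpace (𝓡 m) q) (ψ.symm y) (chartSymmDeriv ψ y v)) ψ.target := by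
  have htangent := (contMDiffOn_symm_of_mem_maximalAtlas hψ).contMDiffOn_tangentMapWithin (m := ∞)
    (by simp) ψ.open_target.uniqueMDiffOn
  have hconst : ContMDiffOn 𝓘(ℝ, Coord m) (𝓡 m).tangent ∞ (fun y => Bundle.TotalSpace.mk' (Coord m)
      (E := fun q : Coord m => TangentSpace (𝓡 m) q) y v) ψ.target :=
    contMDiffOn_vectorSpace_iff_contDiffOn.2 contDiffOn_const
  refine (htangent.comp hconst fun y hy => hy).congr fun y hy => ?_
  simp only [Function.comp_apply, tangentMapWithin, chartSymmDeriv,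
    mfderivWithin_of_isOpen ψ.open_target hy]
  rfl

lemma contDiffOn_metricInChart (hψ : ψ ∈ IsManifold.maximalAtlas (𝓡 m) ∞ N)
    (g : Bundle.ContMDiffRiemannianMetric (𝓡 m) ∞ (Coord m) (fun q : N => TangentSpace (𝓡 m) q)) :
    ContDiffOn ℝ ∞ (metricInChart g ψ) ψ.target := by
  refine contDiffOn_clm_apply.2 fun u => contDiffOn_clm_apply.2 fun v => ?_
  rw [← contMDiffOn_iff_contDiffOn]
  intro y hy
  have hinner : ContMDiffWithinAt 𝓘(ℝ, Coord m) ((𝓡 m).prod 𝓘(ℝ)) ∞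
      (fun y => Bundle.TotalSpace.mk' ℝ (E := Bundle.Trivial N ℝ) (ψ.symm y)
        (g.inner (ψ.symm y) (chartSymmDeriv ψ y u) (chartSymmDeriv ψ y v))) ψ.target y := by
    apply ContMDiffWithinAt.clm_bundle_apply₂ (F₁ := Coord m) (F₂ := Coord m)
    · exact ContMDiffAt.comp_contMDiffWithinAt y g.contMDiff.contMDiffAt
        (contMDiffOn_symm_of_mem_maximalAtlas hψ y hy)
    · exact contMDiffOn_chartSymmDeriv hψ u y hy
    · exact contMDiffOn_chartSymmDeriv hψ v y hy
  simp only [Bundle.contMDiffWithinAt_totalSpace] at hinner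
  exact hinner.2

lemma metricInChart_apply
    (g : Bundle.ContMDiffRiemannianMetric (𝓡 m) ∞ (Coord m) (fun q : N => TangentSpace (𝓡 m) q))
    (y u v : Coord m) : metricInChart g ψ y u v =
      g.inner (ψ.symm y) (chartSymmDeriv ψ y u) (chartSymmDeriv ψ y v) := rfl

lemma metricInChart_chartDeriv (hψ : ψ ∈ IsManifold.maximalAtlas (𝓡 m) ∞ N) (hq : q ∈ ψ.source)
    (g : Bundle.ContMDiffRiemannianMetric (𝓡 m) ∞ (Coord m) (fun q : N => TangentSpace (𝓡 m) q))
    (a b : TangentSpace (𝓡 m) q) :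
    metricInChart g ψ (ψ q) (chartDeriv ψ q a) (chartDeriv ψ q b) = g.inner q a b := by
  obtain ⟨y, hy, rfl⟩ : ∃ y ∈ ψ.target, ψ.symm y = q := ⟨ψ q, ψ.map_source hq, ψ.left_inv hq⟩
  rw [ψ.right_inv hy, metricInChart_apply, chartSymmDeriv_chartDeriv hψ hy,
    chartSymmDeriv_chartDeriv hψ hy]

lemma isMetricOn_metricInChart (hψ : ψ ∈ IsManifold.maximalAtlas (𝓡 m) ∞ N)
    (g : Bundle.ContMDiffRiemannianMetric (𝓡 m) ∞ (Coord m) (fun q : N => TangentSpace (𝓡 m) q)) :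
    IsMetricOn (metricInChart g ψ) ψ.target := by
  refine ⟨ψ.open_target, contDiffOn_metricInChart hψ g, fun y _ u v => ?_, fun y hy u hu => ?_⟩
  · rw [metricInChart_apply, metricInChart_apply, g.symm]
  · rw [metricInChart_apply]
    refine g.pos _ _ fun h0 => hu ?_
    rw [← chartDeriv_chartSymmDeriv hψ hy u, h0, map_zero]

lemma contDiffOn_endInChart (hψ : ψ ∈ IsManifold.maximalAtlas (𝓡 m) ∞ N)
    {J : ∀ q : N, TangentSpace (𝓡 m) q →L[ℝ] TangentSpace (𝓡 m) q}
    (hJ : ContMDiff (𝓡 m) ((𝓡 m).prod 𝓘(ℝ, Coord m →L[ℝ] Coord m)) ∞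
      (fun q : N => Bundle.TotalSpace.mk' (Coord m →L[ℝ] Coord m)
        (E := fun q : N => TangentSpace (𝓡 m) q →L[ℝ] TangentSpace (𝓡 m) q) q (J q))) :
    ContDiffOn ℝ ∞ (endInChart J ψ) ψ.target := by
  refine contDiffOn_clm_apply.2 fun v => ?_
  rw [← contMDiffOn_iff_contDiffOn]
  have hfield : ContMDiffOn 𝓘(ℝ, Coord m) (𝓡 m).tangent ∞ (fun y => Bundle.TotalSpace.mk' (Coord m)
      (E := fun q : N => TangentSpace (𝓡 m) q) (ψ.symm y)
      (J (ψ.symm y) (chartSymmDeriv ψ y v))) ψ.target := by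
    intro y hy
    apply ContMDiffWithinAt.clm_bundle_apply (F₁ := Coord m) (F₂ := Coord m)
    · exact ContMDiffAt.comp_contMDiffWithinAt y hJ.contMDiffAt
        (contMDiffOn_symm_of_mem_maximalAtlas hψ y hy)
    · exact contMDiffOn_chartSymmDeriv hψ v y hy
  have htangent := ((contMDiffOn_of_mem_maximalAtlas hψ).contMDiffOn_tangentMapWithin (m := ∞)
    (by simp) ψ.open_source.uniqueMDiffOn).comp hfield fun y hy => ψ.map_target hy
  have hsnd := (contMDiff_snd_tangentBundle_modelSpace (n := ∞) (Coord m) (𝓡 m)).comp_contMDiffOn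
    htangent
  refine hsnd.congr fun y hy => ?_
  have hderiv := mfderivWithin_of_isOpen (I := 𝓡 m) (I' := 𝓡 m) (f := ψ) ψ.open_source
    (ψ.map_target hy)
  exact (DFunLike.congr_fun hderiv (J (ψ.symm y) (chartSymmDeriv ψ y v))).symm

end Charts

section Immersions

variable {n m : ℕ} {N : Type*} [TopologicalSpace N] [ChartedSpace (Coord m) N]
  {M : Type*} [TopologicalSpace M] [ChartedSpace (Coord n) M] {f : M → N}
  {φ : OpenPartialHomeomorph M (Coord n)} {ψ : OpenPartialHomeomorph N (Coord m)} {y : Coord n}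

/-- The domain of the coordinate expression `ψ ∘ f ∘ φ⁻¹` of `f`. -/
def chartDomain (f : M → N) (φ : OpenPartialHomeomorph M (Coord n))
    (ψ : OpenPartialHomeomorph N (Coord m)) : Set (Coord n) :=
  φ.target ∩ φ.symm ⁻¹' (f ⁻¹' ψ.source)

lemma fderiv_coordinateExpression (hf : ContMDiff (𝓡 n) (𝓡 m) ∞ f)
    (hφ : φ ∈ IsManifold.maximalAtlas (𝓡 n) ∞ M) (hψ : ψ ∈ IsManifold.maximalAtlas (𝓡 m) ∞ N)
    (hy : y ∈ chartDomain f φ ψ) (v : Coord n) :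
    fderiv ℝ (ψ ∘ f ∘ φ.symm) y v =
      chartDeriv ψ (f (φ.symm y)) (mfderiv (𝓡 n) (𝓡 m) f (φ.symm y) (chartSymmDeriv φ y v)) := by
  have hφ_symm := (mdifferentiable_of_mem_maximalAtlas hφ).mdifferentiableAt_symm hy.1
  have hψ_at := (mdifferentiable_of_mem_maximalAtlas hψ).mdifferentiableAt hy.2
  have hf_at := hf.mdifferentiableAt (x := φ.symm y) (by simp)
  rw [← mfderiv_eq_fderiv, mfderiv_comp y (g := ψ) (f := f ∘ φ.symm) hψ_at
    (hf_at.comp y hφ_symm), mfderiv_comp y hf_at hφ_symm]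
  rfl

lemma fderiv_coordinateExpression_chartDeriv (hf : ContMDiff (𝓡 n) (𝓡 m) ∞ f)
    (hφ : φ ∈ IsManifold.maximalAtlas (𝓡 n) ∞ M) (hψ : ψ ∈ IsManifold.maximalAtlas (𝓡 m) ∞ N)
    (hy : y ∈ chartDomain f φ ψ) (u : TangentSpace (𝓡 n) (φ.symm y)) :
    fderiv ℝ (ψ ∘ f ∘ φ.symm) y (chartDeriv φ (φ.symm y) u) =
      chartDeriv ψ (f (φ.symm y)) (mfderiv (𝓡 n) (𝓡 m) f (φ.symm y) u) := by
  rw [fderiv_coordinateExpression hf hφ hψ hy, chartSymmDeriv_chartDeriv hφ hy.1]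

variable [IsManifold (𝓡 m) ∞ N]

theorem isImmersionChart_coordinateExpression
    (g : Bundle.ContMDiffRiemannianMetric (𝓡 m) ∞ (Coord m) (fun q : N => TangentSpace (𝓡 m) q))
    (hf : ContMDiff (𝓡 n) (𝓡 m) ∞ f)
    (himm : ∀ p, Function.Injective (mfderiv (𝓡 n) (𝓡 m) f p))
    (hφ : φ ∈ IsManifold.maximalAtlas (𝓡 n) ∞ M) (hψ : ψ ∈ IsManifold.maximalAtlas (𝓡 m) ∞ N) :
    IsImmersionChart (metricInChart g ψ) (ψ ∘ f ∘ φ.symm) (chartDomain f φ ψ) ψ.target where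
  metric := isMetricOn_metricInChart hψ g
  isOpen := φ.isOpen_inter_preimage_symm (ψ.open_source.preimage hf.continuous)
  smooth := by
    rw [← contMDiffOn_iff_contDiffOn]
    exact (contMDiffOn_of_mem_maximalAtlas hψ).comp (hf.comp_contMDiffOn
      ((contMDiffOn_symm_of_mem_maximalAtlas hφ).mono Set.inter_subset_left)) fun y hy => hy.2
  mapsTo _ hy := ψ.map_source hy.2
  injective y hy u v huv := by
    rw [fderiv_coordinateExpression hf hφ hψ hy, fderiv_coordinateExpression hf hφ hψ hy] at huv
    exact chartSymmDeriv_injective hφ hy.1 (himm _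
      ((mdifferentiable_of_mem_maximalAtlas hψ).mfderiv_injective hy.2 huv))

end Immersions

section LagrangianImmersions

variable {n : ℕ} {c : ℝ} {N : Type*} [TopologicalSpace N] [ChartedSpace (Coord (2 * n)) N]
  [IsManifold (𝓡 (2 * n)) ∞ N] {S : ComplexSpaceForm n c N}
  {M : Type*} [TopologicalSpace M] [ChartedSpace (Coord n) M]
  {f : M → N} {φ : OpenPartialHomeomorph M (Coord n)}
  {ψ : OpenPartialHomeomorph N (Coord (2 * n))}

theorem IsLagrangianImmersion.isLagrangianChart (hf : IsLagrangianImmersion S f)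
    (hφ : φ ∈ IsManifold.maximalAtlas (𝓡 n) ∞ M)
    (hψ : ψ ∈ IsManifold.maximalAtlas (𝓡 (2 * n)) ∞ N) :
    IsLagrangianChart c (metricInChart S.metric ψ) (endInChart S.J ψ) (ψ ∘ f ∘ φ.symm)
      (chartDomain f φ ψ) ψ.target where
  toIsImmersionChart :=
    isImmersionChart_coordinateExpression S.metric hf.smooth hf.immersion hφ hψ
  J_smooth := contDiffOn_endInChart hψ S.J_smooth
  J_sq y hy v := chartSymmDeriv_injective hψ hy <| by
    rw [chartSymmDeriv_endInChart hψ hy, chartSymmDeriv_endInChart hψ hy, S.J_sq, map_neg]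
  J_orth y hy v w := by
    rw [metricInChart_apply, chartSymmDeriv_endInChart hψ hy, chartSymmDeriv_endInChart hψ hy,
      S.J_orthogonal, metricInChart_apply]
  J_parallel := S.J_parallel ψ hψ
  hol := S.holomorphic_sectional_curvature ψ hψ
  isotropic y hy u v := by
    rw [fderiv_coordinateExpression hf.smooth hφ hψ hy,
      fderiv_coordinateExpression hf.smooth hφ hψ hy, Function.comp_apply, Function.comp_apply,
      endInChart_chartDeriv hψ hy.2, metricInChart_chartDeriv hψ hy.2]
    exact (hf.lagrangian _ _).1 ⟨_, rfl⟩ _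
  normal y hy w hw := by
    obtain ⟨w, rfl⟩ := (mdifferentiable_of_mem_maximalAtlas hψ).mfderiv_surjective hy.2 w
    obtain ⟨v, rfl⟩ := (hf.lagrangian (φ.symm y) w).2 fun u => by
      refine (metricInChart_chartDeriv hψ hy.2 S.metric _ w).symm.trans ?_
      rw [← fderiv_coordinateExpression_chartDeriv hf.smooth hφ hψ hy]
      exact hw (chartDeriv φ (φ.symm y) u)
    refine ⟨chartDeriv φ (φ.symm y) v, ?_⟩
    rw [fderiv_coordinateExpression_chartDeriv hf.smooth hφ hψ hy]
    exact endInChart_chartDeriv hψ hy.2 _ _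

end LagrangianImmersions

end LagrangianSimons

end

open LagrangianSimons in
/-- Simons' type inequality for Lagrangian submanifolds of complex space forms, at every point `p`
and in all local coordinates `φ` around `p` and `ψ` around `f p`. -/
theorem mainTheorem3 (n : ℕ) (hn : 2 ≤ n) (c : ℝ)
    {N : Type*} [TopologicalSpace N] [ChartedSpace (Coord (2 * n)) N]
    [IsManifold (𝓡 (2 * n)) ∞ N] (S : ComplexSpaceForm n c N)
    {M : Type*} [TopologicalSpace M] [ChartedSpace (Coord n) M] [IsManifold (𝓡 n) ∞ M]
    (f : M → N) (hf : IsLagrangianImmersion S f) (p : M)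
    (φ : OpenPartialHomeomorph M (Coord n)) (hφ : φ ∈ IsManifold.maximalAtlas (𝓡 n) ∞ M)
    (hpφ : p ∈ φ.source)
    (ψ : OpenPartialHomeomorph N (Coord (2 * n)))
    (hψ : ψ ∈ IsManifold.maximalAtlas (𝓡 (2 * n)) ∞ N) (hpψ : f p ∈ ψ.source)
    (G : Coord (2 * n) → Coord (2 * n) →L[ℝ] Coord (2 * n) →L[ℝ] ℝ)
    (hG : G = metricInChart S.metric ψ)
    (J : Coord (2 * n) → Coord (2 * n) →L[ℝ] Coord (2 * n)) (hJ : J = endInChart S.J ψ)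
    (F : Coord n → Coord (2 * n)) (hF : F = ψ ∘ f ∘ φ.symm)
    (x : Coord n) (hx : x = φ p) :
    (1 / 2) * laplacian (indMetric G F) (normSqTf G J F) x ≥
      ((n : ℝ) + 2) * innerTfCovT G J F x + normSqCovTf G J F x
        + ((n : ℝ) + 1) * c * normSqTf G J F x
        + (n : ℝ) ^ 2 / ((n : ℝ) + 2) * normSqTf G J F x * normSqMeanCurv G F x
        - ((n : ℝ) + 3) / 2 * normSqTf G J F x ^ 2 := by
  subst hG hJ hF hx
  exact (hf.isLagrangianChart hφ hψ).simons_inequality (by omega)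
    ⟨φ.map_source hpφ, by simpa [φ.left_inv hpφ] using hpψ⟩
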